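/- Let $m,n,r\ge 0$ be integers, $N=m+n$, $\mathcal Z=\mathbb Z[\upsilon,\upsilon^{-1}]$, $q=\upsilon^2$. Write $\widehat h=0$ for $1\le h\le m$ and $\widehat h=1$ for $m<h\le N$. **Hecke algebra.** Let $W=\mathfrak S_r$ with simple transpositions $s_k=(k,k+1)$ and length $\ell$, and let $\mathcal H$ be its Hecke algebra over $\mathcal Z$: it is free with basis $T_w$ $(w\in W)$, and $T_wT_s=T_{ws}$ if $\ell(ws)>\ell(w)$, $T_wT_s=(q-1)T_w+qT_{ws}$ otherwise. For $\lambda\in\Lambda(N,r)=\{\lambda\in\mathbb N^N:\sum\lambda_i=r\}$ let $N^\lambda_1,\dots,N^\lambda_N$ be the consecutive blocks of $\{1,\dots,r\}$ of sizes $\lambda_i$, let $W_\lambda$ be their stabilizer, and let $W_{\lambda^{(0)}}$, $W_{\lambda^{(1)}}$ be the subgroups of the elements of $W_\lambda$ that fix every point of the blocks of index $>m$, respectively $\le m$. For a subgroup $P\le W$ let $\mathcal D_P$ be the set of shortest representatives of the right cosets $Pw$. **The algebra $\mathcal S(m|n,r)$.** Put $[xy]_\lambda=\sum_{w\in W_{\lambda^{(0)}}}T_w\cdot\sum_{w\in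 W_{\lambda^{(1)}}}(-q)^{-\ell(w)}T_w$, $\mathfrak T=\bigoplus_{\lambda\in\Lambda(N,r)}[xy]_\lambda\mathcal H$ and $\mathcal S(m|n,r)=\mathrm{End}_{\mathcal H}(\mathfrak T)$. Let $\mathcal D^\circ_{\lambda\mu}$ be the set of $d\in\mathcal D_{W_\lambda}\cap\mathcal D_{W_\mu}^{-1}$ with $d^{-1}W_{\lambda^{(0)}}d\cap W_{\mu^{(1)}}=1=d^{-1}W_{\lambda^{(1)}}d\cap W_{\mu^{(0)}}$, and let $M(m|n,r)$ be the set of the matrices $A=(a_{i,j})$, $a_{i,j}=|N^\lambda_i\cap d(N^\mu_j)|$, for $\lambda,\mu\in\Lambda(N,r)$, $d\in\mathcal D^\circ_{\lambda\mu}$; here $A$ determines $\lambda=\mathrm{ro}(A)$ (row sums), $\mu=\mathrm{co}(A)$ (column sums) and $d$. Let $W_\nu=d^{-1}W_\lambda d\cap W_\mu$. Then $\phi_A\in\mathcal S(m|n,r)$ is given by $$\phi_A([xy]_\alpha h)=\delta_{\mu,\alpha}\,[xy]_\lambda T_d\,T_{\mathcal D_{W_\nu}\cap W_\mu}h,\qquad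 T_D=\sum_{w_0\in D\cap W_{\mu^{(0)}},\,w_1\in D\cap W_{\mu^{(1)}}}T_{w_0}(-q)^{-\ell(w_1)}T_{w_1}.$$ **The tensor superspace.** Let $V=V(m|n)$ be the free $\mathcal Z$-module with basis $v_1,\dots,v_N$. Then $\mathcal H$ acts on the right of $V^{\otimes r}$, with basis $v_{\mathbf i}=v_{i_1}\otimes\cdots\otimes v_{i_r}$, by $$v_{\mathbf i}T_{s_k}=\begin{cases}(-1)^{\widehat{i_k}\widehat{i_{k+1}}}v_{\mathbf is_k},&i_k<i_{k+1},\\ q\,v_{\mathbf i},&i_k=i_{k+1}\le m,\\ -v_{\mathbf i},&i_k=i_{k+1}>m,\\ (-1)^{\widehat{i_k}\widehat{i_{k+1}}}q\,v_{\mathbf is_k}+(q-1)v_{\mathbf i},&i_k>i_{k+1},\end{cases}$$ where $(\mathbf iw)_k=i_{w(k)}$. Let $\mathbf i_\lambda=(1^{\lambda_1},2^{\lambda_2},\dots,N^{\lambda_N})$. For $A\in M(m|n,r)$ with $\lambda,\mu,d,\nu$ as above, let $e_A$ be the endomorphism with $v_{\mathbf i_\mu}\mapsto v_{\mathbf i_\lambda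 d}$ that kills all other $v_{\mathbf i}$, and let $\zeta_A$ be its relative norm $$\zeta_A(v)=\sum_{x\in\mathcal D_{W_\nu}}q^{-\ell(x)}\,e_A(vT_{x^{-1}})\,T_x .$$ Endomorphisms of $V^{\otimes r}$ are written on the left and $\mathrm{End}_{\mathcal H}(V^{\otimes r})$ is multiplied by composition. Put $\phi_B=0$ and $\zeta_B=0$ for matrices $B\notin M(m|n,r)$. **Coefficients.** Set $\dot q_h=1,\ \ddot q_h=q,\ q_h=q$ for $h\le m$ and $\dot q_h=-q^{-1},\ \ddot q_h=-1,\ q_h=q^{-1}$ for $h>m$; $[\![s]\!]_x=1+x+\cdots+x^{s-1}$; $\widehat A=\sum_{m<k<i\le N,\ 1\le j<l\le N}a_{i,j}a_{k,l}$. For $A\in M(m|n,r)$ and $1\le h<N$ let $D^+_h,D^-_h\in M(m|n,r)$, when they exist, be the matrices such that $D^+_h-E_{h,h+1}$, $D^-_h-E_{h+1,h}$ are diagonal and $\mathrm{co}(D^\pm_h)=\mathrm{ro}(A)$; let $A^+_{h,k}=A+E_{h,k}-E_{h+1,k}$ (if $a_{h+1,k}\ge1$) and $A^-_{h,k}=A-E_{h,k}+E_{h+1,k}$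 (if $a_{h,k}\ge1$). Put $$f^+_{h,k}(q,A)=\dot q_{h+1}^{\,\sum_{j<k}a_{h+1,j}}\ \ddot q_h^{\,\sum_{j>k}a_{h,j}},\qquad f^-_{h,k}(q,A)=\dot q_h^{\,\sum_{j>k}a_{h,j}}\ \ddot q_{h+1}^{\,\sum_{j<k}a_{h+1,j}},$$ and let $f_k,g_k$ be the coefficients of Du and Gu: $$f_k(q,A,h)=\begin{cases}q^{\sum_{j>k}a_{h,j}}&(h<m)\\(-1)^{\sum_{i>m,j<k}a_{i,j}}q^{-\sum_{j<k}a_{m+1,j}+\sum_{j>k}a_{m,j}}&(h=m)\\q^{-\sum_{j<k}a_{h+1,j}}&(h>m)\end{cases}\qquad g_k(q,A,h)=\begin{cases}q^{\sum_{j<k}a_{h+1,j}}&(h<m)\\(-1)^{\sum_{i>m,j<k}a_{i,j}}&(h=m)\\q^{-\sum_{j>k}a_{h,j}}&(h>m).\end{cases}$$ **Statement.** Let $A\in M(m|n,r)$ and $1\le h<N$, with $D_h^+$ (respectively $D_h^-$) in $M(m|n,r)$ in the assertions that involve it. 1. $(-1)^{\widehat{D^+_h}+\widehat A+\widehat{A^+_{h,k}}}f^+_{h,k}(q,A)=f_k(q,A,h)$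 whenever $a_{h+1,k}\ge1$, and $(-1)^{\widehat{D^-_h}+\widehat A+\widehat{A^-_{h,k}}}f^-_{h,k}(q,A)=g_k(q,A,h)$ whenever $a_{h,k}\ge1$. 2. The $\phi_A$ are well defined, the $\zeta_A$ are $\mathcal H$-linear, and there is an isomorphism $\psi:V^{\otimes r}\to\mathfrak T$ of right $\mathcal H$-modules with $v_{\mathbf i_\lambda}\mapsto[xy]_\lambda$ for all $\lambda$; the algebra isomorphism $\mathrm{End}_{\mathcal H}(V^{\otimes r})\to\mathcal S(m|n,r)$, $f\mapsto\psi f\psi^{-1}$, maps $\zeta_A$ to $(-1)^{\widehat A}\phi_A$. 3. In $\mathcal S(m|n,r)$, $$\phi_{D^+_h}\phi_A=\sum_{k:\,a_{h+1,k}\ge1}f^+_{h,k}(q,A)[\![a_{h,k}+1]\!]_{q_h}\phi_{A^+_{h,k}},\qquad \phi_{D^-_h}\phi_A=\sum_{k:\,a_{h,k}\ge1}f^-_{h,k}(q,A)[\![a_{h+1,k}+1]\!]_{q_{h+1}}\phi_{A^-_{h,k}},$$ and these formulas, rewritten in terms of the $\zeta_A$, are the formulas of Du and Gu in $\mathrm{End}_{\mathcal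 H}(V^{\otimes r})$: $$\zeta_{D^+_h}\zeta_A=\sum_{k:\,a_{h+1,k}\ge1}f_k(q,A,h)[\![a_{h,k}+1]\!]_{q_h}\zeta_{A^+_{h,k}},\qquad \zeta_{D^-_h}\zeta_A=\sum_{k:\,a_{h,k}\ge1}g_k(q,A,h)[\![a_{h+1,k}+1]\!]_{q_{h+1}}\zeta_{A^-_{h,k}}.$$ -/

import Mathlib

noncomputable section

namespace QSchur

open Equiv

/-! ## The symmetric group and its length function -/

/-- The basic transposition `s_k = (k, k+1)` of the `r` letters `0, …, r - 1`. -/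
def adj {r : ℕ} (k : Fin (r - 1)) : Perm (Fin r) :=
  swap ⟨k, by omega⟩ ⟨k + 1, by omega⟩

/-- The length function of the symmetric group with respect to the basic transpositions. -/
def len {r : ℕ} (w : Perm (Fin r)) : ℕ :=
  sInf {t | ∃ l : List (Fin (r - 1)), l.length = t ∧ (l.map adj).prod = w}

/-- The set of inversions of a permutation; its cardinality is the length, see `len_eq`. -/
def inv {r : ℕ} (w : Perm (Fin r)) : Finset (Fin r × Fin r) :=
  Finset.univ.filter fun p => p.1 < p.2 ∧ w p.2 < w p.1

theorem mem_inv {r : ℕ} (w : Perm (Fin r)) (x y : Fin r) :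
    (x, y) ∈ inv w ↔ x < y ∧ w y < w x := by
  simp [inv]

theorem inv_one {r : ℕ} : inv (1 : Perm (Fin r)) = ∅ := by
  ext ⟨x, y⟩
  simp only [mem_inv, Perm.one_apply, Finset.notMem_empty, iff_false, not_and, not_lt]
  exact fun h => h.le

abbrev lo {r : ℕ} (k : Fin (r - 1)) : Fin r := ⟨k, by omega⟩
abbrev hi {r : ℕ} (k : Fin (r - 1)) : Fin r := ⟨k + 1, by omega⟩

theorem adj_eq {r : ℕ} (k : Fin (r - 1)) : adj k = swap (lo k) (hi k) := rfl

theorem adj_mul_self {r : ℕ} (k : Fin (r - 1)) : adj k * adj k = 1 := by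
  simp [adj_eq]

theorem adj_adj {r : ℕ} (k : Fin (r - 1)) (x : Fin r) : adj k (adj k x) = x := by
  simp [adj_eq]

theorem adj_lt {r : ℕ} (k : Fin (r - 1)) {x y : Fin r} (h : x < y)
    (hne : ¬ (x = lo k ∧ y = hi k)) : adj k x < adj k y := by
  simp only [adj_eq, swap_apply_def, lo, hi, Fin.ext_iff, Fin.lt_def] at *
  split_ifs <;> simp_all <;> omega

theorem inv_mul_adj {r : ℕ} (w : Perm (Fin r)) (k : Fin (r - 1)) (h : w (lo k) < w (hi k)) :
    (inv (w * adj k)).card = (inv w).card + 1 := by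
  have hlo : adj k (lo k) = hi k := by simp [adj_eq]
  have hhi : adj k (hi k) = lo k := by simp [adj_eq]
  have hlh : lo k < hi k := by simp [lo, hi, Fin.lt_def]
  have key : inv (w * adj k) =
      insert (lo k, hi k) ((inv w).map ((adj k).prodCongr (adj k)).toEmbedding) := by
    ext ⟨x, y⟩
    simp only [mem_inv, Perm.mul_apply, Finset.mem_insert, Finset.mem_map, Prod.mk.injEq,
      Prod.exists]
    constructor
    · rintro ⟨hxy, hw⟩
      by_cases hne : x = lo k ∧ y = hi k
      · exact Or.inl hne
      · exact Or.inr ⟨adj k x, adj k y, ⟨adj_lt k hxy hne, hw⟩, by simp [adj_adj]⟩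
    · rintro (⟨rfl, rfl⟩ | ⟨a, b, ⟨hab, hw⟩, h1⟩)
      · exact ⟨hlh, by rwa [hlo, hhi]⟩
      · simp only [Equiv.coe_toEmbedding, Equiv.prodCongr_apply, Prod.map_apply,
          Prod.mk.injEq] at h1
        obtain ⟨rfl, rfl⟩ := h1
        have hne : ¬ (a = lo k ∧ b = hi k) := by
          rintro ⟨rfl, rfl⟩
          exact absurd h (not_lt.2 hw.le)
        exact ⟨adj_lt k hab hne, by simpa [adj_adj] using hw⟩
  rw [key, Finset.card_insert_of_notMem, Finset.card_map]
  simp only [Finset.mem_map, Prod.exists, mem_inv,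
    not_exists, not_and, Equiv.coe_toEmbedding, Equiv.prodCongr_apply, Prod.map_apply,
    Prod.mk.injEq]
  rintro a b ⟨hab, -⟩ h1 h2
  have ha : a = hi k := by rw [← hlo, ← h1, adj_adj]
  have hb : b = lo k := by rw [← hhi, ← h2, adj_adj]
  subst ha hb
  exact absurd hab (not_lt.2 hlh.le)

theorem ne_lo_hi {r : ℕ} (w : Perm (Fin r)) (k : Fin (r - 1)) : w (lo k) ≠ w (hi k) := by
  simp [lo, hi]

theorem inv_mul_adj' {r : ℕ} (w : Perm (Fin r)) (k : Fin (r - 1)) (h : w (hi k) < w (lo k)) :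
    (inv w).card = (inv (w * adj k)).card + 1 := by
  have := inv_mul_adj (w * adj k) k (by simpa [adj_eq] using h)
  rwa [mul_assoc, adj_mul_self, mul_one] at this

theorem eq_one_of_no_descent {r : ℕ} (w : Perm (Fin r))
    (h : ∀ k : Fin (r - 1), w (lo k) < w (hi k)) : w = 1 := by
  have hmono : StrictMono w := by
    cases r with
    | zero => intro x; exact x.elim0
    | succ r =>
      rw [Fin.strictMono_iff_lt_succ]
      intro i
      exact h i
  ext x
  have := congrArg (fun f => f x) (Subsingleton.elim (hmono.orderIsoOfSurjective _ w.surjective)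
    (OrderIso.refl _))
  simpa using congrArg Fin.val this

theorem exists_word {r : ℕ} (w : Perm (Fin r)) :
    ∃ l : List (Fin (r - 1)), l.length = (inv w).card ∧ (l.map adj).prod = w := by
  induction hc : (inv w).card generalizing w with
  | zero =>
    refine ⟨[], rfl, ?_⟩
    rw [eq_one_of_no_descent w]
    · rfl
    · intro k
      by_contra hk
      have := inv_mul_adj' w k (lt_of_le_of_ne (not_lt.1 hk) (ne_lo_hi w k).symm)
      omega
  | succ t ih =>
    by_cases hd : ∀ k : Fin (r - 1), w (lo k) < w (hi k)
    · rw [eq_one_of_no_descent w hd] at hc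
      exfalso
      simp [inv_one] at hc
    · push Not at hd
      obtain ⟨k, hk⟩ := hd
      have h1 := inv_mul_adj' w k (lt_of_le_of_ne hk (ne_lo_hi w k).symm)
      obtain ⟨l, hl, hp⟩ := ih (w * adj k) (by omega)
      refine ⟨l ++ [k], by simp [hl], ?_⟩
      simp [hp, mul_assoc, adj_mul_self]

theorem inv_le_length {r : ℕ} (l : List (Fin (r - 1))) :
    (inv (l.map adj).prod).card ≤ l.length := by
  induction l using List.reverseRecOn with
  | nil => simp [inv_one]
  | append_singleton l k ih =>
    simp only [List.map_append, List.map_cons, List.map_nil, List.prod_append,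
      List.prod_singleton, List.length_append, List.length_singleton]
    rcases lt_or_gt_of_ne (ne_lo_hi (l.map adj).prod k) with h | h
    · rw [inv_mul_adj _ _ h]; omega
    · have := inv_mul_adj' _ _ h; omega

theorem len_eq {r : ℕ} (w : Perm (Fin r)) : len w = (inv w).card := by
  apply le_antisymm
  · exact Nat.sInf_le (exists_word w)
  · refine le_csInf ⟨_, exists_word w⟩ ?_
    rintro _ ⟨l, rfl, rfl⟩
    exact inv_le_length l

/-- A reduced expression of `w`: a word of minimal length in the basic transpositions. -/
theorem exists_redWord {r : ℕ} (w : Perm (Fin r)) :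
    ∃ l : List (Fin (r - 1)), l.length = len w ∧ (l.map adj).prod = w := by
  rw [len_eq]; exact exists_word w

/-- A chosen reduced expression of `w`. -/
def redWord {r : ℕ} (w : Perm (Fin r)) : List (Fin (r - 1)) := (exists_redWord w).choose

theorem len_lt_mul_adj {r : ℕ} (w : Perm (Fin r)) (k : Fin (r - 1)) :
    len w < len (w * adj k) ↔ w (lo k) < w (hi k) := by
  rw [len_eq, len_eq]
  rcases lt_or_gt_of_ne (ne_lo_hi w k) with h | h
  · simp [inv_mul_adj w k h, h]
  · have := inv_mul_adj' w k h
    constructor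
    · intro; omega
    · intro h'; exact absurd h' (not_lt.2 h.le)

theorem len_inv {r : ℕ} (w : Perm (Fin r)) : len w⁻¹ = len w := by
  have key : ∀ w : Perm (Fin r), len w⁻¹ ≤ len w := by
    intro w
    obtain ⟨l, hl, hp⟩ := exists_redWord w
    refine Nat.sInf_le ⟨l.reverse, by simp [hl], ?_⟩
    rw [← hp, List.prod_inv_reverse, List.map_map, List.map_reverse]
    congr 2
  exact le_antisymm (key w) (by simpa using key w⁻¹)

theorem len_lt_adj_mul {r : ℕ} (w : Perm (Fin r)) (k : Fin (r - 1)) :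
    len w < len (adj k * w) ↔ w⁻¹ (lo k) < w⁻¹ (hi k) := by
  rw [← len_lt_mul_adj, ← len_inv w, ← len_inv (adj k * w), mul_inv_rev]
  simp [adj_eq]

/-! ## The Hecke algebra -/

section Hecke

variable {R : Type*} [CommRing R] (q : Rˣ) (r : ℕ)

/-- The basis `{T_w}` of the free module on which the Hecke algebra will act. -/
def eb : Module.Basis (Perm (Fin r)) R (Perm (Fin r) → R) := Pi.basisFun R (Perm (Fin r))

/-- The operator `T_w ↦ T_{s_k} T_w` on the free module with basis `{T_w}`. -/
def lamOp (k : Fin (r - 1)) : Module.End R (Perm (Fin r) → R) :=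
  (eb r).constr R fun w =>
    if len w < len (adj k * w) then eb r (adj k * w)
    else ((q : R) - 1) • eb r w + (q : R) • eb r (adj k * w)

/-- The operator `T_w ↦ T_w T_{s_k}` on the free module with basis `{T_w}`. -/
def rhoOp (k : Fin (r - 1)) : Module.End R (Perm (Fin r) → R) :=
  (eb r).constr R fun w =>
    if len w < len (w * adj k) then eb r (w * adj k)
    else ((q : R) - 1) • eb r w + (q : R) • eb r (w * adj k)

theorem lamOp_single (k : Fin (r - 1)) (w : Perm (Fin r)) :
    lamOp q r k (eb r w) =
      if len w < len (adj k * w) then eb r (adj k * w)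
      else ((q : R) - 1) • eb r w + (q : R) • eb r (adj k * w) := by
  rw [lamOp, Module.Basis.constr_basis]

theorem rhoOp_single (k : Fin (r - 1)) (w : Perm (Fin r)) :
    rhoOp q r k (eb r w) =
      if len w < len (w * adj k) then eb r (w * adj k)
      else ((q : R) - 1) • eb r w + (q : R) • eb r (w * adj k) := by
  rw [rhoOp, Module.Basis.constr_basis]

theorem adj_lt_iff {r : ℕ} (k : Fin (r - 1)) {x y : Fin r} (hxy : x ≠ y)
    (h1 : ¬ (x = lo k ∧ y = hi k)) (h2 : ¬ (x = hi k ∧ y = lo k)) :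
    adj k x < adj k y ↔ x < y := by
  rcases lt_or_gt_of_ne hxy with h | h
  · simp [adj_lt k h h1, h]
  · have := adj_lt k h (fun h' => h2 ⟨h'.2, h'.1⟩)
    simp [not_lt.2 this.le, not_lt.2 h.le]

theorem desc_right {r : ℕ} (w : Perm (Fin r)) (j k : Fin (r - 1)) (hne : adj j * w ≠ w * adj k) :
    len (adj j * w) < len (adj j * w * adj k) ↔ len w < len (w * adj k) := by
  rw [len_lt_mul_adj, len_lt_mul_adj, Perm.mul_apply, Perm.mul_apply]
  apply adj_lt_iff j (ne_lo_hi w k)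
  · rintro ⟨h1, h2⟩
    apply hne
    rw [adj_eq, adj_eq, ← h1, ← h2, swap_apply_apply]
    simp
  · rintro ⟨h1, h2⟩
    apply hne
    rw [adj_eq, adj_eq, ← h1, ← h2, swap_comm, swap_apply_apply]
    simp

theorem desc_left {r : ℕ} (w : Perm (Fin r)) (j k : Fin (r - 1)) (hne : adj j * w ≠ w * adj k) :
    len (w * adj k) < len (adj j * (w * adj k)) ↔ len w < len (adj j * w) := by
  have hi : ∀ i : Fin (r - 1), (adj i)⁻¹ = adj i := fun i => by simp [adj_eq]
  have := desc_right w⁻¹ k j (fun h => hne (by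
    have := congrArg (·⁻¹) h
    simpa [hi] using this.symm))
  rw [← len_inv (w * adj k), ← len_inv (adj j * _), ← len_inv w, ← len_inv (adj j * w)]
  simpa [hi, mul_assoc] using this

theorem comm_aux {M : Type*} [AddCommGroup M] [Module R M] (e : Perm (Fin r) → M)
    (L P : Module.End R M) (j k : Fin (r - 1))
    (hL : ∀ w, L (e w) = if len w < len (adj j * w) then e (adj j * w)
      else ((q : R) - 1) • e w + (q : R) • e (adj j * w))
    (hP : ∀ w, P (e w) = if len w < len (w * adj k) then e (w * adj k)
      else ((q : R) - 1) • e w + (q : R) • e (w * adj k)) (w : Perm (Fin r)) :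
    L (P (e w)) = P (L (e w)) := by
  by_cases hne : adj j * w = w * adj k
  · have h1 : adj j * (w * adj k) = w := by rw [← hne, ← mul_assoc, adj_mul_self, one_mul]
    have h2 : w * adj k * adj k = w := by rw [mul_assoc, adj_mul_self, mul_one]
    have hL1 := hL (w * adj k)
    have hP1 := hP (w * adj k)
    have hL0 := hL w
    have hP0 := hP w
    rw [h1] at hL1
    rw [h2] at hP1
    rw [hne] at hL0
    rw [hL0, hP0]
    split_ifs with h
    · rw [hL1, hP1]
    · rw [map_add, map_add, map_smul, map_smul, map_smul, map_smul, hL1, hP1, hL0, hP0]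
  · have h1 := desc_right w j k hne
    have h2 := desc_left w j k hne
    have hL1 := hL (w * adj k)
    have hP1 := hP (adj j * w)
    rw [mul_assoc] at h1 hP1
    by_cases a : len w < len (w * adj k) <;> by_cases b : len w < len (adj j * w)
    all_goals
      simp only [h1, a, if_true, if_false] at hP1
      simp only [h2, b, if_true, if_false] at hL1
      rw [hL w, hP w]
      simp only [a, b, if_true, if_false, map_add, map_smul, hL1, hP1, hL w, hP w]
    module

theorem lamOp_rhoOp (j k : Fin (r - 1)) :
    lamOp q r j * rhoOp q r k = rhoOp q r k * lamOp q r j := by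
  refine (eb r).ext fun w => ?_
  exact comm_aux q r (eb r) (lamOp q r j) (rhoOp q r k) j k
    (lamOp_single q r j) (rhoOp_single q r k) w

/-- The algebra generated by the operators `T_w ↦ T_{s_k} T_w`. -/
def heckeSub : Subalgebra R (Module.End R (Perm (Fin r) → R)) :=
  Algebra.adjoin R (Set.range (lamOp q r))

/-- The Hecke algebra of the symmetric group on `r` letters, realised through its (faithful) left
regular representation on the free module with basis `{T_w}`.  By `HeckeT` and `HeckeT_mul_adj`
below it is free with basis `{T_w}` and obeys the defining multiplication rule
`T_w T_s = T_{ws}` if `ℓ(ws) > ℓ(w)` and `T_w T_s = (q - 1) T_w + q T_{ws}` otherwise. -/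
def Hecke : Type _ := heckeSub q r

instance : Ring (Hecke q r) :=
  Subalgebra.toRing (A := Module.End R (Perm (Fin r) → R)) (heckeSub q r)

instance : Algebra R (Hecke q r) :=
  Subalgebra.algebra (A := Module.End R (Perm (Fin r) → R)) (heckeSub q r)

/-- The left regular representation. -/
def heckeVal : Hecke q r →ₐ[R] Module.End R (Perm (Fin r) → R) := (heckeSub q r).val

theorem hecke_comm (f : Hecke q r) (k : Fin (r - 1)) :
    heckeVal q r f * rhoOp q r k = rhoOp q r k * heckeVal q r f := by
  have h : heckeSub q r ≤ Subalgebra.centralizer R {rhoOp q r k} := by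
    refine Algebra.adjoin_le ?_
    rintro _ ⟨j, rfl⟩
    rw [SetLike.mem_coe, Subalgebra.mem_centralizer_iff]
    rintro _ rfl
    exact (lamOp_rhoOp q r j k).symm
  exact ((Subalgebra.mem_centralizer_iff R).1 (h f.2) _ rfl).symm

/-- Evaluation at `T_1`. -/
def heckeEv : Hecke q r →ₗ[R] (Perm (Fin r) → R) :=
  (LinearMap.applyₗ (R := R) (eb r 1)).comp
    (heckeVal q r).toLinearMap

theorem heckeEv_apply (f : Hecke q r) :
    heckeEv q r f =
      heckeVal q r f (eb r 1) := rfl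

theorem heckeEv_injective : Function.Injective (heckeEv q r) := by
  rw [injective_iff_map_eq_zero]
  intro f hf
  apply Subtype.ext
  refine (eb r).ext fun w => ?_
  change heckeVal q r f (eb r w) = 0
  induction hc : (inv w).card generalizing w with
  | zero =>
    have : w = 1 := by
      apply eq_one_of_no_descent
      intro k
      by_contra hk
      have := inv_mul_adj' w k (lt_of_le_of_ne (not_lt.1 hk) (ne_lo_hi w k).symm)
      omega
    rw [this]; exact hf
  | succ t ih =>
    by_cases hd : ∀ k : Fin (r - 1), w (lo k) < w (hi k)
    · rw [eq_one_of_no_descent w hd, inv_one] at hc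
      simp at hc
    · push Not at hd
      obtain ⟨k, hk⟩ := hd
      have h1 := inv_mul_adj' w k (lt_of_le_of_ne hk (ne_lo_hi w k).symm)
      have h2 : w * adj k * adj k = w := by rw [mul_assoc, adj_mul_self, mul_one]
      have h3 := rhoOp_single q r k (w * adj k)
      rw [h2, if_pos (by rw [len_eq, len_eq]; omega)] at h3
      rw [← h3, ← Module.End.mul_apply, hecke_comm, Module.End.mul_apply,
        ih _ (by omega), map_zero]

theorem heckeEv_surjective : Function.Surjective (heckeEv q r) := by
  have key : ∀ w : Perm (Fin r), ∃ f, heckeEv q r f = eb r w := by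
    intro w
    obtain ⟨l, hl, hp⟩ := exists_redWord w
    induction l generalizing w with
    | nil =>
      refine ⟨1, ?_⟩
      rw [← hp]; rfl
    | cons k l ih =>
      simp only [List.map_cons, List.prod_cons] at hp
      have hw : (l.map adj).prod = adj k * w := by
        rw [← hp, ← mul_assoc, adj_mul_self, one_mul]
      have h2 : adj k * (adj k * w) = w := by rw [← mul_assoc, adj_mul_self, one_mul]
      have hle : len (adj k * w) ≤ l.length := Nat.sInf_le ⟨l, rfl, hw⟩
      have hlt : len (adj k * w) < len w := by simp at hl; omega
      have hge : len w ≤ len (adj k * w) + 1 := by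
        obtain ⟨l', hl', hp'⟩ := exists_redWord (adj k * w)
        exact Nat.sInf_le ⟨k :: l', by simp [hl'], by simp [hp', h2]⟩
      obtain ⟨f, hf⟩ := ih (adj k * w) (by simp at hl; omega) hw
      let g : Hecke q r := ⟨lamOp q r k, Algebra.subset_adjoin ⟨k, rfl⟩⟩
      have hg : heckeVal q r g = lamOp q r k := rfl
      refine ⟨g * f, ?_⟩
      rw [heckeEv_apply] at hf ⊢
      rw [map_mul, Module.End.mul_apply, hf, hg, lamOp_single, h2, if_pos hlt]
  rw [← LinearMap.range_eq_top, eq_top_iff, ← (eb (R := R) r).span_eq, Submodule.span_le]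
  rintro _ ⟨w, rfl⟩
  exact key w

/-- The basis `{T_w}` of the Hecke algebra. -/
def HeckeT : Module.Basis (Perm (Fin r)) R (Hecke q r) :=
  (eb r).map
    (LinearEquiv.ofBijective (heckeEv q r) ⟨heckeEv_injective q r, heckeEv_surjective q r⟩).symm

theorem heckeEv_T (w : Perm (Fin r)) : heckeEv q r (HeckeT q r w) = eb r w := by
  rw [HeckeT, Module.Basis.map_apply]
  exact LinearEquiv.apply_symm_apply
    (LinearEquiv.ofBijective (heckeEv q r) ⟨heckeEv_injective q r, heckeEv_surjective q r⟩) _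

theorem HeckeT_one : HeckeT q r 1 = 1 := by
  apply heckeEv_injective
  rw [heckeEv_T]; rfl

/-- The defining multiplication rule of the Hecke algebra. -/
theorem HeckeT_mul_adj (w : Perm (Fin r)) (k : Fin (r - 1)) :
    HeckeT q r w * HeckeT q r (adj k) =
      if len w < len (w * adj k) then HeckeT q r (w * adj k)
      else ((q : R) - 1) • HeckeT q r w + (q : R) • HeckeT q r (w * adj k) := by
  have hs : (eb r (adj k) : Perm (Fin r) → R) = rhoOp q r k (eb r 1) := by
    rw [rhoOp_single, one_mul, if_pos]
    rw [← one_mul (adj k), len_lt_mul_adj]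
    simp [lo, hi, Fin.lt_def]
  have hmul : heckeEv q r (HeckeT q r w * HeckeT q r (adj k)) =
      rhoOp q r k (eb r w) := by
    have h1 := heckeEv_T q r (adj k)
    have h2 := heckeEv_T q r w
    rw [heckeEv_apply] at h1 h2 ⊢
    rw [map_mul, Module.End.mul_apply, h1, hs, ← Module.End.mul_apply, hecke_comm,
      Module.End.mul_apply, h2]
  apply heckeEv_injective
  rw [hmul, rhoOp_single]
  split_ifs <;> simp only [map_add, map_smul, heckeEv_T]

end Hecke

/-! ## Compositions, parabolic subgroups, double cosets

Indices and letters are counted from `0`: the index `h` of the mathematics is `h - 1` here. -/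

/-- The compositions of `r` with `N` parts. -/
abbrev Comp (N r : ℕ) : Type := {l : Fin N → ℕ // ∑ i, l i = r}

/-- `word l k = i` means that the letter `k` lies in the `i`-th block `ℕ_i^l` of consecutive
letters, so that `word l` is the sequence `(0^{l_0}, 1^{l_1}, …)`. -/
def word {N r : ℕ} (l : Comp N r) (k : Fin r) : Fin N :=
  (finSigmaFinEquiv.symm (Fin.cast l.2.symm k)).1

/-- The parity of an index. -/
def hat (m : ℕ) {N : ℕ} (h : Fin N) : ℕ := if (h : ℕ) < m then 0 else 1

/-- The parabolic subgroup `W_l`. -/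
def par {N r : ℕ} (l : Comp N r) : Subgroup (Perm (Fin r)) where
  carrier := {w | ∀ k, word l (w k) = word l k}
  mul_mem' := by
    intro a b ha hb k
    rw [Perm.mul_apply, ha, hb]
  one_mem' := fun _ => rfl
  inv_mem' := by
    intro a ha k
    simpa using (ha (a⁻¹ k)).symm

/-- The even (`e = 0`) and odd (`e = 1`) parts of the parabolic subgroup `W_l`. -/
def parPart (m e : ℕ) {N r : ℕ} (l : Comp N r) : Subgroup (Perm (Fin r)) where
  carrier := {w | w ∈ par l ∧ ∀ k, hat m (word l k) ≠ e → w k = k}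
  mul_mem' := by
    rintro a b ⟨ha, ha'⟩ ⟨hb, hb'⟩
    refine ⟨mul_mem ha hb, fun k hk => ?_⟩
    rw [Perm.mul_apply, hb' k hk, ha' k hk]
  one_mem' := ⟨one_mem _, fun _ _ => rfl⟩
  inv_mem' := by
    rintro a ⟨ha, ha'⟩
    refine ⟨inv_mem ha, fun k hk => ?_⟩
    rw [Perm.inv_eq_iff_eq, ha' k hk]

/-- `P^d = d⁻¹ P d`. -/
def conjBy {r : ℕ} (P : Subgroup (Perm (Fin r))) (d : Perm (Fin r)) : Subgroup (Perm (Fin r)) :=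
  P.map (MulAut.conj d⁻¹).toMonoidHom

/-- The shortest representatives `d` of the right cosets `P d`. -/
def minReps {r : ℕ} (P : Subgroup (Perm (Fin r))) : Set (Perm (Fin r)) :=
  {d | ∀ p ∈ P, len d ≤ len (p * d)}

/-- `D°_{l,mu}`: the shortest `W_l`-`W_mu` double coset representatives with trivial even-odd
intersections. -/
def Dcirc (m : ℕ) {N r : ℕ} (l mu : Comp N r) : Set (Perm (Fin r)) :=
  {d | d ∈ minReps (par l) ∧ d⁻¹ ∈ minReps (par mu) ∧
    conjBy (parPart m 0 l) d ⊓ parPart m 1 mu = ⊥ ∧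
    conjBy (parPart m 1 l) d ⊓ parPart m 0 mu = ⊥}

/-- The matrix `(|ℕ_i^l ∩ d(ℕ_j^mu)|)_{i,j}`. -/
def jmat {N r : ℕ} (l : Comp N r) (d : Perm (Fin r)) (mu : Comp N r) :
    Matrix (Fin N) (Fin N) ℕ :=
  fun i j => (Finset.univ.filter fun k => word l (d k) = i ∧ word mu k = j).card

/-- The set `M(m|n,r)`. -/
def Mset (m n r : ℕ) : Set (Matrix (Fin (m + n)) (Fin (m + n)) ℕ) :=
  {A | ∃ (l mu : Comp (m + n) r) (d : Perm (Fin r)), d ∈ Dcirc m l mu ∧ jmat l d mu = A}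

/-- The group `W_{l d ∩ mu} = W_l^d ∩ W_mu`. -/
def nuPar {N r : ℕ} (l : Comp N r) (d : Perm (Fin r)) (mu : Comp N r) :
    Subgroup (Perm (Fin r)) :=
  conjBy (par l) d ⊓ par mu

/-! ## The `q`-Schur superalgebra -/

section Schur

variable {R : Type*} [CommRing R] (q : Rˣ) (m : ℕ) {N r : ℕ}

open Classical in
/-- `T_D = ∑ T_{w₀} (-q)^{-ℓ(w₁)} T_{w₁}` over `w₀ ∈ D ∩ W_{η⁽⁰⁾}`, `w₁ ∈ D ∩ W_{η⁽¹⁾}`. -/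
def TD (eta : Comp N r) (D : Set (Perm (Fin r))) : Hecke q r :=
  ∑ w₀ ∈ Finset.univ.filter fun w => w ∈ D ∧ w ∈ parPart m 0 eta,
    ∑ w₁ ∈ Finset.univ.filter fun w => w ∈ D ∧ w ∈ parPart m 1 eta,
      (((-q)⁻¹ ^ len w₁ : Rˣ) : R) • (HeckeT q r w₀ * HeckeT q r w₁)

open Classical in
/-- `[xy]_l = x_{l⁽⁰⁾} y_{l⁽¹⁾}`. -/
def xy (l : Comp N r) : Hecke q r :=
  (∑ w ∈ Finset.univ.filter fun w => w ∈ parPart m 0 l, HeckeT q r w) *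
    ∑ w ∈ Finset.univ.filter fun w => w ∈ parPart m 1 l,
      (((-q)⁻¹ ^ len w : Rˣ) : R) • HeckeT q r w

/-- The right ideal `[xy]_l H`; right `H`-modules are modules over the opposite ring. -/
def xyH (l : Comp N r) : Submodule (Hecke q r)ᵐᵒᵖ (Hecke q r) :=
  Submodule.span _ {xy q m l}

/-- The element `[xy]_l h` of `[xy]_l H`. -/
def xyMul (l : Comp N r) (h : Hecke q r) : xyH q m l :=
  MulOpposite.op h • ⟨xy q m l, Submodule.subset_span rfl⟩

theorem coe_xyMul (l : Comp N r) (h : Hecke q r) :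
    (xyMul q m l h : Hecke q r) = xy q m l * h := rfl

variable (N r) in
/-- The tensor space `⨁_l [xy]_l H`. -/
abbrev TSpace : Type _ := DirectSum (Comp N r) fun l => xyH q m l

/-- The element `[xy]_l h` of the summand `[xy]_l H` of the tensor space. -/
def inT (l : Comp N r) (h : Hecke q r) : TSpace q m N r :=
  DirectSum.of (fun l => xyH q m l) l (xyMul q m l h)

variable (N r) in
/-- The `q`-Schur superalgebra: the `H`-endomorphisms of the tensor space. -/
abbrev SAlg : Type _ := Module.End (Hecke q r)ᵐᵒᵖ (TSpace q m N r)

/-- `f` is the endomorphism `φ^d_{l,mu}`, which maps `[xy]_a h` to `δ_{mu,a} T_{W_l d W_mu} h`,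
where `T_{W_l d W_mu} = [xy]_l T_d T_{D_ν ∩ W_mu}` and `ν = l d ∩ mu`.  It is determined by this
property since the elements `[xy]_a h` span the tensor space. -/
def IsPhi (l : Comp N r) (d : Perm (Fin r)) (mu : Comp N r) (f : SAlg q m N r) : Prop :=
  ∀ (a : Comp N r) (h : Hecke q r), f (inT q m a h) =
    if a = mu then
      inT q m l (HeckeT q r d * TD q m mu (minReps (nuPar l d mu) ∩ par mu) * h)
    else 0

/-! ## The tensor superspace and its relative norm basis -/

variable (R N r) in
/-- `V(m|n)^{⊗ r}`, where `V(m|n)` is free of rank `N = m + n`. -/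
abbrev VT : Type _ := PiTensorProduct R fun _ : Fin r => (Fin N → R)

variable (R N r) in
/-- The basis of the pure tensors `v_i = v_{i_1} ⊗ ⋯ ⊗ v_{i_r}`. -/
def vb : Module.Basis (Fin r → Fin N) R (VT R N r) :=
  Basis.piTensorProduct fun _ => Pi.basisFun R (Fin N)

/-- The action of `T_{s_k}` on `V(m|n)^{⊗ r}`. -/
def tau (k : Fin (r - 1)) : Module.End R (VT R N r) :=
  (vb R N r).constr R fun i =>
    if i (lo k) < i (hi k) then
      (-1 : R) ^ (hat m (i (lo k)) * hat m (i (hi k))) • vb R N r (i ∘ adj k)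
    else if i (lo k) = i (hi k) then
      (if (i (lo k) : ℕ) < m then (q : R) else -1) • vb R N r i
    else
      ((-1 : R) ^ (hat m (i (lo k)) * hat m (i (hi k))) * (q : R)) • vb R N r (i ∘ adj k) +
        ((q : R) - 1) • vb R N r i

/-- `act h v = v h`, the right action of the Hecke algebra on `V(m|n)^{⊗ r}`: for a reduced
expression `w = s_{k_1} ⋯ s_{k_t}` one has `v T_w = (⋯(v T_{s_{k_1}})⋯) T_{s_{k_t}}`. -/
def act : Hecke q r →ₗ[R] Module.End R (VT R N r) :=
  (HeckeT q r).constr R fun w => (((redWord w).map (tau q m)).reverse).prod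

variable (N r) in
/-- `End_H(V(m|n)^{⊗ r})`, with composition of maps written on the left as multiplication; this
is the opposite of the algebra whose elements are written on the right. -/
def EndV : Subalgebra R (Module.End R (VT R N r)) :=
  Subalgebra.centralizer R (Set.range (act q m : Hecke q r →ₗ[R] Module.End R (VT R N r)))

/-- The matrix unit with `v_{i_mu} ↦ v_{i_l d}` that kills all the other `v_i`. -/
def eUnit (l : Comp N r) (d : Perm (Fin r)) (mu : Comp N r) : Module.End R (VT R N r) :=
  (vb R N r).constr R fun i => if i = word mu then vb R N r (word l ∘ d) else 0

open Classical in
/-- The relative norm `∑_{x ∈ D_ν} q^{-ℓ(x)} T_{x⁻¹} e T_x` of the above matrix unit `e`, where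
`ν = l d ∩ mu`; it maps `v` to `∑ q^{-ℓ(x)} ((v T_{x⁻¹}) e) T_x`. -/
def relNorm (l : Comp N r) (d : Perm (Fin r)) (mu : Comp N r) : Module.End R (VT R N r) :=
  ∑ x ∈ Finset.univ.filter fun x => x ∈ minReps (nuPar l d mu),
    ((q⁻¹ ^ len x : Rˣ) : R) •
      (act q m (HeckeT q r x) * eUnit l d mu * act q m (HeckeT q r x⁻¹))

/-! ## Matrices and structure constants -/

/-- The vector `ro(A)` of row sums. -/
def ro (A : Matrix (Fin N) (Fin N) ℕ) (i : Fin N) : ℕ := ∑ j, A i j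

/-- The vector `co(A)` of column sums. -/
def co (A : Matrix (Fin N) (Fin N) ℕ) (j : Fin N) : ℕ := ∑ i, A i j

/-- `D - E_{i,j}` is diagonal and `co(D) = ro(A)`. -/
def IsD (A : Matrix (Fin N) (Fin N) ℕ) (i j : Fin N) (D : Matrix (Fin N) (Fin N) ℕ) : Prop :=
  (∃ x : Fin N → ℕ, D = Matrix.diagonal x + Matrix.single i j 1) ∧ co D = ro A

/-- `A + E_{i,k} - E_{j,k}`, used only if `a_{j,k} ≥ 1`. -/
def shift (A : Matrix (Fin N) (Fin N) ℕ) (i j k : Fin N) : Matrix (Fin N) (Fin N) ℕ :=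
  A + Matrix.single i k 1 - Matrix.single j k 1

/-- `Â = ∑ a_{i,j} a_{k,l}` over `m < k < i ≤ m + n` and `1 ≤ j < l ≤ m + n`. -/
def hatM (A : Matrix (Fin N) (Fin N) ℕ) : ℕ :=
  ∑ k ∈ Finset.univ.filter fun k : Fin N => m ≤ (k : ℕ),
    ∑ i ∈ Finset.Ioi k, ∑ j, ∑ l ∈ Finset.Ioi j, A i j * A k l

/-- The parameter with one dot. -/
def qd (h : Fin N) : Rˣ := if (h : ℕ) < m then 1 else -q⁻¹

/-- The parameter with two dots. -/
def qdd (h : Fin N) : Rˣ := if (h : ℕ) < m then q else -1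

/-- The parameter `q_h`. -/
def qh (h : Fin N) : Rˣ := if (h : ℕ) < m then q else q⁻¹

/-- `⟦s⟧_x = 1 + x + ⋯ + x^{s-1}`. -/
def gint (s : ℕ) (x : R) : R := ∑ i ∈ Finset.range s, x ^ i

/-- `∑_{j<k} a_{i,j}`. -/
def sumLt (A : Matrix (Fin N) (Fin N) ℕ) (i k : Fin N) : ℕ := ∑ j ∈ Finset.Iio k, A i j

/-- `∑_{j>k} a_{i,j}`. -/
def sumGt (A : Matrix (Fin N) (Fin N) ℕ) (i k : Fin N) : ℕ := ∑ j ∈ Finset.Ioi k, A i j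

/-- `f⁺_{h,k}(q,A)`; here and below `h'` stands for `h + 1`. -/
def fPlus (A : Matrix (Fin N) (Fin N) ℕ) (h h' k : Fin N) : R :=
  ((qd q m h' ^ sumLt A h' k * qdd q m h ^ sumGt A h k : Rˣ) : R)

/-- `f⁻_{h,k}(q,A)`. -/
def fMinus (A : Matrix (Fin N) (Fin N) ℕ) (h h' k : Fin N) : R :=
  ((qd q m h ^ sumGt A h k * qdd q m h' ^ sumLt A h' k : Rˣ) : R)

/-- `∑_{i>m, j<k} a_{i,j}`. -/
def sumOdd (A : Matrix (Fin N) (Fin N) ℕ) (k : Fin N) : ℕ :=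
  ∑ i ∈ Finset.univ.filter fun i : Fin N => m ≤ (i : ℕ), sumLt A i k

/-- Du and Gu's coefficient `f_k(q,A,h)`. -/
def fDG (A : Matrix (Fin N) (Fin N) ℕ) (h h' k : Fin N) : R :=
  if (h : ℕ) + 1 < m then (q : R) ^ sumGt A h k
  else if (h : ℕ) + 1 = m then
    (-1) ^ sumOdd m A k * ((q ^ (-(sumLt A h' k : ℤ) + (sumGt A h k : ℤ)) : Rˣ) : R)
  else ((q ^ (-(sumLt A h' k : ℤ)) : Rˣ) : R)

/-- Du and Gu's coefficient `g_k(q,A,h)`. -/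
def gDG (A : Matrix (Fin N) (Fin N) ℕ) (h h' k : Fin N) : R :=
  if (h : ℕ) + 1 < m then (q : R) ^ sumLt A h' k
  else if (h : ℕ) + 1 = m then (-1) ^ sumOdd m A k
  else ((q ^ (-(sumGt A h k : ℤ)) : Rˣ) : R)

end Schur

/-- The unit `υ` of `ℤ[υ, υ⁻¹]`. -/
def vZ : (LaurentPolynomial ℤ)ˣ where
  val := LaurentPolynomial.T 1
  inv := LaurentPolynomial.T (-1)
  val_inv := by rw [← LaurentPolynomial.T_add]; simp
  inv_val := by rw [← LaurentPolynomial.T_add]; simp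

/-- The parameter `q = υ²`. -/
def qZ : (LaurentPolynomial ℤ)ˣ := vZ ^ 2

end QSchur

end

/-!
The Hecke algebra acts on sequences of indices almost by permuting them, and everything is computed
in a basis in which no signs occur. Every sequence `i` of content `λ` is `i_λ ∘ d` for a unique
shortest representative `d = std i` of a coset `W_λ d`. Multiplying `v_i` by the sign `sgn i` that
counts its inversions between odd indices gives a basis `ub` on which `T_s` acts by the rules of the
unsigned tensor space, except that it acts by `-1` on a pair of equal odd indices. The vector
`[xy]_λ` spans a one-dimensional representation of the Hecke algebra of `W_λ` with the same
eigenvalues (`xy_mul_T`), so `ub i ↦ [xy]_λ T_d` is linear over the Hecke algebra (`psiMap_tau`). It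
is injective since the coefficient of `[xy]_λ T_d` at `T_{d'}` is `δ_{d,d'}` (`repr_xy_mul_T`). This
is the isomorphism `psi`; it also shows that the operators `act`, defined by chosen reduced words,
form an action.

A double coset is determined by its matrix: the conditions on `d` say that the sequence `i_λ d`
increases along each block of `μ`, and that the matrix has no entry above `1` at a place of mixed
parity (`mem_Dcirc_iff`, `Dcirc_unique`). The relative norm is `H`-linear (`relNorm_mem`), because
the shortest coset representatives of `W_ν` either come in pairs `x`, `x s_k` or satisfy
`x s_k = s_j x` with `s_j ∈ W_ν`. At `v_{i_μ}` only its terms with `x ∈ W_μ` survive, and the factor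
`q^{-ℓ(x)}` turns the eigenvalues of `T_{x⁻¹}` into the coefficients of `T_{D_ν ∩ W_μ}`. Hence the
relative norm and `φ_A` agree up to the sign of `i_λ d` (`relNorm_word`), which is `(-1)^Â`
(`sgn_eq`). In the unsigned basis the common value is a sum of the `ub i` over all sequences `i`
with matrix `A`, with weight `1` or `-q⁻¹` for each inversion within a block of `μ` (`act_TD_ub`).

If `D - E_{t,s}` is diagonal with `t`, `s` adjacent, the endomorphism of `D` replaces one entry `s`
of a sequence by `t`, in all possible ways, with a weight that counts the entries `s` on one side
and `t` on the other (`stepEnd_ub`). Applying it to the value of `φ_A` and collecting the terms that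
lead to the same sequence, the entries outside the block of the position concerned yield the
coefficient `f^±`, and those within the block yield a geometric progression: it has ratio `q_t` if
the parities agree, and ratio `-1` otherwise, in which case it has either one term or two that
cancel, according to whether the new matrix belongs to the index set (`sum_blkWt_mul_stepWt`,
`stepEnd_mul`). The formulas of Du and Gu follow by comparing signs (`neg_one_pow_hatM`).
-/

noncomputable section

namespace QSchur

open Equiv

/-! ### Inversions, standardisation and Young subgroups -/

section Perms

variable {r : ℕ}

theorem lo_lt_hi (k : Fin (r - 1)) : lo k < hi k := by simp [lo, hi, Fin.lt_def]

theorem adj_lo (k : Fin (r - 1)) : adj k (lo k) = hi k := by simp [adj_eq]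

theorem adj_hi (k : Fin (r - 1)) : adj k (hi k) = lo k := by simp [adj_eq]

theorem adj_inv (k : Fin (r - 1)) : (adj k)⁻¹ = adj k := by simp [adj_eq]

theorem mul_adj_mul_adj (w : Perm (Fin r)) (k : Fin (r - 1)) : w * adj k * adj k = w := by
  rw [mul_assoc, adj_mul_self, mul_one]

theorem len_mul_adj (w : Perm (Fin r)) (k : Fin (r - 1)) (h : w (lo k) < w (hi k)) :
    len (w * adj k) = len w + 1 := by
  rw [len_eq, len_eq, inv_mul_adj w k h]

/-- Permutations are reached from the identity by right multiplications with basic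
transpositions that increase the length. -/
theorem perm_induction {P : Perm (Fin r) → Prop} (one : P 1)
    (step : ∀ w k, w (lo k) < w (hi k) → P w → P (w * adj k)) (w : Perm (Fin r)) : P w := by
  induction hc : (inv w).card using Nat.strong_induction_on generalizing w with
  | _ t ih =>
    by_cases hd : ∀ k : Fin (r - 1), w (lo k) < w (hi k)
    · rwa [eq_one_of_no_descent w hd]
    · push Not at hd
      obtain ⟨k, hk⟩ := hd
      have hk' := lt_of_le_of_ne hk (ne_lo_hi w k).symm
      have h1 := inv_mul_adj' w k hk'
      have := step (w * adj k) k (by simpa [adj_eq] using hk') (ih _ (by omega) _ rfl)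
      rwa [mul_adj_mul_adj] at this

/-- Multiplying `w` by an ascent adds one inversion and moves the others, so that a product over
the inversions acquires one factor. -/
theorem prod_inv_mul_adj {M : Type*} [CommMonoid M] (g : Fin r → Fin r → M) (w : Perm (Fin r))
    (k : Fin (r - 1)) (h : w (lo k) < w (hi k)) :
    ∏ p ∈ inv (w * adj k), g ((w * adj k) p.1) ((w * adj k) p.2) =
      g (w (hi k)) (w (lo k)) * ∏ p ∈ inv w, g (w p.1) (w p.2) := by
  have hmem : (lo k, hi k) ∈ inv (w * adj k) := by
    rw [mem_inv, Perm.mul_apply, Perm.mul_apply, adj_lo, adj_hi]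
    exact ⟨lo_lt_hi k, h⟩
  rw [← Finset.mul_prod_erase _ _ hmem]
  simp only [Perm.mul_apply, adj_lo, adj_hi]
  congr 1
  refine Finset.prod_bij' (fun p _ => (adj k p.1, adj k p.2))
    (fun p _ => (adj k p.1, adj k p.2)) ?_ ?_ ?_ ?_ ?_
  · rintro ⟨a, b⟩ hab
    rw [Finset.mem_erase, mem_inv] at hab
    rw [mem_inv]
    exact ⟨adj_lt k hab.2.1 (fun h' => hab.1 (Prod.ext h'.1 h'.2)), hab.2.2⟩
  · rintro ⟨a, b⟩ hab
    rw [mem_inv] at hab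
    have hne : ¬ (a = lo k ∧ b = hi k) := by
      rintro ⟨rfl, rfl⟩
      exact absurd h (not_lt.2 hab.2.le)
    rw [Finset.mem_erase, mem_inv]
    refine ⟨fun he => ?_, adj_lt k hab.1 hne, by simpa [adj_adj] using hab.2⟩
    simp only [Prod.mk.injEq] at he
    have h1 : a = hi k := by rw [← adj_lo, ← he.1, adj_adj]
    have h2 : b = lo k := by rw [← adj_hi, ← he.2, adj_adj]
    exact absurd hab.1 (by rw [h1, h2]; exact not_lt.2 (lo_lt_hi k).le)
  · rintro ⟨a, b⟩ _; simp [adj_adj]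
  · rintro ⟨a, b⟩ _; simp [adj_adj]
  · rintro ⟨a, b⟩ _; rfl

variable {α : Type*}

/-- `x` is increasing on the fibres of `u ∘ x`. If `u` is monotone this means that `x` is the
shortest element in its coset under the stabiliser of `u`, see `mem_minReps_iff`. -/
def IsStd (u : Fin r → α) (x : Perm (Fin r)) : Prop :=
  ∀ a b, a < b → u (x a) = u (x b) → x a < x b

theorem isStd_one (u : Fin r → α) : IsStd u 1 := fun _ _ h _ => h

/-- Shortest coset representatives have the fewest inversions: `x` standard for `u` has its
inversions among those of every `p * x` with `p` in the stabiliser of `u`. -/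
theorem inv_subset_inv_mul [LinearOrder α] {u : Fin r → α} (hu : Monotone u)
    {x p : Perm (Fin r)} (hx : IsStd u x) (hp : ∀ k, u (p k) = u k) : inv x ⊆ inv (p * x) := by
  rintro ⟨a, b⟩ hab
  rw [mem_inv] at hab ⊢
  refine ⟨hab.1, ?_⟩
  have h1 : u (x b) < u (x a) := by
    refine lt_of_le_of_ne (hu hab.2.le) fun he => ?_
    exact absurd (hx a b hab.1 he.symm) (not_lt.2 hab.2.le)
  rw [← hp (x b), ← hp (x a)] at h1
  exact hu.reflect_lt h1

/-- Two functions with fibres of equal sizes differ by a permutation of their domain. -/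
theorem exists_comp_perm_eq [DecidableEq α] {u v : Fin r → α}
    (h : ∀ c, (Finset.univ.filter fun k => u k = c).card =
      (Finset.univ.filter fun k => v k = c).card) :
    ∃ t : Perm (Fin r), u ∘ t = v := by
  have e : ∀ c, Nonempty ({a // v a = c} ≃ {b // u b = c}) := fun c => by
    rw [← Fintype.card_eq, Fintype.card_subtype, Fintype.card_subtype, h c]
  exact ⟨Equiv.ofFiberEquiv fun c => (e c).some,
    funext fun k => Equiv.ofFiberEquiv_map (fun c => (e c).some) k⟩

/-- A monotone function is determined by the sizes of its fibres. -/
theorem eq_of_monotone_of_card [LinearOrder α] {u v : Fin r → α} (hu : Monotone u)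
    (hv : Monotone v) (h : ∀ c, (Finset.univ.filter fun k => u k = c).card =
      (Finset.univ.filter fun k => v k = c).card) : u = v := by
  obtain ⟨t, ht⟩ := exists_comp_perm_eq h
  have := Tuple.unique_monotone (f := u) (σ := 1) (τ := t) (by simpa using hu)
    (by rw [ht]; exact hv)
  rwa [ht, Perm.coe_one, Function.comp_id] at this

/-- The standardisation of the sequence `i`: the permutation `w` that is increasing on the fibres
of `i` and for which `i ∘ w⁻¹` is monotone. -/
def std [LinearOrder α] (i : Fin r → α) : Perm (Fin r) := (Tuple.sort i)⁻¹

theorem eq_std [LinearOrder α] {i u : Fin r → α} {w : Perm (Fin r)} (hu : Monotone u)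
    (hi : u ∘ w = i) (hw : IsStd u w) : w = std i := by
  rw [std, ← inv_inj, inv_inv, Tuple.eq_sort_iff]
  have h1 : i ∘ ⇑w⁻¹ = u := by
    rw [← hi]; ext k; simp
  refine ⟨by rw [h1]; exact hu, fun a b hab he => ?_⟩
  have h2 : ∀ k, i (w⁻¹ k) = u k := fun k => congrFun h1 k
  rw [h2, h2] at he
  by_contra hc
  rcases (not_lt.1 hc).lt_or_eq with hlt | heq
  · have := hw _ _ hlt (by simpa using he.symm)
    simp only [Perm.coe_inv, apply_symm_apply] at this
    exact absurd hab (not_lt.2 this.le)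
  · exact hab.ne (w⁻¹.injective heq.symm)

theorem std_lt_std_iff [LinearOrder α] (i : Fin r → α) (a b : Fin r) :
    std i a < std i b ↔ i a < i b ∨ (i a = i b ∧ a < b) := by
  obtain ⟨h1, h2⟩ := Tuple.eq_sort_iff.1 (rfl : Tuple.sort i = Tuple.sort i)
  have key : ∀ a b, i a < i b ∨ (i a = i b ∧ a < b) → std i a < std i b := by
    rintro a b (h | ⟨h, hab⟩)
    · have : (i ∘ Tuple.sort i) (std i a) < (i ∘ Tuple.sort i) (std i b) := by simpa [std] using h
      exact h1.reflect_lt this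
    · by_contra hc
      rcases (not_lt.1 hc).lt_or_eq with hlt | heq
      · have := h2 _ _ hlt (by simpa [std] using h.symm)
        simp only [std, Perm.coe_inv, apply_symm_apply] at this
        exact absurd hab (not_lt.2 this.le)
      · exact hab.ne ((std i).injective heq.symm)
  refine ⟨fun h => ?_, key a b⟩
  by_contra hc
  push Not at hc
  rcases hc.1.lt_or_eq with hlt | heq
  · exact absurd h (not_lt.2 (key _ _ (Or.inl hlt)).le)
  · rcases (hc.2 heq.symm).lt_or_eq with hlt' | heq'
    · exact absurd h (not_lt.2 (key _ _ (Or.inr ⟨heq, hlt'⟩)).le)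
    · rw [heq'] at h; exact absurd h (lt_irrefl _)

theorem mem_inv_std [LinearOrder α] (i : Fin r → α) (a b : Fin r) :
    (a, b) ∈ inv (std i) ↔ a < b ∧ i b < i a := by
  rw [mem_inv, std_lt_std_iff]
  constructor
  · rintro ⟨h, h' | h'⟩
    · exact ⟨h, h'⟩
    · exact absurd h (not_lt.2 h'.2.le)
  · rintro ⟨h, h'⟩
    exact ⟨h, Or.inl h'⟩

theorem isStd_std [LinearOrder α] (i u : Fin r → α) (h : u ∘ std i = i) : IsStd u (std i) := by
  intro a b hab he
  have : i a = i b := by rw [← h]; exact he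
  exact (std_lt_std_iff i a b).2 (Or.inr ⟨this, hab⟩)

theorem comp_std [LinearOrder α] {i u : Fin r → α} (hu : Monotone u) {t : Perm (Fin r)}
    (h : u ∘ t = i) : u ∘ std i = i := by
  have h1 : i ∘ ⇑t⁻¹ = u := by rw [← h]; ext k; simp
  have h2 := Tuple.unique_monotone (f := i) (σ := t⁻¹) (τ := Tuple.sort i) (by rw [h1]; exact hu)
    (Tuple.monotone_sort i)
  rw [← h1, h2]
  ext k
  simp [std]

/-- The shortest coset representatives of the stabiliser of a monotone function. -/
theorem mem_minReps_iff [LinearOrder α] {u : Fin r → α} (hu : Monotone u)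
    {P : Subgroup (Perm (Fin r))} (hP : ∀ w, w ∈ P ↔ ∀ k, u (w k) = u k) (x : Perm (Fin r)) :
    x ∈ minReps P ↔ IsStd u x := by
  constructor
  · intro hx
    have hc : u ∘ std (u ∘ x) = u ∘ x := comp_std hu rfl
    have hs := isStd_std _ _ hc
    have hmem : std (u ∘ x) * x⁻¹ ∈ P := by
      rw [hP]
      intro k
      have := congrFun hc (x⁻¹ k)
      simpa using this
    have h1 := hx _ hmem
    rw [inv_mul_cancel_right, len_eq, len_eq] at h1
    have h2 := inv_subset_inv_mul hu hs ((hP _).1 (inv_mem hmem))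
    rw [mul_inv_rev, inv_inv, mul_assoc, inv_mul_cancel, mul_one] at h2
    have h3 := Finset.eq_of_subset_of_card_le h2 h1
    intro a b hab he
    by_contra hlt
    have hm : (a, b) ∈ inv x :=
      (mem_inv _ _ _).2 ⟨hab, lt_of_le_of_ne (not_lt.1 hlt) fun h => hab.ne' (x.injective h)⟩
    rw [← h3, mem_inv_std] at hm
    exact absurd he hm.2.ne'
  · intro hx p hp
    rw [len_eq, len_eq]
    exact Finset.card_le_card (inv_subset_inv_mul hu hx ((hP p).1 hp))

/-- If `x` is increasing on the fibres of `u ∘ x` and `u ∘ x` takes equal values at `k` and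
`k + 1`, then `x` maps these letters to adjacent letters, and so carries `s_k` to a basic
transposition. -/
theorem exists_adj_mul [LinearOrder α] {u : Fin r → α} (hu : Monotone u) {x : Perm (Fin r)}
    (hx : IsStd u x) {k : Fin (r - 1)} (hk : u (x (lo k)) = u (x (hi k))) :
    ∃ j : Fin (r - 1), lo j = x (lo k) ∧ hi j = x (hi k) ∧ x * adj k = adj j * x := by
  have hlt := hx _ _ (lo_lt_hi k) hk
  have hadj : (x (hi k) : ℕ) = x (lo k) + 1 := by
    by_contra hne
    have hlt' : (x (lo k) : ℕ) < x (hi k) := hlt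
    let c : Fin r := ⟨x (lo k) + 1, by have := (x (hi k)).2; omega⟩
    have h1 : x (lo k) < c := by simp [c, Fin.lt_def]
    have h2 : c < x (hi k) := by simp only [c, Fin.lt_def]; omega
    have hc1 : u (x (lo k)) = u c :=
      le_antisymm (hu h1.le) ((hu h2.le).trans hk.ge)
    have hc2 : u c = u (x (hi k)) := hc1.symm.trans hk
    have e1 : lo k < x⁻¹ c := by
      by_contra hn
      rcases (not_lt.1 hn).lt_or_eq with hl | he
      · have := hx _ _ hl (by simpa using hc1.symm)
        simp only [Perm.coe_inv, apply_symm_apply] at this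
        exact absurd h1 (not_lt.2 this.le)
      · rw [← he] at h1; simp at h1
    have e2 : x⁻¹ c < hi k := by
      by_contra hn
      rcases (not_lt.1 hn).lt_or_eq with hl | he
      · have := hx _ _ hl (by simpa using hc2.symm)
        simp only [Perm.coe_inv, apply_symm_apply] at this
        exact absurd h2 (not_lt.2 this.le)
      · rw [he] at h2; simp at h2
    simp only [lo, hi, Fin.lt_def] at e1 e2
    omega
  refine ⟨⟨x (lo k), by have := (x (hi k)).2; omega⟩, rfl, Fin.ext hadj.symm, ?_⟩
  have e1 : lo (⟨x (lo k), by have := (x (hi k)).2; omega⟩ : Fin (r - 1)) = x (lo k) := rfl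
  have e2 : hi (⟨x (lo k), by have := (x (hi k)).2; omega⟩ : Fin (r - 1)) = x (hi k) :=
    Fin.ext hadj.symm
  rw [adj_eq, adj_eq, e1, e2, swap_apply_apply]
  simp

/-- A sum over a set of permutations stable under `w ↦ w s_k`, grouped into pairs. -/
theorem sum_pairs {M : Type*} [AddCommMonoid M] (S : Finset (Perm (Fin r))) (k : Fin (r - 1))
    (hS : ∀ w ∈ S, w * adj k ∈ S) (G : Perm (Fin r) → M) :
    ∑ w ∈ S, G w = ∑ w ∈ S with w (lo k) < w (hi k), (G w + G (w * adj k)) := by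
  rw [← Finset.sum_filter_add_sum_filter_not S (fun w => w (lo k) < w (hi k)),
    Finset.sum_add_distrib]
  congr 1
  refine Finset.sum_bij' (fun w _ => w * adj k) (fun w _ => w * adj k) ?_ ?_ ?_ ?_ ?_
  · intro w hw
    rw [Finset.mem_filter] at hw ⊢
    refine ⟨hS _ hw.1, ?_⟩
    rw [Perm.mul_apply, Perm.mul_apply, adj_lo, adj_hi]
    exact lt_of_le_of_ne (not_lt.1 hw.2) (ne_lo_hi w k).symm
  · intro w hw
    rw [Finset.mem_filter] at hw ⊢
    refine ⟨hS _ hw.1, ?_⟩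
    rw [Perm.mul_apply, Perm.mul_apply, adj_lo, adj_hi]
    exact not_lt.2 hw.2.le
  · intro w _; exact mul_adj_mul_adj w k
  · intro w _; exact mul_adj_mul_adj w k
  · intro w _; rw [mul_adj_mul_adj]

end Perms

/-! ### Products of basis elements of the Hecke algebra -/

section HeckeProducts

variable {R : Type*} [CommRing R] (q : Rˣ) {r : ℕ}

theorem T_mul_adj_of_lt {w : Perm (Fin r)} {k : Fin (r - 1)} (h : w (lo k) < w (hi k)) :
    HeckeT q r w * HeckeT q r (adj k) = HeckeT q r (w * adj k) := by
  rw [HeckeT_mul_adj, if_pos ((len_lt_mul_adj w k).2 h)]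

theorem T_mul_adj_mul_adj {w : Perm (Fin r)} {k : Fin (r - 1)} (h : w (lo k) < w (hi k)) :
    HeckeT q r (w * adj k) * HeckeT q r (adj k) =
      ((q : R) - 1) • HeckeT q r (w * adj k) + (q : R) • HeckeT q r w := by
  rw [HeckeT_mul_adj, if_neg, mul_adj_mul_adj]
  rw [mul_adj_mul_adj, len_mul_adj w k h]
  omega

/-- `T_w T_v = T_{wv}` if every inversion of `v` is an inversion of `w v`. -/
theorem T_mul_T {w v : Perm (Fin r)} (h : ∀ a b, a < b → v b < v a → w (v b) < w (v a)) :
    HeckeT q r w * HeckeT q r v = HeckeT q r (w * v) := by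
  induction v using perm_induction with
  | one => rw [HeckeT_one, mul_one, mul_one]
  | step v k hk ih =>
    have h1 : w (v (lo k)) < w (v (hi k)) := by
      have := h (lo k) (hi k) (lo_lt_hi k)
      simp only [Perm.mul_apply, adj_lo, adj_hi] at this
      exact this hk
    rw [← T_mul_adj_of_lt q hk, ← mul_assoc, ih, T_mul_adj_of_lt q (by simpa using h1), mul_assoc]
    intro a b hab hv
    have := h (adj k a) (adj k b) (adj_lt k hab ?_)
    · simp only [Perm.mul_apply, adj_adj] at this
      exact this hv
    · rintro ⟨rfl, rfl⟩
      exact absurd hk (not_lt.2 hv.le)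

/-- The lengths of an element `p` of a Young subgroup and of a shortest coset representative `x` of
it add up. -/
theorem T_mul_T_of_isStd {α : Type*} [LinearOrder α] {u : Fin r → α} (hu : Monotone u)
    {x p : Perm (Fin r)} (hx : IsStd u x) (hp : ∀ k, u (p k) = u k) :
    HeckeT q r p * HeckeT q r x = HeckeT q r (p * x) := by
  refine T_mul_T q fun a b hab h => ?_
  have := inv_subset_inv_mul hu hx hp ((mem_inv _ _ _).2 ⟨hab, h⟩)
  exact ((mem_inv _ _ _).1 this).2

end HeckeProducts

/-! ### Words, contents and their signs -/

section Words

variable {N r : ℕ}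

theorem word_monotone (l : Comp N r) : Monotone (word l) := by
  intro k k' hkk
  by_contra hlt
  push Not at hlt
  have hpos : ∀ k : Fin r, (k : ℕ) = ∑ i : Fin (word l k), l.1 (Fin.castLE (word l k).2.le i) +
      (finSigmaFinEquiv.symm (Fin.cast l.2.symm k)).2 := by
    intro k
    rw [word, ← finSigmaFinEquiv_apply, apply_symm_apply]
    rfl
  have hsum : ∀ i : Fin N, ∑ j : Fin i, l.1 (Fin.castLE i.2.le j) =
      ∑ j ∈ Finset.Iio i, l.1 j := by
    intro i
    refine Finset.sum_bij (fun j _ => Fin.castLE i.2.le j) ?_ ?_ ?_ ?_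
    · intro j _; rw [Finset.mem_Iio, Fin.lt_def]; exact j.2
    · intro a _ b _ h; simpa [Fin.ext_iff] using h
    · intro b hb
      exact ⟨⟨b, Fin.lt_def.1 (Finset.mem_Iio.1 hb)⟩, Finset.mem_univ _, rfl⟩
    · intro _ _; rfl
  have h1 := hpos k
  have h2 := hpos k'
  rw [hsum] at h1 h2
  have h3 : (finSigmaFinEquiv.symm (Fin.cast l.2.symm k')).2.1 < l.1 (word l k') :=
    (finSigmaFinEquiv.symm (Fin.cast l.2.symm k')).2.2
  have h4 : ∑ j ∈ Finset.Iio (word l k'), l.1 j + l.1 (word l k') ≤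
      ∑ j ∈ Finset.Iio (word l k), l.1 j := by
    rw [add_comm, ← Finset.sum_insert (by simp)]
    refine Finset.sum_le_sum_of_subset fun x hx => ?_
    rw [Finset.mem_insert, Finset.mem_Iio] at hx
    rw [Finset.mem_Iio]
    rcases hx with rfl | hx
    · exact hlt
    · exact hx.trans hlt
  have h5 : (k : ℕ) ≤ k' := hkk
  omega

theorem card_word (l : Comp N r) (i : Fin N) :
    (Finset.univ.filter fun k => word l k = i).card = l.1 i := by
  have h1 : (Finset.univ.filter fun k => word l k = i).card =
      (Finset.univ.filter fun x : (i : Fin N) × Fin (l.1 i) => x.1 = i).card := by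
    refine Finset.card_bij' (fun k _ => finSigmaFinEquiv.symm (Fin.cast l.2.symm k))
      (fun x _ => Fin.cast l.2 (finSigmaFinEquiv x)) ?_ ?_ ?_ ?_
    · intro k hk
      rw [Finset.mem_filter] at hk ⊢
      exact ⟨Finset.mem_univ _, hk.2⟩
    · intro x hx
      rw [Finset.mem_filter] at hx ⊢
      refine ⟨Finset.mem_univ _, ?_⟩
      rw [word, Fin.cast_cast, Fin.cast_eq_self, symm_apply_apply]
      exact hx.2
    · intro k _; simp
    · intro k _; simp
  rw [h1, ← Fintype.card_subtype,
    Fintype.card_congr (Equiv.sigmaSubtype i), Fintype.card_fin]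

/-- The content of a sequence of indices: how often each index occurs. -/
def content (i : Fin r → Fin N) : Comp N r :=
  ⟨fun a => (Finset.univ.filter fun k => i k = a).card, by
    rw [← Finset.card_eq_sum_card_fiberwise (fun _ _ => Finset.mem_univ _), Finset.card_univ,
      Fintype.card_fin]⟩

theorem content_word (l : Comp N r) : content (word l) = l :=
  Subtype.ext (funext fun i => card_word l i)

theorem exists_word_comp (i : Fin r → Fin N) : ∃ t : Perm (Fin r), word (content i) ∘ t = i :=
  exists_comp_perm_eq fun c => card_word (content i) c

theorem word_content_comp_std (i : Fin r → Fin N) : word (content i) ∘ std i = i :=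
  comp_std (word_monotone _) (exists_word_comp i).choose_spec

theorem word_content_std (i : Fin r → Fin N) (k : Fin r) : word (content i) (std i k) = i k :=
  congrFun (word_content_comp_std i) k

theorem content_comp (i : Fin r → Fin N) (w : Perm (Fin r)) : content (i ∘ w) = content i := by
  refine Subtype.ext (funext fun a => ?_)
  change (Finset.univ.filter fun k => i (w k) = a).card =
    (Finset.univ.filter fun k => i k = a).card
  refine Finset.card_bij' (fun k _ => w k) (fun k _ => w⁻¹ k) ?_ ?_ ?_ ?_
  · intro k hk; simpa using hk
  · intro k hk; simpa using hk
  · intro k _; simp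
  · intro k _; simp

theorem std_word (l : Comp N r) : std (word l) = 1 :=
  (eq_std (word_monotone l) (by simp) (isStd_one _)).symm

theorem isStd_word_std (i : Fin r → Fin N) : IsStd (word (content i)) (std i) :=
  isStd_std _ _ (word_content_comp_std i)

theorem std_comp_adj (i : Fin r → Fin N) (k : Fin (r - 1)) (h : i (lo k) < i (hi k)) :
    std (i ∘ adj k) = std i * adj k := by
  refine (eq_std (word_monotone (content i)) ?_ ?_).symm
  · rw [Perm.coe_mul, ← Function.comp_assoc, word_content_comp_std]
  · intro a b hab he
    rw [Perm.mul_apply, Perm.mul_apply, word_content_std, word_content_std] at he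
    rw [Perm.mul_apply, Perm.mul_apply, std_lt_std_iff]
    refine Or.inr ⟨he, adj_lt k hab ?_⟩
    rintro ⟨rfl, rfl⟩
    rw [adj_lo, adj_hi] at he
    exact h.ne he.symm

theorem std_lo_lt_hi (i : Fin r → Fin N) (k : Fin (r - 1)) (h : i (lo k) ≤ i (hi k)) :
    std i (lo k) < std i (hi k) := by
  rw [std_lt_std_iff]
  rcases h.lt_or_eq with h | h
  · exact Or.inl h
  · exact Or.inr ⟨h, lo_lt_hi k⟩

theorem comp_adj_of_eq (i : Fin r → Fin N) (k : Fin (r - 1)) (h : i (lo k) = i (hi k)) :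
    i ∘ adj k = i := by
  ext x
  simp only [Function.comp_apply, adj_eq, swap_apply_def]
  split_ifs with h1 h2
  · rw [h1, h]
  · rw [h2, h]
  · rfl

theorem comp_adj_adj (i : Fin r → Fin N) (k : Fin (r - 1)) : (i ∘ adj k) ∘ adj k = i := by
  ext x; simp [adj_adj]

theorem mem_par (l : Comp N r) (w : Perm (Fin r)) :
    w ∈ par l ↔ ∀ k, word l (w k) = word l k := Iff.rfl

/-- The sign of the unsigned basis vector `ub i` relative to `v_i`: the parity of the number of
inversions of the sequence `i` between odd indices. -/
def sgn (R : Type*) [CommRing R] (m : ℕ) (i : Fin r → Fin N) : Rˣ :=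
  ∏ p ∈ inv (std i), (-1) ^ (hat m (i p.1) * hat m (i p.2))

theorem sgn_comp_adj (R : Type*) [CommRing R] (m : ℕ) (i : Fin r → Fin N) (k : Fin (r - 1))
    (h : i (lo k) < i (hi k)) :
    sgn R m (i ∘ adj k) = (-1) ^ (hat m (i (lo k)) * hat m (i (hi k))) * sgn R m i := by
  have hc : ∀ x, i (adj k x) = word (content i) ((std i * adj k) x) := fun x => by
    rw [Perm.mul_apply, word_content_std]
  have := prod_inv_mul_adj (fun x y => ((-1 : Rˣ)) ^ (hat m (word (content i) x) *
    hat m (word (content i) y))) (std i) k (std_lo_lt_hi i k h.le)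
  simp only [Perm.mul_apply, word_content_std] at this
  rw [sgn, std_comp_adj i k h]
  simp only [Function.comp_apply]
  rw [this, mul_comm (hat m (i (hi k)))]
  rfl

end Words

/-! ### The unsigned basis of the tensor superspace -/

section Tensor

variable {R : Type*} [CommRing R] (q : Rˣ) (m : ℕ) {N r : ℕ}

variable (R N r) in
/-- The basis `± v_i` of the tensor superspace, with the sign `sgn i` that removes all signs from
the action of the Hecke algebra, see `tau_ub_of_lt`, `tau_ub_of_eq` and `tau_ub_comp_of_lt`. -/
def ub : Module.Basis (Fin r → Fin N) R (VT R N r) := (vb R N r).unitsSMul (sgn R m)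

theorem ub_apply (i : Fin r → Fin N) : ub R m N r i = (sgn R m i : R) • vb R N r i := by
  rw [ub, Module.Basis.unitsSMul_apply, Units.smul_def]

theorem ub_word (l : Comp N r) : ub R m N r (word l) = vb R N r (word l) := by
  rw [ub_apply, sgn, std_word, inv_one, Finset.prod_empty, Units.val_one, one_smul]

theorem tau_ub_of_lt (i : Fin r → Fin N) (k : Fin (r - 1)) (h : i (lo k) < i (hi k)) :
    tau q m k (ub R m N r i) = ub R m N r (i ∘ adj k) := by
  rw [ub_apply, ub_apply, sgn_comp_adj R m i k h, map_smul, tau, Module.Basis.constr_basis,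
    if_pos h, smul_smul]
  congr 1
  push_cast
  ring

theorem tau_ub_of_eq (i : Fin r → Fin N) (k : Fin (r - 1)) (h : i (lo k) = i (hi k)) :
    tau q m k (ub R m N r i) = (qdd q m (i (lo k)) : R) • ub R m N r i := by
  rw [ub_apply, map_smul, tau, Module.Basis.constr_basis, if_neg h.not_lt, if_pos h,
    smul_comm]
  congr 2
  rw [qdd]
  split_ifs <;> simp

theorem tau_ub_comp_of_lt (i : Fin r → Fin N) (k : Fin (r - 1)) (h : i (lo k) < i (hi k)) :
    tau q m k (ub R m N r (i ∘ adj k)) =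
      (q : R) • ub R m N r i + ((q : R) - 1) • ub R m N r (i ∘ adj k) := by
  have h1 : (i ∘ adj k) (lo k) = i (hi k) := by rw [Function.comp_apply, adj_lo]
  have h2 : (i ∘ adj k) (hi k) = i (lo k) := by rw [Function.comp_apply, adj_hi]
  rw [ub_apply, ub_apply, sgn_comp_adj R m i k h, map_smul, tau, Module.Basis.constr_basis, h1, h2,
    if_neg h.not_gt, if_neg h.ne', comp_adj_adj, smul_add, smul_smul, smul_smul, smul_smul,
    smul_smul]
  have hs : ((-1 : R) ^ (hat m (i (lo k)) * hat m (i (hi k)))) ^ 2 = 1 := by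
    rw [← pow_mul, mul_comm, pow_mul]; simp
  congr 2
  · push_cast
    rw [mul_comm (hat m (i (hi k)))]
    linear_combination (q : R) * (sgn R m i : R) * hs
  · push_cast
    ring

end Tensor

/-! ### The elements `[xy]_λ` -/

section XY

variable {R : Type*} [CommRing R] (q : Rˣ) (m : ℕ) {N r : ℕ}

theorem hecke_sum_mul {ι : Type*} (s : Finset ι) (f : ι → Hecke q r) (b : Hecke q r) :
    (∑ x ∈ s, f x) * b = ∑ x ∈ s, f x * b := Finset.sum_mul s f b

theorem hecke_mul_sum {ι : Type*} (s : Finset ι) (f : ι → Hecke q r) (b : Hecke q r) :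
    b * ∑ x ∈ s, f x = ∑ x ∈ s, b * f x := Finset.mul_sum s f b

theorem hat_eq_zero_or_one (h : Fin N) : hat m h = 0 ∨ hat m h = 1 := by
  rw [hat]; split_ifs <;> simp

/-- The coefficient of `T_p`, `p ∈ W_λ`, in `[xy]_λ`: the inversions of `p` in even blocks have
weight `1`, those in odd blocks have weight `-q⁻¹`. -/
def invWt (l : Comp N r) (p : Perm (Fin r)) : Rˣ := ∏ x ∈ inv p, qd q m (word l (p x.1))

theorem word_eq_of_mem_inv {l : Comp N r} {p : Perm (Fin r)} (hp : p ∈ par l) {a b : Fin r}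
    (hab : a < b) (h : p b < p a) : word l a = word l b := by
  have h1 := word_monotone l h.le
  rw [hp, hp] at h1
  exact le_antisymm (word_monotone l hab.le) h1

variable {m} in
theorem T_mul_T_parPart {l : Comp N r} {w₀ w₁ : Perm (Fin r)} (h₀ : w₀ ∈ parPart m 0 l)
    (h₁ : w₁ ∈ parPart m 1 l) : HeckeT q r w₀ * HeckeT q r w₁ = HeckeT q r (w₀ * w₁) := by
  refine T_mul_T q fun a b hab h => ?_
  have hw := word_eq_of_mem_inv h₁.1 hab h
  rcases hat_eq_zero_or_one m (word l a) with ha | ha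
  · rw [h₁.2 a (by omega), h₁.2 b (by rw [← hw]; omega)] at h
    exact absurd hab (not_lt.2 h.le)
  · rwa [h₀.2 (w₁ a) (by rw [h₁.1]; omega), h₀.2 (w₁ b) (by rw [h₁.1, ← hw]; omega)]

variable {m} in
theorem invWt_mul {l : Comp N r} {w₀ w₁ : Perm (Fin r)} (h₀ : w₀ ∈ parPart m 0 l)
    (h₁ : w₁ ∈ parPart m 1 l) : invWt q m l (w₀ * w₁) = (-q)⁻¹ ^ len w₁ := by
  classical
  have hp := mul_mem h₀.1 h₁.1
  have h2 : inv w₁ = (inv (w₀ * w₁)).filter fun x => hat m (word l x.1) = 1 := by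
    ext ⟨a, b⟩
    rw [Finset.mem_filter, mem_inv, mem_inv]
    constructor
    · rintro ⟨hab, h⟩
      have hw := word_eq_of_mem_inv h₁.1 hab h
      have ha : hat m (word l a) = 1 := by
        rcases hat_eq_zero_or_one m (word l a) with ha | ha
        · rw [h₁.2 a (by omega), h₁.2 b (by rw [← hw]; omega)] at h
          exact absurd hab (not_lt.2 h.le)
        · exact ha
      refine ⟨⟨hab, ?_⟩, ha⟩
      rw [Perm.mul_apply, Perm.mul_apply]
      rwa [h₀.2 (w₁ a) (by rw [h₁.1]; omega), h₀.2 (w₁ b) (by rw [h₁.1, ← hw]; omega)]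
    · rintro ⟨⟨hab, h⟩, ha⟩
      have hw := word_eq_of_mem_inv hp hab h
      rw [Perm.mul_apply, Perm.mul_apply, h₀.2 (w₁ a) (by rw [h₁.1]; dsimp only at ha; omega),
        h₀.2 (w₁ b) (by rw [h₁.1, ← hw]; dsimp only at ha; omega)] at h
      exact ⟨hab, h⟩
  rw [len_eq, h2, ← Finset.prod_const, Finset.prod_filter, invWt]
  refine Finset.prod_congr rfl fun x _ => ?_
  rw [hp, qd, hat]
  by_cases h3 : (word l x.1 : ℕ) < m
  · simp [h3]
  · simp [h3, inv_neg]

open Classical in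
/-- The double sum that defines `T_D` as a single sum over `D ∩ W_η`. -/
theorem TD_eq_sum (eta : Comp N r) (D : Set (Perm (Fin r)))
    (hD : ∀ w₀ ∈ parPart m 0 eta, ∀ w₁ ∈ parPart m 1 eta, w₀ * w₁ ∈ D ↔ w₀ ∈ D ∧ w₁ ∈ D) :
    TD q m eta D = ∑ p with p ∈ D ∧ p ∈ par eta, (invWt q m eta p : R) • HeckeT q r p := by
  have hinj : ∀ w₀ ∈ parPart m 0 eta, ∀ w₁ ∈ parPart m 1 eta, ∀ k,
      (hat m (word eta k) = 0 → (w₀ * w₁) k = w₀ k) ∧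
      (hat m (word eta k) = 1 → (w₀ * w₁) k = w₁ k) := by
    intro w₀ h₀ w₁ h₁ k
    constructor <;> intro hk
    · rw [Perm.mul_apply, h₁.2 k (by omega)]
    · rw [Perm.mul_apply, h₀.2 (w₁ k) (by rw [h₁.1]; omega)]
  rw [TD, ← Finset.sum_product']
  refine Finset.sum_bij (fun w _ => w.1 * w.2) ?_ ?_ ?_ ?_
  · rintro ⟨w₀, w₁⟩ hw
    simp only [Finset.mem_product, Finset.mem_filter, Finset.mem_univ, true_and] at hw ⊢
    exact ⟨(hD _ hw.1.2 _ hw.2.2).2 ⟨hw.1.1, hw.2.1⟩, mul_mem hw.1.2.1 hw.2.2.1⟩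
  · rintro ⟨w₀, w₁⟩ hw ⟨v₀, v₁⟩ hv he
    simp only [Finset.mem_product, Finset.mem_filter, Finset.mem_univ, true_and] at hw hv he
    have h0 : w₀ = v₀ := by
      ext k
      rcases hat_eq_zero_or_one m (word eta k) with hk | hk
      · rw [← (hinj _ hw.1.2 _ hw.2.2 k).1 hk, ← (hinj _ hv.1.2 _ hv.2.2 k).1 hk, he]
      · rw [hw.1.2.2 k (by omega), hv.1.2.2 k (by omega)]
    rw [h0] at he
    rw [h0, mul_left_cancel he]
  · intro p hp
    simp only [Finset.mem_filter, Finset.mem_univ, true_and] at hp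
    have hpar : ∀ e x, hat m (word eta (p x)) = e ↔ hat m (word eta x) = e := fun e x => by
      rw [hp.2]
    let P : ℕ → Perm (Fin r) := fun e =>
      Perm.ofSubtype (p := fun x => hat m (word eta x) = e) (p.subtypePerm (hpar e))
    have hP1 : ∀ e k, hat m (word eta k) = e → P e k = p k := fun e k hk =>
      Perm.ofSubtype_apply_of_mem (p := fun x => hat m (word eta x) = e) _ hk
    have hP2 : ∀ e k, hat m (word eta k) ≠ e → P e k = k := fun e k hk =>
      Perm.ofSubtype_apply_of_not_mem (p := fun x => hat m (word eta x) = e) _ hk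
    have hPp : ∀ e, P e ∈ parPart m e eta := fun e => by
      refine ⟨fun k => ?_, hP2 e⟩
      by_cases hk : hat m (word eta k) = e
      · rw [hP1 e k hk, hp.2]
      · rw [hP2 e k hk]
    have hmul : P 0 * P 1 = p := by
      ext k
      rcases hat_eq_zero_or_one m (word eta k) with hk | hk
      · rw [(hinj _ (hPp 0) _ (hPp 1) k).1 hk, hP1 0 k hk]
      · rw [(hinj _ (hPp 0) _ (hPp 1) k).2 hk, hP1 1 k hk]
    have hd := (hD _ (hPp 0) _ (hPp 1)).1 (by rw [hmul]; exact hp.1)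
    refine ⟨(P 0, P 1), ?_, hmul⟩
    simp only [Finset.mem_product, Finset.mem_filter, Finset.mem_univ, true_and]
    exact ⟨⟨hd.1, hPp 0⟩, hd.2, hPp 1⟩
  · rintro ⟨w₀, w₁⟩ hw
    simp only [Finset.mem_product, Finset.mem_filter, Finset.mem_univ, true_and] at hw
    rw [T_mul_T_parPart q hw.1.2 hw.2.2, invWt_mul q hw.1.2 hw.2.2]

open Classical in
theorem xy_eq_sum (l : Comp N r) :
    xy q m l = ∑ p with p ∈ par l, (invWt q m l p : R) • HeckeT q r p := by
  have h1 := TD_eq_sum q m l Set.univ (by simp)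
  simp only [Set.mem_univ, true_and] at h1
  rw [← h1, xy, TD, hecke_sum_mul]
  simp only [Set.mem_univ, true_and]
  refine Finset.sum_congr rfl fun w₀ _ => ?_
  rw [hecke_mul_sum]
  refine Finset.sum_congr rfl fun w₁ _ => ?_
  rw [mul_smul_comm]

theorem invWt_one (l : Comp N r) : invWt q m l 1 = 1 := by rw [invWt, inv_one, Finset.prod_empty]

theorem invWt_mul_adj {l : Comp N r} {p : Perm (Fin r)} {j : Fin (r - 1)}
    (h : p (lo j) < p (hi j)) :
    invWt q m l (p * adj j) = qd q m (word l (p (hi j))) * invWt q m l p :=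
  prod_inv_mul_adj (fun x _ => qd q m (word l x)) p j h

theorem adj_mem_par {l : Comp N r} {j : Fin (r - 1)} (h : word l (lo j) = word l (hi j)) :
    adj j ∈ par l := fun k => congrFun (comp_adj_of_eq (word l) j h) k

/-- `[xy]_λ` spans a one-dimensional representation of the Hecke algebra of `W_λ`, on which `T_s`
acts by `q` for `s` in an even block and by `-1` for `s` in an odd one. -/
theorem xy_mul_T (l : Comp N r) (j : Fin (r - 1)) (h : word l (lo j) = word l (hi j)) :
    xy q m l * HeckeT q r (adj j) = (qdd q m (word l (lo j)) : R) • xy q m l := by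
  classical
  have hj := adj_mem_par h
  have hS : ∀ w ∈ Finset.univ.filter (fun w => w ∈ par l),
      w * adj j ∈ Finset.univ.filter (fun w => w ∈ par l) := by
    intro w hw
    rw [Finset.mem_filter] at hw ⊢
    exact ⟨Finset.mem_univ _, mul_mem hw.2 hj⟩
  rw [xy_eq_sum, hecke_sum_mul, sum_pairs _ j hS, sum_pairs _ j hS, Finset.smul_sum]
  refine Finset.sum_congr rfl fun p hp => ?_
  rw [Finset.mem_filter, Finset.mem_filter] at hp
  rw [smul_mul_assoc, smul_mul_assoc, T_mul_adj_of_lt q hp.2, T_mul_adj_mul_adj q hp.2,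
    invWt_mul_adj q m hp.2, hp.1.2, ← h]
  have e1 : (qdd q m (word l (lo j)) : R) =
      (qd q m (word l (lo j)) : R) * q := by
    rw [qd, qdd]; split_ifs <;> simp
  have e2 : (qdd q m (word l (lo j)) : R) * qd q m (word l (lo j)) =
      1 + (qd q m (word l (lo j)) : R) * (q - 1) := by
    rw [qd, qdd]; split_ifs <;> simp [mul_sub]
  rw [Units.val_mul, smul_add ((qdd q m (word l (lo j)) : R)), smul_smul _ _ (HeckeT q r p),
    smul_smul _ _ (HeckeT q r (p * adj j)), ← mul_assoc, e2, e1]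
  module

end XY

/-! ### The isomorphism between the tensor superspace and the tensor space -/

section Psi

variable {R : Type*} [CommRing R] (q : Rˣ) (m : ℕ) {N r : ℕ}

theorem op_smul_inT (l : Comp N r) (h x : Hecke q r) :
    MulOpposite.op x • inT q m l h = inT q m l (h * x) := by
  rw [inT, inT, ← DirectSum.lof_eq_of (Hecke q r)ᵐᵒᵖ, ← DirectSum.lof_eq_of (Hecke q r)ᵐᵒᵖ,
    ← map_smul]
  congr 1

theorem inT_add (l : Comp N r) (h h' : Hecke q r) :
    inT q m l (h + h') = inT q m l h + inT q m l h' := by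
  rw [inT, inT, inT, ← map_add]
  congr 1
  ext
  rw [Submodule.coe_add, coe_xyMul, coe_xyMul, coe_xyMul, mul_add]

theorem inT_of_xy_mul {l : Comp N r} {h h' : Hecke q r} {c : R}
    (e : xy q m l * h = c • (xy q m l * h')) : inT q m l h = c • inT q m l h' := by
  rw [inT, inT, ← DirectSum.lof_eq_of R, ← DirectSum.lof_eq_of R, ← map_smul]
  congr 1
  ext
  exact e

theorem inT_smul (l : Comp N r) (h : Hecke q r) (c : R) :
    inT q m l (c • h) = c • inT q m l h :=
  inT_of_xy_mul q m (by rw [mul_smul_comm])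

theorem inT_zero (l : Comp N r) : inT q m l 0 = 0 := by
  simpa using inT_smul q m l 0 0

theorem inT_sum {ι : Type*} (s : Finset ι) (l : Comp N r) (h : ι → Hecke q r) :
    inT q m l (∑ x ∈ s, h x) = ∑ x ∈ s, inT q m l (h x) := by
  classical
  induction s using Finset.induction_on with
  | empty => simp [inT_zero]
  | insert a s ha ih => rw [Finset.sum_insert ha, Finset.sum_insert ha, inT_add, ih]

variable (N r) in
/-- The linear map `V^{⊗ r} → 𝔗` that sends the unsigned basis vector of a sequence `i` of content
`λ` to `[xy]_λ T_d`, where `d` is the standardisation of `i`. -/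
def psiMap : VT R N r →ₗ[R] TSpace q m N r :=
  (ub R m N r).constr R fun i => inT q m (content i) (HeckeT q r (std i))

theorem psiMap_ub (i : Fin r → Fin N) :
    psiMap q m N r (ub R m N r i) = inT q m (content i) (HeckeT q r (std i)) := by
  rw [psiMap, Module.Basis.constr_basis]

theorem psiMap_tau (k : Fin (r - 1)) (v : VT R N r) :
    psiMap q m N r (tau q m k v) = MulOpposite.op (HeckeT q r (adj k)) • psiMap q m N r v := by
  have key : psiMap q m N r ∘ₗ tau q m k =
      (DistribSMul.toLinearMap R (TSpace q m N r) (MulOpposite.op (HeckeT q r (adj k)))) ∘ₗ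
        psiMap q m N r := by
    refine (ub R m N r).ext fun i => ?_
    simp only [LinearMap.comp_apply, DistribSMul.toLinearMap_apply]
    rw [psiMap_ub, op_smul_inT]
    rcases lt_trichotomy (i (lo k)) (i (hi k)) with h | h | h
    · rw [tau_ub_of_lt q m i k h, psiMap_ub, content_comp, std_comp_adj i k h,
        T_mul_adj_of_lt q (std_lo_lt_hi i k h.le)]
    · rw [tau_ub_of_eq q m i k h, map_smul, psiMap_ub]
      have hw : word (content i) (std i (lo k)) = word (content i) (std i (hi k)) := by
        rw [word_content_std, word_content_std, h]
      obtain ⟨j, hj1, hj2, hj⟩ := exists_adj_mul (word_monotone _) (isStd_word_std i) hw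
      have hwj : word (content i) (lo j) = word (content i) (hi j) := by rw [hj1, hj2, hw]
      refine (inT_of_xy_mul q m ?_).symm
      rw [T_mul_adj_of_lt q (std_lo_lt_hi i k h.le), hj,
        ← T_mul_T_of_isStd q (word_monotone _) (isStd_word_std i) (adj_mem_par hwj),
        ← mul_assoc, xy_mul_T q m _ j hwj, smul_mul_assoc, hj1, word_content_std]
    · obtain ⟨i', hi'⟩ : ∃ i' : Fin r → Fin N, i = i' ∘ adj k := ⟨i ∘ adj k,
        (comp_adj_adj i k).symm⟩
      subst hi'
      have h' : i' (lo k) < i' (hi k) := by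
        simpa only [Function.comp_apply, adj_lo, adj_hi] using h
      rw [tau_ub_comp_of_lt q m i' k h', map_add, map_smul, map_smul, psiMap_ub, psiMap_ub,
        content_comp, std_comp_adj i' k h', T_mul_adj_mul_adj q (std_lo_lt_hi i' k h'.le),
        inT_add, inT_smul, inT_smul, add_comm]
  exact LinearMap.congr_fun key v

theorem psiMap_surjective : Function.Surjective (psiMap q m N r) := by
  have h1 : ∀ (l : Comp N r) (w : Perm (Fin r)),
      inT q m l (HeckeT q r w) ∈ LinearMap.range (psiMap q m N r) := by
    intro l w
    induction w using perm_induction with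
    | one =>
      refine ⟨ub R m N r (word l), ?_⟩
      rw [psiMap_ub, content_word, std_word]
    | step w k hk ih =>
      obtain ⟨v, hv⟩ := ih
      refine ⟨tau q m k v, ?_⟩
      rw [psiMap_tau, hv, op_smul_inT, T_mul_adj_of_lt q hk]
  have h2 : ∀ (l : Comp N r) (h : Hecke q r),
      inT q m l h ∈ LinearMap.range (psiMap q m N r) := by
    intro l h
    rw [← (HeckeT q r).sum_repr h, inT_sum]
    refine Submodule.sum_mem _ fun w _ => ?_
    rw [inT_smul]
    exact Submodule.smul_mem _ _ (h1 l w)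
  rw [← LinearMap.range_eq_top, eq_top_iff]
  rintro t -
  induction t using DirectSum.induction_on with
  | zero => exact zero_mem _
  | of l x =>
    obtain ⟨x, hx⟩ := x
    obtain ⟨a, rfl⟩ := Submodule.mem_span_singleton.1 hx
    exact h2 l a.unop
  | add x y hx hy => exact add_mem hx hy

/-- The coefficient of `[xy]_λ T_d` at `T_{d'}`, for shortest coset representatives `d`, `d'`. -/
theorem repr_xy_mul_T (i j : Fin r → Fin N) (h : content i = content j) :
    (HeckeT q r).repr (xy q m (content i) * HeckeT q r (std j)) (std i) =
      if i = j then 1 else 0 := by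
  classical
  have h1 : ∀ p ∈ par (content i), p * std j = std i → i = j := by
    intro p hp he
    ext1 k
    rw [← word_content_std i k, ← he, Perm.mul_apply, hp, h, word_content_std]
  rw [xy_eq_sum, hecke_sum_mul, map_sum, Finsupp.finsetSum_apply]
  have h2 : ∀ p ∈ Finset.univ.filter (fun p => p ∈ par (content i)),
      (HeckeT q r).repr ((invWt q m (content i) p : R) • HeckeT q r p * HeckeT q r (std j))
        (std i) = if p * std j = std i then (invWt q m (content i) p : R) else 0 := by
    intro p hp
    rw [Finset.mem_filter] at hp
    rw [smul_mul_assoc, T_mul_T_of_isStd q (word_monotone (content i))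
      (by rw [h]; exact isStd_word_std j) hp.2, map_smul, Module.Basis.repr_self,
      Finsupp.smul_apply, Finsupp.single_apply, smul_eq_mul, mul_ite, mul_one, mul_zero]
  rw [Finset.sum_congr rfl h2]
  split_ifs with hij
  · subst hij
    rw [Finset.sum_eq_single 1]
    · rw [if_pos (one_mul _), invWt_one, Units.val_one]
    · intro p _ hp
      rw [if_neg]
      intro he
      exact hp (by simpa using he)
    · intro hn
      exact absurd (Finset.mem_filter.2 ⟨Finset.mem_univ _, one_mem _⟩) hn
  · refine Finset.sum_eq_zero fun p hp => ?_
    rw [if_neg fun he => hij (h1 p (Finset.mem_filter.1 hp).2 he)]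

theorem psiMap_injective : Function.Injective (psiMap q m N r) := by
  let c : (i : Fin r → Fin N) → TSpace q m N r →ₗ[R] R := fun i =>
    (Finsupp.lapply (std i)) ∘ₗ (HeckeT q r).repr.toLinearMap ∘ₗ
      ((xyH q m (content i)).subtype.restrictScalars R) ∘ₗ
      DirectSum.component R (Comp N r) (fun l => xyH q m l) (content i)
  have hc : ∀ i j, c i (psiMap q m N r (ub R m N r j)) = if i = j then 1 else 0 := by
    intro i j
    have h0 : c i (psiMap q m N r (ub R m N r j)) = (HeckeT q r).repr
        (((psiMap q m N r (ub R m N r j)) (content i) : xyH q m (content i)) : Hecke q r)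
        (std i) := rfl
    rw [h0, psiMap_ub, inT]
    by_cases h : content i = content j
    · rw [← repr_xy_mul_T q m i j h, h, DirectSum.of_eq_same, coe_xyMul]
    · rw [if_neg fun he => h (by rw [he]), DirectSum.of_eq_of_ne _ _ _ h, ZeroMemClass.coe_zero,
        map_zero, Finsupp.zero_apply]
  rw [injective_iff_map_eq_zero]
  intro v hv
  refine (ub R m N r).ext_elem fun i => ?_
  have : c i ∘ₗ psiMap q m N r = (ub R m N r).coord i := by
    refine (ub R m N r).ext fun j => ?_
    rw [LinearMap.comp_apply, hc, Module.Basis.coord_apply, Module.Basis.repr_self,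
      Finsupp.single_apply]
    simp only [eq_comm]
  rw [← Module.Basis.coord_apply, ← this, LinearMap.comp_apply, hv, map_zero, map_zero]
  rfl

end Psi

/-! ### The action of the Hecke algebra on the tensor superspace -/

section Action

variable {R : Type*} [CommRing R] (q : Rˣ) (m : ℕ) {N r : ℕ}

variable (N r) in
/-- The isomorphism `V^{⊗ r} ≅ 𝔗` with `v_{i_λ} ↦ [xy]_λ`. -/
def psi : VT R N r ≃ₗ[R] TSpace q m N r :=
  LinearEquiv.ofBijective (psiMap q m N r) ⟨psiMap_injective q m, psiMap_surjective q m⟩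

theorem psi_apply (v : VT R N r) : psi q m N r v = psiMap q m N r v := rfl

theorem T_prod_of_reduced (l : List (Fin (r - 1))) (h : l.length = len (l.map adj).prod) :
    HeckeT q r (l.map adj).prod = (l.map fun k => HeckeT q r (adj k)).prod := by
  induction l using List.reverseRecOn with
  | nil => exact HeckeT_one q r
  | append_singleton l k ih =>
    simp only [List.map_append, List.map_cons, List.map_nil, List.prod_append,
      List.prod_singleton, List.length_append, List.length_singleton] at h ⊢
    have h1 : len (l.map adj).prod ≤ l.length := by rw [len_eq]; exact inv_le_length l
    have h2 : len ((l.map adj).prod * adj k) ≤ len (l.map adj).prod + 1 := by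
      obtain ⟨l', hl', hp'⟩ := exists_redWord (l.map adj).prod
      exact Nat.sInf_le ⟨l' ++ [k], by simp [hl'], by simp [hp']⟩
    rw [← ih (by omega), T_mul_adj_of_lt]
    rw [← len_lt_mul_adj]
    omega

theorem psi_list_prod (l : List (Fin (r - 1))) (v : VT R N r) :
    psi q m N r (((l.map (tau q m)).reverse).prod v) =
      MulOpposite.op ((l.map fun k => HeckeT q r (adj k)).prod) • psi q m N r v := by
  induction l generalizing v with
  | nil => simp
  | cons k l ih =>
    simp only [List.map_cons, List.reverse_cons, List.prod_append,
      Module.End.mul_apply, List.prod_cons]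
    rw [ih, psi_apply, psi_apply, psiMap_tau, smul_smul]
    rfl

theorem psi_act_T (w : Perm (Fin r)) (v : VT R N r) :
    psi q m N r (act q m (HeckeT q r w) v) =
      MulOpposite.op (HeckeT q r w) • psi q m N r v := by
  obtain ⟨h1, h2⟩ := (exists_redWord w).choose_spec
  rw [act, Module.Basis.constr_basis, psi_list_prod]
  congr 2
  change (redWord w).length = len w at h1
  change ((redWord w).map adj).prod = w at h2
  rw [← T_prod_of_reduced q _ (by rw [h2, h1]), h2]

/-- The operators `act x` are transported by `psi` to right multiplications; in particular they
define a right action, although `act` is defined through a choice of reduced expressions. -/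
theorem psi_act (x : Hecke q r) (v : VT R N r) :
    psi q m N r (act q m x v) = MulOpposite.op x • psi q m N r v := by
  induction (HeckeT q r).mem_span x using Submodule.span_induction with
  | mem x hx =>
    obtain ⟨w, rfl⟩ := hx
    exact psi_act_T q m w v
  | zero => rw [map_zero, LinearMap.zero_apply, map_zero, MulOpposite.op_zero, zero_smul]
  | add x y _ _ hx hy =>
    rw [map_add, LinearMap.add_apply, map_add, hx, hy, MulOpposite.op_add, add_smul]
  | smul c x _ hx =>
    rw [map_smul, LinearMap.smul_apply, map_smul, hx, MulOpposite.op_smul, smul_assoc]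

theorem act_mul (x y : Hecke q r) :
    (act q m (x * y) : Module.End R (VT R N r)) = act q m y * act q m x := by
  refine LinearMap.ext fun v => ?_
  apply (psi q m N r).injective
  rw [psi_act, Module.End.mul_apply, psi_act, psi_act, smul_smul]
  rfl

theorem act_one : (act q m (1 : Hecke q r) : Module.End R (VT R N r)) = 1 := by
  refine LinearMap.ext fun v => ?_
  apply (psi q m N r).injective
  rw [psi_act, MulOpposite.op_one, one_smul, Module.End.one_apply]

theorem act_T_adj (k : Fin (r - 1)) :
    (act q m (HeckeT q r (adj k)) : Module.End R (VT R N r)) = tau q m k := by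
  refine LinearMap.ext fun v => ?_
  apply (psi q m N r).injective
  rw [psi_act, psi_apply, psi_apply, psiMap_tau]

theorem act_T_mul_adj {w : Perm (Fin r)} {k : Fin (r - 1)} (h : w (lo k) < w (hi k)) :
    (act q m (HeckeT q r (w * adj k)) : Module.End R (VT R N r)) =
      tau q m k * act q m (HeckeT q r w) := by
  rw [← T_mul_adj_of_lt q h, act_mul, act_T_adj]

/-- The factor by which `T_w` acts on `ub i`, see `act_T_ub`: every inversion of `w` that moves
equal indices past each other contributes `q` or `-1`, according to their parity. -/
def eqWt (i : Fin r → Fin N) (w : Perm (Fin r)) : Rˣ :=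
  ∏ p ∈ inv w, if i (w p.1) = i (w p.2) then qdd q m (i (w p.1)) else 1

/-- If the inversions of `w` only move smaller or equal indices to the right, then `T_w` permutes
the factors of the tensor up to a scalar. -/
theorem act_T_ub (i : Fin r → Fin N) (w : Perm (Fin r))
    (h : ∀ a b, a < b → w b < w a → i (w b) ≤ i (w a)) :
    act q m (HeckeT q r w) (ub R m N r i) = (eqWt q m i w : R) • ub R m N r (i ∘ w) := by
  induction w using perm_induction with
  | one =>
    rw [HeckeT_one, act_one, eqWt, inv_one, Finset.prod_empty, Units.val_one, one_smul]
    rfl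
  | step w k hk ih =>
    have h1 : i (w (lo k)) ≤ i (w (hi k)) := by
      have := h (lo k) (hi k) (lo_lt_hi k)
      simp only [Perm.mul_apply, adj_lo, adj_hi] at this
      exact this hk
    have h2 : (i ∘ w) ∘ adj k = i ∘ ⇑(w * adj k) := rfl
    have h3 : eqWt q m i (w * adj k) =
        (if i (w (hi k)) = i (w (lo k)) then qdd q m (i (w (hi k))) else 1) * eqWt q m i w :=
      prod_inv_mul_adj (fun x y => if i x = i y then qdd q m (i x) else 1) w k hk
    rw [act_T_mul_adj q m hk, Module.End.mul_apply, ih, map_smul, h3]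
    · rcases h1.lt_or_eq with hlt | heq
      · rw [tau_ub_of_lt q m (i ∘ w) k hlt, h2, if_neg hlt.ne', one_mul]
      · rw [tau_ub_of_eq q m (i ∘ w) k heq, smul_smul, if_pos heq.symm, ← h2,
          comp_adj_of_eq (i ∘ w) k heq, Units.val_mul, mul_comm, Function.comp_apply, heq]
    · intro a b hab hv
      have := h (adj k a) (adj k b) (adj_lt k hab ?_)
      · simp only [Perm.mul_apply, adj_adj] at this
        exact this hv
      · rintro ⟨rfl, rfl⟩
        exact absurd hk (not_lt.2 hv.le)

/-- As `act_T_ub`, if no equal indices are moved past each other. -/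
theorem act_T_ub_of_lt (i : Fin r → Fin N) (w : Perm (Fin r))
    (h : ∀ a b, a < b → w b < w a → i (w b) < i (w a)) :
    act q m (HeckeT q r w) (ub R m N r i) = ub R m N r (i ∘ w) := by
  rw [act_T_ub q m i w fun a b hab hw => (h a b hab hw).le, eqWt, Finset.prod_eq_one,
    Units.val_one, one_smul]
  rintro ⟨a, b⟩ hab
  rw [mem_inv] at hab
  rw [if_neg (h a b hab.1 hab.2).ne']

theorem act_std_word (i : Fin r → Fin N) :
    act q m (HeckeT q r (std i)) (ub R m N r (word (content i))) = ub R m N r i := by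
  rw [act_T_ub_of_lt, word_content_comp_std]
  intro a b hab h
  rw [word_content_std, word_content_std]
  exact ((mem_inv_std i a b).1 ((mem_inv _ _ _).2 ⟨hab, h⟩)).2

theorem mem_EndV_iff (f : Module.End R (VT R N r)) :
    f ∈ EndV q m N r ↔ ∀ k, tau q m k * f = f * tau q m k := by
  rw [EndV, Subalgebra.mem_centralizer_iff]
  constructor
  · intro h k
    rw [← act_T_adj]
    exact h _ ⟨_, rfl⟩
  · rintro h _ ⟨x, rfl⟩
    rw [← (HeckeT q r).sum_repr x, map_sum, Finset.sum_mul, Finset.mul_sum]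
    refine Finset.sum_congr rfl fun w _ => ?_
    rw [map_smul, smul_mul_assoc, mul_smul_comm]
    congr 1
    clear * - h
    induction w using perm_induction with
    | one => rw [HeckeT_one, act_one, one_mul, mul_one]
    | step w k hk ih => rw [act_T_mul_adj q m hk, mul_assoc, ih, ← mul_assoc, h k, mul_assoc]

theorem EndV_act (f : EndV q m N r) (x : Hecke q r) (v : VT R N r) :
    f.1 (act q m x v) = act q m x (f.1 v) := by
  have := (Subalgebra.mem_centralizer_iff R).1 f.2 _ ⟨x, rfl⟩
  exact (LinearMap.congr_fun this v).symm

/-- An `H`-linear endomorphism is determined by its values on the `v_{i_λ}`. -/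
theorem EndV_ext {f g : EndV q m N r}
    (h : ∀ l : Comp N r, f.1 (ub R m N r (word l)) = g.1 (ub R m N r (word l))) : f = g := by
  refine Subtype.ext ((ub R m N r).ext fun i => ?_)
  rw [← act_std_word q m i, EndV_act, EndV_act, h]

variable (N r) in
/-- The isomorphism `End_H(V^{⊗ r}) ≅ End_H(𝔗)` of conjugation with `psi`. -/
def Theta : EndV q m N r ≃ₐ[R] SAlg q m N r :=
  AlgEquiv.ofBijective
    { toFun := fun f =>
        { toFun := fun t => psi q m N r (f.1 ((psi q m N r).symm t))
          map_add' := fun t t' => by simp only [map_add]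
          map_smul' := fun x t => by
            obtain ⟨v, rfl⟩ := (psi q m N r).surjective t
            have : x • psi q m N r v = psi q m N r (act q m x.unop v) :=
              (psi_act q m x.unop v).symm
            rw [this, LinearEquiv.symm_apply_apply, EndV_act, psi_act,
              LinearEquiv.symm_apply_apply]
            rfl }
      map_one' := by
        refine LinearMap.ext fun t => ?_
        exact (psi q m N r).apply_symm_apply t
      map_mul' := fun f g => by
        refine LinearMap.ext fun t => ?_
        change psi q m N r (f.1 (g.1 ((psi q m N r).symm t))) =
          psi q m N r (f.1 ((psi q m N r).symm (psi q m N r (g.1 ((psi q m N r).symm t)))))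
        rw [LinearEquiv.symm_apply_apply]
      map_zero' := by
        refine LinearMap.ext fun t => ?_
        exact map_zero (psi q m N r)
      map_add' := fun f g => by
        refine LinearMap.ext fun t => ?_
        exact map_add (psi q m N r) _ _
      commutes' := fun c => by
        refine LinearMap.ext fun t => ?_
        change psi q m N r (c • (psi q m N r).symm t) = c • t
        rw [map_smul, LinearEquiv.apply_symm_apply] } <| by
    constructor
    · intro f g h
      refine Subtype.ext (LinearMap.ext fun v => (psi q m N r).injective ?_)
      have := LinearMap.congr_fun h (psi q m N r v)
      change psi q m N r (f.1 ((psi q m N r).symm (psi q m N r v))) =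
        psi q m N r (g.1 ((psi q m N r).symm (psi q m N r v))) at this
      rwa [LinearEquiv.symm_apply_apply] at this
    · intro g
      let f : Module.End R (VT R N r) := (psi q m N r).symm.toLinearMap ∘ₗ
        (g.restrictScalars R) ∘ₗ (psi q m N r).toLinearMap
      have hf : ∀ v, psi q m N r (f v) = g (psi q m N r v) := fun v =>
        (psi q m N r).apply_symm_apply _
      refine ⟨⟨f, (Subalgebra.mem_centralizer_iff R).2 ?_⟩, ?_⟩
      · rintro _ ⟨x, rfl⟩
        refine LinearMap.ext fun v => (psi q m N r).injective ?_
        rw [Module.End.mul_apply, Module.End.mul_apply, psi_act, hf, hf, psi_act, map_smul]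
      · refine LinearMap.ext fun t => ?_
        change psi q m N r (f ((psi q m N r).symm t)) = g t
        rw [hf, LinearEquiv.apply_symm_apply]

theorem Theta_psi (f : EndV q m N r) (v : VT R N r) :
    Theta q m N r f (psi q m N r v) = psi q m N r (f.1 v) := by
  change psi q m N r (f.1 ((psi q m N r).symm (psi q m N r v))) = _
  rw [LinearEquiv.symm_apply_apply]

theorem psi_act_word (l : Comp N r) (h : Hecke q r) :
    psi q m N r (act q m h (ub R m N r (word l))) = inT q m l h := by
  rw [psi_act, psi_apply, psiMap_ub, content_word, std_word, HeckeT_one, op_smul_inT, one_mul]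

end Action

/-! ### Double cosets and matrices -/

section Cosets

variable {m N r : ℕ}

/-- The matrix that counts how often the pair `(a, b)` occurs in the sequences `i` and `i_μ`; for
`i = i_λ d` it is `jmat l d mu`. -/
def countMat (i : Fin r → Fin N) (mu : Comp N r) : Matrix (Fin N) (Fin N) ℕ :=
  fun a b => (Finset.univ.filter fun k => i k = a ∧ word mu k = b).card

theorem jmat_eq (l : Comp N r) (d : Perm (Fin r)) (mu : Comp N r) :
    jmat l d mu = countMat (word l ∘ d) mu := rfl

theorem countMat_comp (i : Fin r → Fin N) (mu : Comp N r) {p : Perm (Fin r)} (hp : p ∈ par mu) :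
    countMat (i ∘ p) mu = countMat i mu := by
  ext a b
  refine Finset.card_bij' (fun k _ => p k) (fun k _ => p⁻¹ k) ?_ ?_ ?_ ?_
  · intro k hk
    rw [Finset.mem_filter] at hk ⊢
    exact ⟨Finset.mem_univ _, hk.2.1, by rw [hp]; exact hk.2.2⟩
  · intro k hk
    rw [Finset.mem_filter] at hk ⊢
    refine ⟨Finset.mem_univ _, by simpa using hk.2.1, ?_⟩
    rw [(par mu).inv_mem hp]
    exact hk.2.2
  · intro k _; simp
  · intro k _; simp

theorem co_countMat (i : Fin r → Fin N) (mu : Comp N r) : co (countMat i mu) = mu.1 := by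
  ext b
  rw [← card_word mu b, co]
  simp only [countMat]
  rw [Finset.card_eq_sum_card_fiberwise (f := i) (fun _ _ => Finset.mem_univ _)]
  refine Finset.sum_congr rfl fun a _ => ?_
  rw [Finset.filter_filter]
  congr 1
  ext k
  simp only [Finset.mem_filter, and_comm]

theorem ro_countMat (i : Fin r → Fin N) (mu : Comp N r) : ro (countMat i mu) = (content i).1 := by
  ext a
  rw [ro, content]
  simp only [countMat]
  rw [Finset.card_eq_sum_card_fiberwise (f := word mu) (fun _ _ => Finset.mem_univ _)]
  refine Finset.sum_congr rfl fun b _ => ?_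
  rw [Finset.filter_filter]

/-- The entries of `A` at places of different parities are at most `1`. -/
def IsSuper (m : ℕ) (A : Matrix (Fin N) (Fin N) ℕ) : Prop :=
  ∀ a b, hat m a ≠ hat m b → A a b ≤ 1

theorem hat_eq_of_isSuper {i : Fin r → Fin N} {mu : Comp N r} (h : IsSuper m (countMat i mu))
    {x y : Fin r} (hxy : x ≠ y) (h1 : i x = i y) (h2 : word mu x = word mu y) :
    hat m (i x) = hat m (word mu x) := by
  by_contra hne
  have := Finset.card_le_one.1 (h _ _ hne) x (by simp) y (by simp [h1, h2])
  exact hxy this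

theorem mem_conjBy (P : Subgroup (Perm (Fin r))) (d w : Perm (Fin r)) :
    w ∈ conjBy P d ↔ d * w * d⁻¹ ∈ P := by
  rw [conjBy, Subgroup.mem_map]
  constructor
  · rintro ⟨p, hp, rfl⟩
    simpa [mul_assoc] using hp
  · intro h
    exact ⟨_, h, by simp [mul_assoc]⟩

theorem swap_mem_parPart {l : Comp N r} {x y : Fin r} (h : word l x = word l y) :
    swap x y ∈ parPart m (hat m (word l x)) l := by
  refine ⟨fun k => ?_, fun k hk => ?_⟩
  · rw [swap_apply_def]
    split_ifs with h1 h2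
    · rw [h1, h]
    · rw [h2, h]
    · rfl
  · refine swap_apply_of_ne_of_ne ?_ ?_ <;> rintro rfl
    · exact hk rfl
    · exact hk (by rw [h])

/-- The intersection is a Young subgroup, so it is trivial if and only if its blocks have at most
one letter; the sizes of the blocks are entries of the matrix. -/
theorem conjBy_inf_eq_bot_iff {l mu : Comp N r} {d : Perm (Fin r)} {e e' : ℕ} :
    conjBy (parPart m e l) d ⊓ parPart m e' mu = ⊥ ↔
      ∀ a b, hat m a = e → hat m b = e' → jmat l d mu a b ≤ 1 := by
  constructor
  · intro h a b ha hb
    refine Finset.card_le_one.2 fun x hx y hy => ?_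
    simp only [Finset.mem_filter, Finset.mem_univ, true_and] at hx hy
    have h1 : swap x y ∈ parPart m e' mu := by
      have := swap_mem_parPart (m := m) (hx.2.trans hy.2.symm)
      rwa [hx.2, hb] at this
    have h2 : swap x y ∈ conjBy (parPart m e l) d := by
      rw [mem_conjBy, ← swap_apply_apply]
      have := swap_mem_parPart (m := m) (hx.1.trans hy.1.symm)
      rwa [hx.1, ha] at this
    have h3 : swap x y ∈ (⊥ : Subgroup (Perm (Fin r))) := h ▸ Subgroup.mem_inf.2 ⟨h2, h1⟩
    rw [Subgroup.mem_bot, Perm.one_def, swap_eq_refl_iff] at h3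
    exact h3
  · intro h
    rw [eq_bot_iff]
    intro w hw
    obtain ⟨h2, h1⟩ := Subgroup.mem_inf.1 hw
    rw [mem_conjBy] at h2
    rw [Subgroup.mem_bot]
    ext1 x
    rw [Perm.one_apply]
    have hd : word l (d (w x)) = word l (d x) := by
      have := h2.1 (d x)
      simpa using this
    by_cases hx : hat m (word mu x) = e'
    · by_cases hx' : hat m (word l (d x)) = e
      · exact Finset.card_le_one.1 (h _ _ hx' hx) (w x) (by simp [hd, h1.1 x]) x (by simp)
      · have := h2.2 (d x) hx'
        simpa using this
    · exact h1.2 x hx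

/-- The double coset representatives in terms of sequences; the trivial intersections become the
condition that the matrix has entries `0` and `1` at places of different parities. -/
theorem mem_Dcirc_iff (l mu : Comp N r) (d : Perm (Fin r)) :
    d ∈ Dcirc m l mu ↔
      IsStd (word l) d ∧ IsStd (word mu) d⁻¹ ∧ IsSuper m (jmat l d mu) := by
  rw [Dcirc, Set.mem_ofPred_eq, mem_minReps_iff (word_monotone l) (mem_par l),
    mem_minReps_iff (word_monotone mu) (mem_par mu),
    conjBy_inf_eq_bot_iff, conjBy_inf_eq_bot_iff]
  refine and_congr_right fun _ => and_congr_right fun _ => ⟨fun h a b hab => ?_, fun h => ?_⟩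
  · rcases hat_eq_zero_or_one m a with ha | ha <;> rcases hat_eq_zero_or_one m b with hb | hb
    · omega
    · exact h.1 a b ha hb
    · exact h.2 a b ha hb
    · omega
  · exact ⟨fun a b ha hb => h a b (by omega), fun a b ha hb => h a b (by omega)⟩

/-- The pairs of the `k`-th entries of `i_μ` and `i`, ordered lexicographically. -/
def pairWord (i : Fin r → Fin N) (mu : Comp N r) (k : Fin r) : Fin N ×ₗ Fin N :=
  toLex (word mu k, i k)

theorem pairWord_eq_iff (i j : Fin r → Fin N) (mu : Comp N r) (x y : Fin r) :
    pairWord i mu x = pairWord j mu y ↔ word mu x = word mu y ∧ i x = j y := by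
  rw [pairWord, pairWord, EmbeddingLike.apply_eq_iff_eq, Prod.mk.injEq]

theorem card_pairWord (i : Fin r → Fin N) (mu : Comp N r) (c : Fin N ×ₗ Fin N) :
    (Finset.univ.filter fun k => pairWord i mu k = c).card =
      countMat i mu (ofLex c).2 (ofLex c).1 := by
  rw [countMat]
  congr 1
  ext k
  simp only [Finset.mem_filter, Finset.mem_univ, true_and]
  constructor
  · rintro rfl
    exact ⟨rfl, rfl⟩
  · rintro ⟨h1, h2⟩
    rw [pairWord, h1, h2]
    rfl

/-- Two sequences with the same matrix differ by an element of `W_μ`. -/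
theorem exists_pairWord_comp {i j : Fin r → Fin N} {mu : Comp N r}
    (h : countMat i mu = countMat j mu) :
    ∃ t : Perm (Fin r), pairWord i mu ∘ t = pairWord j mu :=
  exists_comp_perm_eq fun c => by rw [card_pairWord, card_pairWord, h]

theorem pairWord_monotone {i : Fin r → Fin N} {mu : Comp N r}
    (h : ∀ a b, a < b → word mu a = word mu b → i a ≤ i b) : Monotone (pairWord i mu) := by
  intro a b hab
  rcases hab.lt_or_eq with hlt | rfl
  · rw [pairWord, pairWord, Prod.Lex.toLex_le_toLex]
    rcases (word_monotone mu hab).lt_or_eq with hw | hw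
    · exact Or.inl hw
    · exact Or.inr ⟨hw, h a b hlt hw⟩
  · exact le_rfl

section

variable {l mu : Comp N r} {d : Perm (Fin r)}

theorem Dcirc_lt (hd : d ∈ Dcirc m l mu) {a b : Fin r} (hab : a < b)
    (h : word mu a = word mu b) : d a < d b := by
  by_contra hn
  rcases (not_lt.1 hn).lt_or_eq with hlt | heq
  · have := ((mem_Dcirc_iff l mu d).1 hd).2.1 _ _ hlt (by simpa using h.symm)
    simp only [Perm.coe_inv, symm_apply_apply] at this
    exact absurd hab (not_lt.2 this.le)
  · exact hab.ne (d.injective heq.symm)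

theorem Dcirc_le (hd : d ∈ Dcirc m l mu) {a b : Fin r} (hab : a < b)
    (h : word mu a = word mu b) : (word l ∘ d) a ≤ (word l ∘ d) b :=
  word_monotone l (Dcirc_lt hd hab h).le

theorem Dcirc_pairWord_monotone (hd : d ∈ Dcirc m l mu) :
    Monotone (pairWord (word l ∘ d) mu) := pairWord_monotone fun _ _ => Dcirc_le hd

theorem Dcirc_eq_std (hd : d ∈ Dcirc m l mu) : d = std (word l ∘ d) :=
  eq_std (word_monotone l) rfl ((mem_Dcirc_iff l mu d).1 hd).1

theorem mem_nuPar (w : Perm (Fin r)) : w ∈ nuPar l d mu ↔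
    ∀ k, pairWord (word l ∘ d) mu (w k) = pairWord (word l ∘ d) mu k := by
  rw [nuPar, Subgroup.mem_inf, mem_conjBy, mem_par, mem_par]
  simp only [pairWord_eq_iff]
  rw [forall_and, and_comm]
  refine and_congr_right fun _ => ⟨fun h k => ?_, fun h k => ?_⟩
  · simpa using h (d k)
  · simpa using h (d⁻¹ k)

/-- `W_ν` is the stabiliser of the monotone sequence of pairs, so that its shortest coset
representatives are again described by `IsStd`. -/
theorem mem_minReps_nuPar (hd : d ∈ Dcirc m l mu) (x : Perm (Fin r)) :
    x ∈ minReps (nuPar l d mu) ↔ IsStd (pairWord (word l ∘ d) mu) x :=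
  mem_minReps_iff (Dcirc_pairWord_monotone hd) mem_nuPar x

/-- The matrix of a double coset determines the double coset. -/
theorem Dcirc_unique {l' mu' : Comp N r} {d' : Perm (Fin r)} (hd : d ∈ Dcirc m l mu)
    (hd' : d' ∈ Dcirc m l' mu') (h : jmat l d mu = jmat l' d' mu') :
    l = l' ∧ mu = mu' ∧ d = d' := by
  have h1 : mu = mu' := Subtype.ext <| by
    rw [← co_countMat (word l ∘ d) mu, ← jmat_eq, h, jmat_eq, co_countMat]
  have h2 : l = l' := by
    rw [← content_word l, ← content_comp (word l) d, ← content_word l',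
      ← content_comp (word l') d']
    exact Subtype.ext <| by
      rw [← ro_countMat (word l ∘ d) mu, ← jmat_eq, h, jmat_eq, ro_countMat]
  subst h1 h2
  have h3 := eq_of_monotone_of_card (Dcirc_pairWord_monotone hd) (Dcirc_pairWord_monotone hd')
    fun c => by rw [card_pairWord, card_pairWord, ← jmat_eq, ← jmat_eq, h]
  have h4 : word l ∘ d = word l ∘ d' :=
    funext fun k => ((pairWord_eq_iff _ _ _ _ _).1 (congrFun h3 k)).2
  rw [Dcirc_eq_std hd, Dcirc_eq_std hd', h4]
  exact ⟨rfl, rfl, rfl⟩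

end

/-- Every matrix of a pair of sequences whose entries at places of different parities are at most
`1` comes from a double coset. -/
theorem exists_Dcirc {i : Fin r → Fin N} {mu : Comp N r} (h : IsSuper m (countMat i mu)) :
    ∃ l, ∃ d ∈ Dcirc m l mu, jmat l d mu = countMat i mu := by
  -- rearrange `i` increasingly within each block of `μ`
  let t := Tuple.sort (pairWord i mu)
  have ht : Monotone (pairWord i mu ∘ t) := Tuple.monotone_sort _
  have hmu : word mu ∘ t = word mu := by
    refine eq_of_monotone_of_card ?_ (word_monotone mu) fun c => ?_
    · intro a b hab
      have := ht hab
      simp only [Function.comp_apply, pairWord, Prod.Lex.toLex_le_toLex] at this ⊢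
      rcases this with h1 | h1
      · exact h1.le
      · exact h1.1.le
    · have h1 := congrArg (fun l => l.1 c) (content_comp (word mu) t)
      exact h1
  have htp : t ∈ par mu := fun k => congrFun hmu k
  have hle : ∀ a b, a < b → word mu a = word mu b → (i ∘ t) a ≤ (i ∘ t) b := by
    intro a b hab hw
    have := ht hab.le
    simp only [Function.comp_apply, pairWord, Prod.Lex.toLex_le_toLex] at this ⊢
    rw [htp, htp] at this
    rcases this with h1 | h1
    · exact absurd hw h1.ne
    · exact h1.2
  have hwd : word (content (i ∘ t)) ∘ std (i ∘ t) = i ∘ t := word_content_comp_std _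
  have hj : jmat (content (i ∘ t)) (std (i ∘ t)) mu = countMat i mu := by
    rw [jmat_eq, hwd, countMat_comp i mu htp]
  refine ⟨content (i ∘ t), std (i ∘ t), (mem_Dcirc_iff _ _ _).2 ⟨isStd_word_std _, ?_, ?_⟩, hj⟩
  · intro a b hab hw
    by_contra hn
    have hne : (std (i ∘ t))⁻¹ b < (std (i ∘ t))⁻¹ a :=
      lt_of_le_of_ne (not_lt.1 hn) fun he => hab.ne' ((std (i ∘ t))⁻¹.injective he)
    have h2 := hle _ _ hne hw.symm
    have h3 : std (i ∘ t) ((std (i ∘ t))⁻¹ b) < std (i ∘ t) ((std (i ∘ t))⁻¹ a) := by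
      rw [std_lt_std_iff]
      rcases h2.lt_or_eq with h2 | h2
      · exact Or.inl h2
      · exact Or.inr ⟨h2, hne⟩
    simp only [Perm.coe_inv, apply_symm_apply] at h3
    exact absurd hab (not_lt.2 h3.le)
  · rw [hj]
    exact h

end Cosets

/-! ### The relative norm is linear over the Hecke algebra -/

section RelNorm

variable {R : Type*} [CommRing R] (q : Rˣ) (m : ℕ) {N r : ℕ}

theorem sgn_mul_self (i : Fin r → Fin N) : sgn R m i * sgn R m i = 1 := by
  rw [sgn, ← Finset.prod_mul_distrib]
  refine Finset.prod_eq_one fun p _ => ?_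
  rw [← mul_pow]
  simp

theorem vb_eq (i : Fin r → Fin N) : vb R N r i = (sgn R m i : R) • ub R m N r i := by
  rw [ub_apply, smul_smul, ← Units.val_mul, sgn_mul_self, Units.val_one, one_smul]

theorem qdd_eq_of_hat_eq {h h' : Fin N} (e : hat m h = hat m h') : qdd q m h = qdd q m h' := by
  rw [hat, hat] at e
  rw [qdd, qdd]
  split_ifs at * <;> simp_all

theorem qd_eq_of_hat_eq {h h' : Fin N} (e : hat m h = hat m h') : qd q m h = qd q m h' := by
  rw [hat, hat] at e
  rw [qd, qd]
  split_ifs at * <;> simp_all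

theorem qd_mul (h : Fin N) : qd q m h * q = qdd q m h := by
  rw [qd, qdd]
  split_ifs <;> simp

theorem eUnit_ub_word (l : Comp N r) (d : Perm (Fin r)) (mu : Comp N r) :
    (eUnit l d mu : Module.End R (VT R N r)) (ub R m N r (word mu)) =
      (sgn R m (word l ∘ d) : R) • ub R m N r (word l ∘ d) := by
  rw [ub_word, eUnit, Module.Basis.constr_basis, if_pos rfl, vb_eq m]

theorem eUnit_ub_of_ne (l : Comp N r) (d : Perm (Fin r)) (mu : Comp N r) {i : Fin r → Fin N}
    (hi : i ≠ word mu) : (eUnit l d mu : Module.End R (VT R N r)) (ub R m N r i) = 0 := by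
  rw [ub_apply, map_smul, eUnit, Module.Basis.constr_basis, if_neg hi, smul_zero]

variable {m} {l mu : Comp N r} {d : Perm (Fin r)}

/-- The matrix unit is linear over the Hecke algebra of `W_ν`. -/
theorem eUnit_tau (hd : d ∈ Dcirc m l mu) {j : Fin (r - 1)}
    (hj : pairWord (word l ∘ d) mu (lo j) = pairWord (word l ∘ d) mu (hi j)) :
    eUnit l d mu * tau q m j = tau q m j * eUnit l d mu := by
  rw [pairWord_eq_iff] at hj
  refine (ub R m N r).ext fun i => ?_
  rw [Module.End.mul_apply, Module.End.mul_apply]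
  by_cases hi : i = word mu
  · have hh := hat_eq_of_isSuper ((mem_Dcirc_iff l mu d).1 hd).2.2 (lo_lt_hi j).ne hj.2 hj.1
    rw [hi, tau_ub_of_eq q m _ j hj.1, map_smul, eUnit_ub_word, map_smul,
      tau_ub_of_eq q m _ j hj.2, smul_comm, ← qdd_eq_of_hat_eq q m hh]
    rfl
  · have hi' : i ∘ adj j ≠ word mu := by
      intro he
      apply hi
      rw [← comp_adj_adj i j, he, comp_adj_of_eq _ j hj.1]
    rw [eUnit_ub_of_ne m l d mu hi, map_zero]
    rcases lt_trichotomy (i (lo j)) (i (QSchur.hi j)) with h | h | h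
    · rw [tau_ub_of_lt q m i j h, eUnit_ub_of_ne m l d mu hi']
    · rw [tau_ub_of_eq q m i j h, map_smul, eUnit_ub_of_ne m l d mu hi, smul_zero]
    · have h' : (i ∘ adj j) (lo j) < (i ∘ adj j) (QSchur.hi j) := by
        simpa only [Function.comp_apply, adj_lo, adj_hi] using h
      have h2 := tau_ub_comp_of_lt q m (i ∘ adj j) j h'
      rw [comp_adj_adj] at h2
      rw [h2, map_add, map_smul, map_smul, eUnit_ub_of_ne m l d mu hi,
        eUnit_ub_of_ne m l d mu hi', smul_zero, smul_zero, add_zero]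

theorem tau_mul_tau (k : Fin (r - 1)) : (tau q m k : Module.End R (VT R N r)) * tau q m k =
    ((q : R) - 1) • tau q m k + (q : R) • 1 := by
  have h := T_mul_adj_mul_adj q (w := 1) (k := k) (lo_lt_hi k)
  rw [one_mul, HeckeT_one] at h
  rw [← act_T_adj, ← act_mul, h, map_add, map_smul, map_smul, act_one]

theorem T_adj_mul_T_inv {x : Perm (Fin r)} {k : Fin (r - 1)} (h : x (lo k) < x (hi k)) :
    HeckeT q r (adj k) * HeckeT q r x⁻¹ = HeckeT q r (adj k * x⁻¹) := by
  refine T_mul_T q fun a b hab hx => adj_lt k hx ?_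
  rintro ⟨h1, h2⟩
  rw [← h1, ← h2] at h
  simp only [Perm.coe_inv, apply_symm_apply] at h
  exact absurd hab (not_lt.2 h.le)

/-- The relative norm is `H`-linear: the shortest coset representatives come in pairs `x`, `x s_k`,
for which the sum of the two terms commutes with `T_{s_k}`, and representatives `x` with
`x s_k = s_j x`, `s_j ∈ W_ν`, whose term commutes with `T_{s_k}` since the matrix unit commutes
with `T_{s_j}`. -/
theorem relNorm_mem (hd : d ∈ Dcirc m l mu) : relNorm q m l d mu ∈ EndV q m N r := by
  classical
  rw [mem_EndV_iff]
  intro k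
  let Y : Perm (Fin r) → Module.End R (VT R N r) := fun x =>
    act q m (HeckeT q r x) * eUnit l d mu * act q m (HeckeT q r x⁻¹)
  let G : Perm (Fin r) → Module.End R (VT R N r) := fun x => ((q⁻¹ ^ len x : Rˣ) : R) • Y x
  change tau q m k * ∑ x with x ∈ minReps (nuPar l d mu), G x =
    (∑ x with x ∈ minReps (nuPar l d mu), G x) * tau q m k
  have hY1 : ∀ x : Perm (Fin r), x (lo k) < x (hi k) →
      Y (x * adj k) = tau q m k * Y x * tau q m k := by
    intro x hx
    change act q m (HeckeT q r (x * adj k)) * eUnit l d mu *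
      act q m (HeckeT q r (x * adj k)⁻¹) = tau q m k * (act q m (HeckeT q r x) * eUnit l d mu *
        act q m (HeckeT q r x⁻¹)) * tau q m k
    rw [act_T_mul_adj q m hx, mul_inv_rev, adj_inv, ← T_adj_mul_T_inv q hx, act_mul, act_T_adj]
    simp only [mul_assoc]
  have hY2 : ∀ x ∈ minReps (nuPar l d mu), x * adj k ∉ minReps (nuPar l d mu) →
      tau q m k * Y x = Y x * tau q m k := by
    intro x hx hxk
    rw [mem_minReps_nuPar hd] at hx hxk
    have he : pairWord (word l ∘ d) mu (x (lo k)) = pairWord (word l ∘ d) mu (x (hi k)) := by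
      by_contra hne
      apply hxk
      intro a b hab h
      refine hx _ _ (adj_lt k hab ?_) h
      rintro ⟨rfl, rfl⟩
      rw [Perm.mul_apply, Perm.mul_apply, adj_lo, adj_hi] at h
      exact hne h.symm
    have hlt := hx _ _ (lo_lt_hi k) he
    obtain ⟨j, hj1, hj2, hj⟩ := exists_adj_mul (Dcirc_pairWord_monotone hd) hx he
    have hje : pairWord (word l ∘ d) mu (lo j) = pairWord (word l ∘ d) mu (hi j) := by
      rw [hj1, hj2, he]
    have hjm : ∀ y, pairWord (word l ∘ d) mu (adj j y) = pairWord (word l ∘ d) mu y := by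
      intro y
      rw [pairWord_eq_iff] at hje ⊢
      exact ⟨adj_mem_par hje.1 y, congrFun (comp_adj_of_eq (word l ∘ d) j hje.2) y⟩
    have e1 : tau q m k * act q m (HeckeT q r x) =
        (act q m (HeckeT q r x) * tau q m j : Module.End R (VT R N r)) := by
      rw [← act_T_mul_adj q m hlt, hj,
        ← T_mul_T_of_isStd q (Dcirc_pairWord_monotone hd) hx hjm, act_mul, act_T_adj]
    have hinv : adj k * x⁻¹ = x⁻¹ * adj j := by
      rw [eq_inv_mul_iff_mul_eq, ← mul_assoc, hj, mul_assoc, mul_inv_cancel, mul_one]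
    have e2 : act q m (HeckeT q r x⁻¹) * tau q m k =
        (tau q m j * act q m (HeckeT q r x⁻¹) : Module.End R (VT R N r)) := by
      rw [← act_T_adj q m k, ← act_mul, T_adj_mul_T_inv q hlt, hinv, act_T_mul_adj]
      rw [hj1, hj2]
      simp
    change tau q m k * (act q m (HeckeT q r x) * eUnit l d mu * act q m (HeckeT q r x⁻¹)) =
      act q m (HeckeT q r x) * eUnit l d mu * act q m (HeckeT q r x⁻¹) * tau q m k
    rw [mul_assoc _ _ (tau q m k), e2, ← mul_assoc, ← mul_assoc, e1, mul_assoc _ (tau q m j),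
      ← eUnit_tau q hd hje]
    simp only [mul_assoc]
  rw [← Finset.sum_filter_add_sum_filter_not _ (fun x => x * adj k ∈ minReps (nuPar l d mu)),
    mul_add, add_mul]
  congr 1
  · rw [sum_pairs _ k, Finset.mul_sum, Finset.sum_mul]
    · refine Finset.sum_congr rfl fun x hx => ?_
      have hlt := (Finset.mem_filter.1 hx).2
      have hq : ((q⁻¹ ^ len (x * adj k) : Rˣ) : R) * q = ((q⁻¹ ^ len x : Rˣ) : R) := by
        rw [len_mul_adj x k hlt, ← Units.val_mul, pow_succ, inv_mul_cancel_right]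
      change tau q m k * (_ • Y x + _ • Y (x * adj k)) = (_ • Y x + _ • Y (x * adj k)) * tau q m k
      have h1 : tau q m k * (tau q m k * Y x * tau q m k) =
          ((q : R) - 1) • (tau q m k * Y x * tau q m k) + (q : R) • (Y x * tau q m k) := by
        rw [← mul_assoc, ← mul_assoc, tau_mul_tau, add_mul, add_mul]
        simp only [smul_mul_assoc, one_mul]
      have h2 : tau q m k * Y x * tau q m k * tau q m k =
          ((q : R) - 1) • (tau q m k * Y x * tau q m k) + (q : R) • (tau q m k * Y x) := by
        rw [mul_assoc, tau_mul_tau, mul_add]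
        simp only [mul_smul_comm, mul_one]
      rw [hY1 x hlt, mul_add, add_mul, mul_smul_comm, mul_smul_comm, smul_mul_assoc,
        smul_mul_assoc, h1, h2, ← hq]
      module
    · intro x hx
      simp only [Finset.mem_filter, Finset.mem_univ, true_and] at hx ⊢
      exact ⟨hx.2, by rw [mul_adj_mul_adj]; exact hx.1⟩
  · rw [Finset.mul_sum, Finset.sum_mul]
    refine Finset.sum_congr rfl fun x hx => ?_
    simp only [Finset.mem_filter, Finset.mem_univ, true_and] at hx
    change tau q m k * (_ • Y x) = (_ • Y x) * tau q m k
    rw [mul_smul_comm, smul_mul_assoc, hY2 x hx.1 hx.2]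

/-! ### The values of the relative norm -/

theorem prod_inv_inv {M : Type*} [CommMonoid M] (g : Fin r → Fin r → M) (w : Perm (Fin r)) :
    ∏ p ∈ inv w⁻¹, g p.1 p.2 = ∏ p ∈ inv w, g (w p.2) (w p.1) := by
  refine Finset.prod_bij' (fun p _ => (w⁻¹ p.2, w⁻¹ p.1)) (fun p _ => (w p.2, w p.1))
    ?_ ?_ ?_ ?_ ?_
  · rintro ⟨a, b⟩ hab
    rw [mem_inv] at hab ⊢
    exact ⟨hab.2, by simpa using hab.1⟩
  · rintro ⟨a, b⟩ hab
    rw [mem_inv] at hab ⊢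
    exact ⟨hab.2, by simpa using hab.1⟩
  · rintro ⟨a, b⟩ _; simp
  · rintro ⟨a, b⟩ _; simp
  · rintro ⟨a, b⟩ _; simp

/-- The factor `q^{-ℓ(p)}` of the relative norm turns the eigenvalues `q` and `-1` of `T_{p⁻¹}` on
`v_{i_μ}` into the coefficients `1` and `-q⁻¹` of `T_D`. -/
theorem eqWt_inv {p : Perm (Fin r)} (hp : p ∈ par mu) :
    q⁻¹ ^ len p * eqWt q m (word mu) p⁻¹ = invWt q m mu p := by
  have hp' := (par mu).inv_mem hp
  have h1 : eqWt q m (word mu) p⁻¹ = ∏ x ∈ inv p⁻¹, qdd q m (word mu x.1) := by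
    refine Finset.prod_congr rfl fun x hx => ?_
    rw [mem_inv p⁻¹ x.1 x.2] at hx
    rw [hp', hp', if_pos (word_eq_of_mem_inv hp' hx.1 hx.2)]
  rw [h1, prod_inv_inv (fun x _ => qdd q m (word mu x)), len_eq, ← Finset.prod_const,
    ← Finset.prod_mul_distrib, invWt]
  refine Finset.prod_congr rfl fun x hx => ?_
  rw [mem_inv p x.1 x.2] at hx
  rw [hp, hp, word_eq_of_mem_inv hp hx.1 hx.2, ← qd_mul, mul_comm, mul_inv_cancel_right]

/-- The set `D_ν ∩ W_μ` is compatible with the decomposition of `W_μ` into its even and odd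
parts. -/
theorem isStd_mul_iff (i : Fin r → Fin N) {w₀ w₁ : Perm (Fin r)} (h₀ : w₀ ∈ parPart m 0 mu)
    (h₁ : w₁ ∈ parPart m 1 mu) :
    IsStd (pairWord i mu) (w₀ * w₁) ↔ IsStd (pairWord i mu) w₀ ∧ IsStd (pairWord i mu) w₁ := by
  have e0 : ∀ k, hat m (word mu k) = 0 → (w₀ * w₁) k = w₀ k ∧ w₁ k = k := fun k hk => by
    rw [Perm.mul_apply, h₁.2 k (by omega)]; exact ⟨rfl, rfl⟩
  have e1 : ∀ k, hat m (word mu k) = 1 → (w₀ * w₁) k = w₁ k ∧ w₀ k = k := fun k hk => by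
    rw [Perm.mul_apply, h₀.2 (w₁ k) (by rw [h₁.1]; omega), h₀.2 k (by omega)]; exact ⟨rfl, rfl⟩
  have hw : ∀ {w}, w ∈ par mu → ∀ {a b}, pairWord i mu (w a) = pairWord i mu (w b) →
      word mu a = word mu b := by
    intro w hw a b h
    rw [pairWord_eq_iff, hw, hw] at h
    exact h.1
  constructor
  · refine fun h => ⟨fun a b hab he => ?_, fun a b hab he => ?_⟩
    · have hm := hw h₀.1 he
      rcases hat_eq_zero_or_one m (word mu a) with ha | ha
      · have := h a b hab
        rw [(e0 a ha).1, (e0 b (by rw [← hm, ha])).1] at this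
        exact this he
      · rwa [(e1 a ha).2, (e1 b (by rw [← hm, ha])).2]
    · have hm := hw h₁.1 he
      rcases hat_eq_zero_or_one m (word mu a) with ha | ha
      · rwa [(e0 a ha).2, (e0 b (by rw [← hm, ha])).2]
      · have := h a b hab
        rw [(e1 a ha).1, (e1 b (by rw [← hm, ha])).1] at this
        exact this he
  · rintro ⟨h0, h1⟩ a b hab he
    have hm := hw (mul_mem h₀.1 h₁.1) he
    rcases hat_eq_zero_or_one m (word mu a) with ha | ha
    · rw [(e0 a ha).1, (e0 b (by rw [← hm, ha])).1] at he ⊢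
      exact h0 a b hab he
    · rw [(e1 a ha).1, (e1 b (by rw [← hm, ha])).1] at he ⊢
      exact h1 a b hab he

open Classical in
theorem TD_nuPar (hd : d ∈ Dcirc m l mu) :
    TD q m mu (minReps (nuPar l d mu) ∩ par mu) =
      ∑ p with p ∈ minReps (nuPar l d mu) ∧ p ∈ par mu,
        (invWt q m mu p : R) • HeckeT q r p := by
  rw [TD_eq_sum]
  · refine Finset.sum_congr ?_ fun _ _ => rfl
    ext p
    simp only [Finset.mem_filter, Set.mem_inter_iff, SetLike.mem_coe]
    tauto
  · intro w₀ h₀ w₁ h₁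
    simp only [Set.mem_inter_iff, SetLike.mem_coe, mem_minReps_nuPar hd, isStd_mul_iff _ h₀ h₁,
      h₀.1, h₁.1, mul_mem h₀.1 h₁.1, and_true]

/-- The relative norm sends `v_{i_μ}` to `± v_{i_λ d} T_{D_ν ∩ W_μ}` and kills the other
`v_{i_α}`. -/
theorem relNorm_word (hd : d ∈ Dcirc m l mu) (a : Comp N r) :
    relNorm q m l d mu (ub R m N r (word a)) =
      if a = mu then (sgn R m (word l ∘ d) : R) •
        act q m (TD q m mu (minReps (nuPar l d mu) ∩ par mu)) (ub R m N r (word l ∘ d))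
      else 0 := by
  classical
  have hx : ∀ x : Perm (Fin r), act q m (HeckeT q r x⁻¹) (ub R m N r (word a)) =
      (eqWt q m (word a) x⁻¹ : R) • ub R m N r (word a ∘ ⇑x⁻¹) := fun x =>
    act_T_ub q m _ _ fun b c _ h => word_monotone a h.le
  have hne : ∀ x : Perm (Fin r), ¬ (a = mu ∧ x ∈ par mu) → word a ∘ ⇑x⁻¹ ≠ word mu := by
    intro x h he
    have h1 : a = mu := by
      rw [← content_word a, ← content_comp (word a) x⁻¹, he, content_word]
    subst h1
    refine h ⟨rfl, ?_⟩
    rw [← inv_inv x]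
    exact (par a).inv_mem fun k => congrFun he k
  rw [relNorm, LinearMap.sum_apply]
  simp only [LinearMap.smul_apply, Module.End.mul_apply, hx]
  split_ifs with ham
  · subst ham
    rw [TD_nuPar q hd, map_sum, LinearMap.sum_apply, Finset.smul_sum]
    rw [Finset.sum_filter, Finset.sum_filter]
    refine Finset.sum_congr rfl fun x _ => ?_
    by_cases hp : x ∈ par a
    · have he : word a ∘ ⇑x⁻¹ = word a := funext fun k => (par a).inv_mem hp k
      simp only [hp, and_true]
      split_ifs
      · rw [he, map_smul, eUnit_ub_word, map_smul, map_smul, smul_smul, ← Units.val_mul,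
          eqWt_inv q hp, map_smul, LinearMap.smul_apply, smul_comm]
      · rfl
    · simp only [hp, and_false, if_false]
      rw [map_smul, eUnit_ub_of_ne m l d a (hne x fun h => hp h.2), smul_zero, map_zero,
        smul_zero, ite_self]
  · refine Finset.sum_eq_zero fun x _ => ?_
    rw [map_smul, eUnit_ub_of_ne m l d mu (hne x fun h => ham h.1), smul_zero, map_zero,
      smul_zero]

/-- The coefficient of `ub i` in the image of `v_{i_μ}`: the inversions of `i` within an even
block of `μ` have weight `1`, those within an odd block have weight `-q⁻¹`. -/
def blkWt (q : Rˣ) (m : ℕ) (mu : Comp N r) (i : Fin r → Fin N) : Rˣ :=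
  ∏ p ∈ inv (std i), if word mu p.1 = word mu p.2 then qd q m (word mu p.1) else 1

/-- The inversions of `p` are the inversions within the blocks of `μ` of the sequence it yields. -/
theorem invWt_eq_blkWt (hd : d ∈ Dcirc m l mu) {p : Perm (Fin r)} (hp : p ∈ par mu)
    (hs : IsStd (pairWord (word l ∘ d) mu) p) :
    invWt q m mu p = blkWt q m mu (word l ∘ d ∘ p) := by
  rw [invWt, blkWt, ← Finset.prod_filter]
  refine Finset.prod_congr ?_ fun x _ => by rw [hp]
  ext ⟨a, b⟩
  rw [Finset.mem_filter, mem_inv, mem_inv_std]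
  constructor
  · rintro ⟨hab, h⟩
    have hw := word_eq_of_mem_inv hp hab h
    have hw' : word mu (p b) = word mu (p a) := by rw [hp, hp, hw]
    refine ⟨⟨hab, lt_of_le_of_ne (Dcirc_le hd h hw') fun he => ?_⟩, hw⟩
    exact absurd (hs a b hab ((pairWord_eq_iff _ _ _ _ _).2 ⟨hw'.symm, he.symm⟩))
      (not_lt.2 h.le)
  · rintro ⟨⟨hab, h⟩, hw⟩
    refine ⟨hab, ?_⟩
    by_contra hn
    have hne : p a < p b := lt_of_le_of_ne (not_lt.1 hn) fun he => hab.ne (p.injective he)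
    exact absurd (Dcirc_le hd hne (by rw [hp, hp]; exact hw)) (not_le.2 h)

/-- The vector `v_{i_λ d} T_{D_ν ∩ W_μ}`, up to sign, as a sum over the sequences with a given
matrix. -/
theorem act_TD_ub (hd : d ∈ Dcirc m l mu) :
    act q m (TD q m mu (minReps (nuPar l d mu) ∩ par mu)) (ub R m N r (word l ∘ d)) =
      ∑ i with countMat i mu = jmat l d mu, (blkWt q m mu i : R) • ub R m N r i := by
  classical
  rw [TD_nuPar q hd, map_sum, LinearMap.sum_apply]
  refine Finset.sum_bij (fun p _ => word l ∘ d ∘ p) ?_ ?_ ?_ ?_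
  · intro p hp
    rw [Finset.mem_filter] at hp ⊢
    exact ⟨Finset.mem_univ _, countMat_comp (word l ∘ d) mu hp.2.2⟩
  · intro p hp p' hp' he
    rw [Finset.mem_filter, mem_minReps_nuPar hd] at hp hp'
    have h1 : pairWord (word l ∘ d) mu ∘ p = pairWord (word l ∘ d) mu ∘ p' := by
      ext1 k
      refine (pairWord_eq_iff _ _ _ _ _).2 ⟨?_, congrFun he k⟩
      rw [hp.2.2, hp'.2.2]
    exact (eq_std (Dcirc_pairWord_monotone hd) h1 hp.2.1).trans
      (eq_std (Dcirc_pairWord_monotone hd) rfl hp'.2.1).symm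
  · intro i hi
    rw [Finset.mem_filter] at hi
    obtain ⟨t, ht⟩ := exists_pairWord_comp hi.2.symm
    have h1 := comp_std (Dcirc_pairWord_monotone hd) ht
    have h2 := fun k => (pairWord_eq_iff _ _ _ _ _).1 (congrFun h1 k)
    refine ⟨std (pairWord i mu), ?_, funext fun k => (h2 k).2⟩
    rw [Finset.mem_filter, mem_minReps_nuPar hd]
    exact ⟨Finset.mem_univ _, isStd_std _ _ h1, fun k => (h2 k).1⟩
  · intro p hp
    rw [Finset.mem_filter, mem_minReps_nuPar hd] at hp
    rw [map_smul, LinearMap.smul_apply, act_T_ub_of_lt, invWt_eq_blkWt q hd hp.2.2 hp.2.1]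
    · rfl
    · intro a b hab h
      have hw : word mu (p b) = word mu (p a) := by
        rw [hp.2.2, hp.2.2, word_eq_of_mem_inv hp.2.2 hab h]
      refine lt_of_le_of_ne (Dcirc_le hd h hw) fun he => ?_
      exact absurd (hp.2.1 a b hab ((pairWord_eq_iff _ _ _ _ _).2 ⟨hw.symm, he.symm⟩))
        (not_lt.2 h.le)

/-- The sign between the relative norm basis and the standard basis. -/
theorem sgn_eq (hd : d ∈ Dcirc m l mu) :
    sgn R m (word l ∘ d) = (-1) ^ hatM m (jmat l d mu) := by
  classical
  have h1 : sgn R m (word l ∘ d) = (-1) ^ ((inv (std (word l ∘ d))).filter fun p =>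
      m ≤ ((word l ∘ d) p.1 : ℕ) ∧ m ≤ ((word l ∘ d) p.2 : ℕ)).card := by
    rw [sgn, ← Finset.prod_const, Finset.prod_filter]
    refine Finset.prod_congr rfl fun p _ => ?_
    rw [hat, hat]
    split_ifs <;> first | omega | simp
  rw [h1]
  congr 1
  set i := word l ∘ d with hi
  have hmem : ∀ a b, (a, b) ∈ inv (std i) ↔ i b < i a ∧ word mu a < word mu b := by
    intro a b
    rw [mem_inv_std]
    constructor
    · rintro ⟨hab, h⟩
      refine ⟨h, lt_of_le_of_ne (word_monotone mu hab.le) fun he => ?_⟩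
      exact absurd (Dcirc_le hd hab he) (not_le.2 h)
    · rintro ⟨h, hw⟩
      exact ⟨(word_monotone mu).reflect_lt hw, h⟩
  have h2 : ((inv (std i)).filter fun p => m ≤ (i p.1 : ℕ) ∧ m ≤ (i p.2 : ℕ)) =
      (Finset.univ.filter fun k : Fin N => m ≤ (k : ℕ)).biUnion fun k =>
        (Finset.Ioi k).biUnion fun i' => Finset.univ.biUnion fun j =>
          (Finset.Ioi j).biUnion fun j' =>
            (Finset.univ.filter fun x => i x = i' ∧ word mu x = j) ×ˢ
              (Finset.univ.filter fun x => i x = k ∧ word mu x = j') := by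
    ext ⟨a, b⟩
    simp only [Finset.mem_filter, hmem, Finset.mem_biUnion, Finset.mem_univ, true_and,
      Finset.mem_Ioi, Finset.mem_product]
    constructor
    · rintro ⟨⟨h3, h4⟩, -, h5⟩
      exact ⟨i b, h5, i a, h3, word mu a, word mu b, h4, ⟨rfl, rfl⟩, rfl, rfl⟩
    · rintro ⟨k, h5, i', h3, j, j', h4, ⟨rfl, rfl⟩, rfl, rfl⟩
      exact ⟨⟨h3, h4⟩, h5.trans h3.le, h5⟩
  rw [h2, hatM, jmat_eq, Finset.card_biUnion]
  · refine Finset.sum_congr rfl fun k _ => ?_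
    rw [Finset.card_biUnion]
    · refine Finset.sum_congr rfl fun i' _ => ?_
      rw [Finset.card_biUnion]
      · refine Finset.sum_congr rfl fun j _ => ?_
        rw [Finset.card_biUnion]
        · exact Finset.sum_congr rfl fun j' _ => Finset.card_product _ _
        · intro x _ y _ hxy
          refine Finset.disjoint_left.2 fun p hp hp' => hxy ?_
          simp only [Finset.mem_product, Finset.mem_filter] at hp hp'
          rw [← hp.2.2.2, ← hp'.2.2.2]
      · intro x _ y _ hxy
        refine Finset.disjoint_left.2 fun p hp hp' => hxy ?_
        simp only [Finset.mem_biUnion, Finset.mem_product, Finset.mem_filter] at hp hp'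
        obtain ⟨_, _, hp, _⟩ := hp
        obtain ⟨_, _, hp', _⟩ := hp'
        rw [← hp.2.2, ← hp'.2.2]
    · intro x _ y _ hxy
      refine Finset.disjoint_left.2 fun p hp hp' => hxy ?_
      simp only [Finset.mem_biUnion, Finset.mem_product, Finset.mem_filter] at hp hp'
      obtain ⟨_, _, _, _, hp, _⟩ := hp
      obtain ⟨_, _, _, _, hp', _⟩ := hp'
      rw [← hp.2.1, ← hp'.2.1]
  · intro x _ y _ hxy
    refine Finset.disjoint_left.2 fun p hp hp' => hxy ?_
    simp only [Finset.mem_biUnion, Finset.mem_product, Finset.mem_filter] at hp hp'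
    obtain ⟨_, _, _, _, _, _, _, hp⟩ := hp
    obtain ⟨_, _, _, _, _, _, _, hp'⟩ := hp'
    rw [← hp.2.1, ← hp'.2.1]

end RelNorm

/-! ### Changing one entry of a sequence -/

section Update

variable {m N r : ℕ}

theorem countMat_update (i : Fin r → Fin N) (mu : Comp N r) (p : Fin r) (t : Fin N) :
    countMat (Function.update i p t) mu + Matrix.single (i p) (word mu p) 1 =
      countMat i mu + Matrix.single t (word mu p) 1 := by
  ext a b
  simp only [Matrix.add_apply, countMat, Finset.card_filter, Matrix.single_apply]
  rw [← Finset.add_sum_erase _ _ (Finset.mem_univ p),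
    ← Finset.add_sum_erase (a := p) _ (fun k => if i k = a ∧ word mu k = b then 1 else 0)
      (Finset.mem_univ p), Function.update_self]
  have : ∑ k ∈ Finset.univ.erase p, (if Function.update i p t k = a ∧ word mu k = b then 1 else 0) =
      ∑ k ∈ Finset.univ.erase p, if i k = a ∧ word mu k = b then 1 else 0 := by
    refine Finset.sum_congr rfl fun k hk => ?_
    rw [Function.update_of_ne (Finset.ne_of_mem_erase hk)]
  omega

theorem shift_add {A : Matrix (Fin N) (Fin N) ℕ} {t s k : Fin N} (hts : t ≠ s) (h : 1 ≤ A s k) :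
    shift A t s k + Matrix.single s k 1 = A + Matrix.single t k 1 := by
  ext a b
  simp only [shift, Matrix.add_apply, Matrix.sub_apply, Matrix.single_apply]
  by_cases hs : s = a ∧ k = b
  · obtain ⟨rfl, rfl⟩ := hs
    simp only [hts, false_and, if_false, and_self, if_true]
    omega
  · simp only [hs, if_false]
    omega

theorem countMat_word_apply {l : Comp N r} {a b : Fin N} (hab : a ≠ b) :
    countMat (word l) l a b = 0 := by
  rw [countMat, Finset.card_eq_zero, Finset.filter_eq_empty_iff]
  rintro k - ⟨rfl, h⟩
  exact hab h

/-- A matrix with the column sums of `countMat i mu` that agrees with it off the diagonal is equal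
to it. -/
theorem eq_of_co_eq {A B : Matrix (Fin N) (Fin N) ℕ} (h : co A = co B)
    (hd : ∀ a b, a ≠ b → A a b = B a b) : A = B := by
  ext a b
  by_cases hab : a = b
  · subst hab
    have h1 := congrFun h a
    rw [co, co, ← Finset.add_sum_erase _ _ (Finset.mem_univ a),
      ← Finset.add_sum_erase _ (fun i => B i a) (Finset.mem_univ a),
      Finset.sum_congr rfl fun x hx => hd x a (Finset.ne_of_mem_erase hx)] at h1
    omega
  · exact hd a b hab

/-- The sequences with matrix `D`, where `D - E_{t,s}` is diagonal, are those which differ from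
`i_λ` in one entry, which is `t` instead of `s`. -/
theorem countMat_eq_iff {l : Comp N r} {t s : Fin N} (hts : t ≠ s) {x : Fin N → ℕ}
    {D : Matrix (Fin N) (Fin N) ℕ} (hD : D = Matrix.diagonal x + Matrix.single t s 1)
    (hco : co D = l.1) (i : Fin r → Fin N) :
    countMat i l = D ↔ ∃ p, word l p = s ∧ i = Function.update (word l) p t := by
  have hDts : D t s = 1 := by simp [hD, hts]
  have hD0 : ∀ a b, a ≠ b → ¬ (a = t ∧ b = s) → D a b = 0 := by
    intro a b hab hne
    rw [hD, Matrix.add_apply, Matrix.diagonal_apply_ne _ hab, zero_add, Matrix.single_apply, if_neg]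
    rintro ⟨rfl, rfl⟩
    exact hne ⟨rfl, rfl⟩
  constructor
  · intro h
    rw [← h] at hDts
    obtain ⟨p, hp⟩ := Finset.card_eq_one.1 hDts
    have hmem : ∀ k, i k = t ∧ word l k = s ↔ k = p := fun k => by
      have := congrArg (k ∈ ·) hp
      simpa using this
    have hpp := (hmem p).2 rfl
    refine ⟨p, hpp.2, funext fun k => ?_⟩
    by_cases hk : k = p
    · rw [hk, Function.update_self, hpp.1]
    · rw [Function.update_of_ne hk]
      by_contra hne
      have h0 := hD0 _ _ hne fun h' => hk ((hmem k).1 h')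
      rw [← h, countMat, Finset.card_eq_zero, Finset.filter_eq_empty_iff] at h0
      exact h0 (Finset.mem_univ k) ⟨rfl, rfl⟩
  · rintro ⟨p, hp, rfl⟩
    refine eq_of_co_eq (by rw [co_countMat, hco]) fun a b hab => ?_
    have h1 := congrFun (congrFun (countMat_update (word l) l p t) a) b
    rw [Matrix.add_apply, Matrix.add_apply, countMat_word_apply hab, hp, Matrix.single_apply,
      Matrix.single_apply, if_neg (by rintro ⟨rfl, rfl⟩; exact hab rfl)] at h1
    rw [add_zero, zero_add] at h1
    rw [h1, hD, Matrix.add_apply, Matrix.diagonal_apply_ne _ hab, zero_add, Matrix.single_apply]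

/-- `before t s p a` means that the position `a` lies before `p`, or behind `p`, if the index `t`
is smaller, or greater, than the index `s`. -/
def before (t s : Fin N) (p a : Fin r) : Prop := if t < s then a < p else p < a

instance (t s : Fin N) (p a : Fin r) : Decidable (before t s p a) := by
  rw [before]; infer_instance

theorem before_of_lt {t s : Fin N} (h : t < s) (p a : Fin r) : before t s p a ↔ a < p := by
  rw [before, if_pos h]

theorem before_of_gt {t s : Fin N} (h : s < t) (p a : Fin r) : before t s p a ↔ p < a := by
  rw [before, if_neg h.not_gt]

theorem ne_of_before {t s : Fin N} {p a : Fin r} (h : before t s p a) : a ≠ p := by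
  rw [before] at h
  split_ifs at h
  · exact h.ne
  · exact h.ne'

theorem prod_pairs_right {M : Type*} [CommMonoid M] (p : Fin r) (P : Fin r → Prop)
    [DecidablePred P] (z : M) :
    ∏ x : Fin r × Fin r, (if x.2 = p ∧ P x.1 then z else 1) =
      z ^ (Finset.univ.filter P).card := by
  rw [Fintype.prod_prod_type, ← Finset.prod_const, Finset.prod_filter]
  refine Finset.prod_congr rfl fun a _ => ?_
  simp only [ite_and, Finset.prod_ite_eq', Finset.mem_univ, if_true]

theorem prod_pairs_left {M : Type*} [CommMonoid M] (p : Fin r) (P : Fin r → Prop)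
    [DecidablePred P] (z : M) :
    ∏ x : Fin r × Fin r, (if x.1 = p ∧ P x.2 then z else 1) =
      z ^ (Finset.univ.filter P).card := by
  rw [Fintype.prod_prod_type_right, ← Finset.prod_const, Finset.prod_filter]
  refine Finset.prod_congr rfl fun a _ => ?_
  simp only [ite_and, Finset.prod_ite_eq', Finset.mem_univ, if_true]

variable {R : Type*} [CommRing R] (q : Rˣ)

theorem blkWt_eq_prod (mu : Comp N r) (i : Fin r → Fin N) :
    blkWt q m mu i = ∏ x : Fin r × Fin r,
      if x.1 < x.2 ∧ i x.2 < i x.1 ∧ word mu x.1 = word mu x.2 then qd q m (word mu x.1)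
      else 1 := by
  rw [blkWt, ← Fintype.prod_ite_mem]
  refine Finset.prod_congr rfl fun x _ => ?_
  have h := mem_inv_std i x.1 x.2
  by_cases hx : x ∈ inv (std i)
  · simp [hx, h.1 hx]
  · rw [if_neg hx, if_neg fun h' => hx (h.2 ⟨h'.1, h'.2.1⟩)]

theorem blkWt_update_aux {t s : Fin N} (hts : (s : ℕ) = t + 1) (mu : Comp N r)
    {i : Fin r → Fin N} {p : Fin r} (hp : i p = s) :
    blkWt q m mu i * qd q m (word mu p) ^
        (Finset.univ.filter fun a => a < p ∧ word mu a = word mu p ∧ i a = s).card =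
      blkWt q m mu (Function.update i p t) * qd q m (word mu p) ^
        (Finset.univ.filter fun a => p < a ∧ word mu a = word mu p ∧ i a = t).card := by
  rw [blkWt_eq_prod, blkWt_eq_prod, ← prod_pairs_right p, ← prod_pairs_left p,
    ← Finset.prod_mul_distrib, ← Finset.prod_mul_distrib]
  refine Finset.prod_congr rfl fun x _ => ?_
  obtain ⟨a, b⟩ := x
  dsimp only
  have ht : t < s := by rw [Fin.lt_def]; omega
  have h1 : ∀ c, s < c ∨ c = s ↔ t < c := fun c => by
    simp only [Fin.lt_def, Fin.ext_iff]; omega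
  have h2 : ∀ c, c < t ∨ c = t ↔ c < s := fun c => by
    simp only [Fin.lt_def, Fin.ext_iff]; omega
  by_cases hb : b = p
  · subst hb
    by_cases ha : a = b
    · subst ha
      simp
    · rw [Function.update_self, Function.update_of_ne ha, hp]
      simp only [← h1, ha, true_and, false_and, if_false, mul_one]
      by_cases hlt : a < b <;> by_cases hw : word mu a = word mu b <;>
        by_cases hs : i a = s <;> simp [hlt, hw, hs]
  · by_cases ha : a = p
    · subst ha
      rw [Function.update_self, Function.update_of_ne hb, hp]
      simp only [← h2, hb, true_and, false_and, if_false, mul_one]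
      by_cases hlt : a < b <;> by_cases hw : word mu a = word mu b <;>
        by_cases hs : i b = t <;> simp [hlt, hw, hs, eq_comm]
    · rw [Function.update_of_ne ha, Function.update_of_ne hb]
      simp [ha, hb]

/-- How the weight of a sequence changes if one entry `s` is replaced by an adjacent index `t`. -/
theorem blkWt_update {t s : Fin N} (hts : (s : ℕ) = t + 1 ∨ (t : ℕ) = s + 1) (mu : Comp N r)
    {i : Fin r → Fin N} {p : Fin r} (hp : i p = s) :
    blkWt q m mu i * qd q m (word mu p) ^
        (Finset.univ.filter fun a => before t s p a ∧ word mu a = word mu p ∧ i a = s).card =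
      blkWt q m mu (Function.update i p t) * qd q m (word mu p) ^
        (Finset.univ.filter fun a => before s t p a ∧ word mu a = word mu p ∧ i a = t).card := by
  rcases hts with hts | hts
  · have ht : t < s := by rw [Fin.lt_def]; omega
    simp only [before_of_lt ht, before_of_gt ht]
    exact blkWt_update_aux q hts mu hp
  · have ht : s < t := by rw [Fin.lt_def]; omega
    simp only [before_of_lt ht, before_of_gt ht]
    have h := blkWt_update_aux q (m := m) hts mu (i := Function.update i p t) (p := p)
      (Function.update_self ..)
    rw [Function.update_idem, ← hp, Function.update_eq_self] at h
    have e : ∀ (P : Fin r → Prop), (∀ a, P a → a ≠ p) → ∀ c, ∀ a,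
        (P a ∧ word mu a = word mu p ∧ Function.update i p t a = c) ↔
          (P a ∧ word mu a = word mu p ∧ i a = c) := by
      intro P hP c a
      refine and_congr_right fun ha => ?_
      rw [Function.update_of_ne (hP a ha)]
    simp only [e (fun a => a < p) (fun a ha => ne_of_lt ha),
      e (fun a => p < a) (fun a ha => ne_of_gt ha)] at h
    rw [← hp, ← h]

end Update

/-! ### Endomorphisms that change one entry -/

section Step

variable {R : Type*} [CommRing R] (q : Rˣ) {m N r : ℕ}

/-- For the matrix `A` of `d`, the preimage of `[xy]_λ T_d T_{D_ν ∩ W_μ}` under `psi`, written in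
the unsigned basis, see `act_TD_ub`; it is zero unless `co A = μ`. -/
def stdVec (m : ℕ) (mu : Comp N r) (A : Matrix (Fin N) (Fin N) ℕ) : VT R N r :=
  ∑ i with countMat i mu = A, (blkWt q m mu i : R) • ub R m N r i

theorem blkWt_word (mu : Comp N r) : blkWt q m mu (word mu) = 1 := by
  rw [blkWt, std_word, inv_one, Finset.prod_empty]

/-- The coefficient of `ub i`, with the entry `i p = s` replaced by the adjacent index `t`, in the
image of `ub i` under the standard endomorphism of the matrix `D` for which `D - E_{t,s}` is
diagonal. -/
def stepWt (q : Rˣ) (m : ℕ) (t s : Fin N) (i : Fin r → Fin N) (p : Fin r) : Rˣ :=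
  qd q m s ^ (Finset.univ.filter fun a => before t s p a ∧ i a = s).card *
    qdd q m t ^ (Finset.univ.filter fun a => before s t p a ∧ i a = t).card

/-- The coefficients of `stdVec` for a matrix `D` such that `D - E_{t,s}` is diagonal. -/
theorem blkWt_update_word {t s : Fin N} (hts : (s : ℕ) = t + 1 ∨ (t : ℕ) = s + 1)
    (l : Comp N r) {p : Fin r} (hp : word l p = s) :
    blkWt q m l (Function.update (word l) p t) =
      qd q m s ^ (Finset.univ.filter fun a => before t s p a ∧ word l a = s).card := by
  have h := blkWt_update q (m := m) hts l hp
  have hne : t ≠ s := by rw [Ne, Fin.ext_iff]; omega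
  rw [blkWt_word, one_mul, hp] at h
  have h0 : (Finset.univ.filter fun a => before s t p a ∧ word l a = s ∧ word l a = t) = ∅ := by
    rw [Finset.filter_eq_empty_iff]
    rintro a - ⟨-, h1, h2⟩
    exact hne (h2.symm.trans h1)
  rw [h0, Finset.card_empty, pow_zero, mul_one] at h
  rw [← h]
  congr 2
  ext a
  simp

/-- The factor that arises when the standardisation of `i` acts on a word with one entry replaced:
only the new entry `t` is moved past equal indices. -/
theorem eqWt_update_word {t s : Fin N} (hts : (s : ℕ) = t + 1 ∨ (t : ℕ) = s + 1)
    {i : Fin r → Fin N} {p : Fin r} (hp : i p = s) :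
    eqWt q m (Function.update (word (content i)) (std i p) t) (std i) =
      qdd q m t ^ (Finset.univ.filter fun a => before s t p a ∧ i a = t).card := by
  have hne : t ≠ s := by rw [Ne, Fin.ext_iff]; omega
  have hu : ∀ a, Function.update (word (content i)) (std i p) t (std i a) =
      Function.update i p t a := by
    intro a
    by_cases ha : a = p
    · rw [ha, Function.update_self, Function.update_self]
    · rw [Function.update_of_ne ha, Function.update_of_ne fun h => ha ((std i).injective h),
        word_content_std]
  rw [eqWt]
  simp only [hu]
  rw [← Fintype.prod_ite_mem]
  have hinv : ∀ a b, (a, b) ∈ inv (std i) ↔ a < b ∧ i b < i a := mem_inv_std i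
  rcases lt_or_gt_of_ne hne with ht | ht
  · simp only [before_of_gt ht]
    rw [← prod_pairs_left p]
    refine Finset.prod_congr rfl fun x _ => ?_
    obtain ⟨a, b⟩ := x
    simp only [hinv]
    by_cases ha : a = p
    · subst ha
      by_cases hb : b = a
      · subst hb; simp
      · rw [Function.update_self, Function.update_of_ne hb, hp]
        simp only [eq_comm (a := t) (b := i b)]
        by_cases hab : a < b <;> by_cases hbt : i b = t <;> simp [hab, hbt, ht]
    · by_cases hb : b = p
      · subst hb
        rw [Function.update_self, Function.update_of_ne ha, hp]
        simp only [ha, false_and, if_false]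
        split_ifs with h1 h2
        · exact absurd (h2 ▸ h1.2) ht.not_gt
        · rfl
        · rfl
      · rw [Function.update_of_ne ha, Function.update_of_ne hb]
        simp only [ha, false_and, if_false]
        split_ifs with h1 h2
        · exact absurd h2 h1.2.ne'
        · rfl
        · rfl
  · simp only [before_of_lt ht]
    rw [← prod_pairs_right p]
    refine Finset.prod_congr rfl fun x _ => ?_
    obtain ⟨a, b⟩ := x
    simp only [hinv]
    by_cases hb : b = p
    · subst hb
      by_cases ha : a = b
      · subst ha; simp
      · rw [Function.update_self, Function.update_of_ne ha, hp]
        by_cases hab : a < b <;> by_cases hbt : i a = t <;> simp [hab, hbt, ht]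
    · by_cases ha : a = p
      · subst ha
        rw [Function.update_self, Function.update_of_ne hb, hp]
        simp only [hb, false_and, if_false]
        split_ifs with h1 h2
        · exact absurd (h2 ▸ h1.2) ht.not_gt
        · rfl
        · rfl
      · rw [Function.update_of_ne ha, Function.update_of_ne hb]
        simp only [hb, false_and, if_false]
        split_ifs with h1 h2
        · exact absurd h2 h1.2.ne'
        · rfl
        · rfl

theorem before_std_iff {t s : Fin N} {i : Fin r → Fin N} {p a : Fin r} (h : i a = i p) :
    before t s (std i p) (std i a) ↔ before t s p a := by
  rw [before, before]
  split_ifs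
  · simp [std_lt_std_iff, h]
  · simp [std_lt_std_iff, h]

/-- The standard endomorphism of a matrix `D` for which `D - E_{t,s}` is diagonal, `t` and `s`
adjacent, acts like a root vector of a quantum group: it replaces one entry `s` by `t`, in all
possible ways. -/
theorem stepEnd_ub {t s : Fin N} (hts : (s : ℕ) = t + 1 ∨ (t : ℕ) = s + 1) {x : Fin N → ℕ}
    {D : Matrix (Fin N) (Fin N) ℕ} (hD : D = Matrix.diagonal x + Matrix.single t s 1)
    {i : Fin r → Fin N} (hco : co D = (content i).1) (f : EndV q m N r)
    (hf : f.1 (ub R m N r (word (content i))) = stdVec q m (content i) D) :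
    f.1 (ub R m N r i) =
      ∑ p with i p = s, (stepWt q m t s i p : R) • ub R m N r (Function.update i p t) := by
  have hne : t ≠ s := by rw [Ne, Fin.ext_iff]; omega
  have hu : ∀ p, Function.update (word (content i)) (std i p) t ∘ std i =
      Function.update i p t := by
    intro p
    ext1 a
    rw [Function.comp_apply]
    by_cases ha : a = p
    · rw [ha, Function.update_self, Function.update_self]
    · rw [Function.update_of_ne ha, Function.update_of_ne fun h => ha ((std i).injective h),
        word_content_std]
  rw [← act_std_word q m i, EndV_act, hf, stdVec, map_sum]
  symm
  refine Finset.sum_bij (fun p _ => Function.update (word (content i)) (std i p) t) ?_ ?_ ?_ ?_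
  · intro p hp
    rw [Finset.mem_filter] at hp ⊢
    exact ⟨Finset.mem_univ _, (countMat_eq_iff hne hD hco _).2
      ⟨std i p, by rw [word_content_std, hp.2], rfl⟩⟩
  · intro p hp p' hp' he
    rw [Finset.mem_filter] at hp hp'
    by_contra hpp
    have := congrFun he (std i p)
    rw [Function.update_self, Function.update_of_ne fun h => hpp ((std i).injective h),
      word_content_std, hp.2] at this
    exact hne this
  · intro j hj
    rw [Finset.mem_filter] at hj
    obtain ⟨p, hp, rfl⟩ := (countMat_eq_iff hne hD hco _).1 hj.2
    refine ⟨(std i)⁻¹ p, ?_, by simp⟩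
    rw [Finset.mem_filter]
    refine ⟨Finset.mem_univ _, ?_⟩
    rw [← word_content_std i, ← hp]
    simp
  · intro p hp
    rw [Finset.mem_filter] at hp
    have hle : ∀ a b, a < b → std i b < std i a →
        Function.update (word (content i)) (std i p) t (std i b) ≤
          Function.update (word (content i)) (std i p) t (std i a) := by
      intro a b hab h
      have h1 := ((mem_inv_std i a b).1 ((mem_inv _ _ _).2 ⟨hab, h⟩)).2
      have h2 := fun a => congrFun (hu p) a
      simp only [Function.comp_apply] at h2
      rw [h2, h2]
      by_cases ha : a = p
      · subst ha
        rw [Function.update_self, Function.update_of_ne hab.ne']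
        rw [hp.2] at h1
        rw [Fin.le_def]; rw [Fin.lt_def] at h1
        omega
      · by_cases hb : b = p
        · subst hb
          rw [Function.update_self, Function.update_of_ne ha]
          rw [hp.2] at h1
          rw [Fin.le_def]; rw [Fin.lt_def] at h1
          omega
        · rw [Function.update_of_ne ha, Function.update_of_ne hb]
          exact h1.le
    rw [map_smul, act_T_ub q m _ _ hle, hu, smul_smul, ← Units.val_mul,
      blkWt_update_word q hts _ (by rw [word_content_std, hp.2]), eqWt_update_word q hts hp.2,
      stepWt]
    congr 4
    refine Finset.card_bij' (fun a _ => std i a) (fun a _ => (std i)⁻¹ a) ?_ ?_ ?_ ?_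
    · intro a ha
      rw [Finset.mem_filter] at ha ⊢
      rw [word_content_std, before_std_iff (ha.2.2.trans hp.2.symm)]
      exact ⟨Finset.mem_univ _, ha.2⟩
    · intro a ha
      obtain ⟨b, rfl⟩ := (std i).surjective a
      rw [Finset.mem_filter, word_content_std] at ha
      rw [before_std_iff (ha.2.2.trans hp.2.symm)] at ha
      rw [Finset.mem_filter]
      simpa using ha
    · intro a _; simp
    · intro a _; simp

theorem sum_pow_card_gt (S : Finset (Fin r)) (z : R) :
    ∑ p ∈ S, z ^ (S.filter fun a => p < a).card = gint S.card z := by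
  induction S using Finset.induction_on_min with
  | empty => simp [gint]
  | insert a s h ih =>
    have ha : a ∉ s := fun h' => lt_irrefl _ (h a h')
    rw [Finset.sum_insert ha, Finset.card_insert_of_notMem ha, gint, Finset.sum_range_succ,
      ← gint, ← ih, add_comm]
    congr 1
    · refine Finset.sum_congr rfl fun p hp => ?_
      rw [Finset.filter_insert, if_neg (h p hp).not_gt]
    · rw [Finset.filter_insert, if_neg (lt_irrefl a), Finset.filter_true_of_mem h]

theorem sum_pow_card_lt (S : Finset (Fin r)) (z : R) :
    ∑ p ∈ S, z ^ (S.filter fun a => a < p).card = gint S.card z := by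
  induction S using Finset.induction_on_max with
  | empty => simp [gint]
  | insert a s h ih =>
    have ha : a ∉ s := fun h' => lt_irrefl _ (h a h')
    rw [Finset.sum_insert ha, Finset.card_insert_of_notMem ha, gint, Finset.sum_range_succ,
      ← gint, ← ih, add_comm]
    congr 1
    · refine Finset.sum_congr rfl fun p hp => ?_
      rw [Finset.filter_insert, if_neg (h p hp).not_gt]
    · rw [Finset.filter_insert, if_neg (lt_irrefl a), Finset.filter_true_of_mem h]

theorem sum_pow_card_before (t s : Fin N) (S : Finset (Fin r)) (z : R) :
    ∑ p ∈ S, z ^ (S.filter fun a => before t s p a).card = gint S.card z := by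
  by_cases h : t < s
  · simp only [before, if_pos h, sum_pow_card_lt]
  · simp only [before, if_neg h, sum_pow_card_gt]

end Step

/-! ### Products with an endomorphism that changes one entry -/

section StepMul

variable {R : Type*} [CommRing R] (q : Rˣ) {m N r : ℕ}

/-- The positions before `p` are those in the blocks of `μ` before that of `p`, which are counted by
the matrix, and those in the block of `p`. -/
theorem card_lt_eq (i : Fin r → Fin N) (mu : Comp N r) (p : Fin r) (s : Fin N) :
    (Finset.univ.filter fun a => a < p ∧ i a = s).card =
      sumLt (countMat i mu) s (word mu p) +
        (Finset.univ.filter fun a => a < p ∧ word mu a = word mu p ∧ i a = s).card := by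
  have h1 : sumLt (countMat i mu) s (word mu p) =
      (Finset.univ.filter fun a => word mu a < word mu p ∧ i a = s).card := by
    rw [sumLt, Finset.card_eq_sum_card_fiberwise (f := word mu) (t := Finset.Iio (word mu p))]
    · refine Finset.sum_congr rfl fun j hj => ?_
      rw [countMat, Finset.filter_filter]
      congr 1
      ext a
      simp only [Finset.mem_filter, Finset.mem_univ, true_and]
      rw [Finset.mem_Iio] at hj
      constructor
      · rintro ⟨h1, rfl⟩; exact ⟨⟨hj, h1⟩, rfl⟩
      · rintro ⟨⟨-, h1⟩, rfl⟩; exact ⟨h1, rfl⟩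
    · intro a ha
      simp only [Finset.coe_filter, Finset.mem_univ, true_and, Set.mem_ofPred_eq] at ha
      simpa using ha.1
  rw [h1, ← Finset.card_union_of_disjoint]
  · congr 1
    ext a
    simp only [Finset.mem_union, Finset.mem_filter, Finset.mem_univ, true_and]
    constructor
    · rintro ⟨h1, h2⟩
      rcases (word_monotone mu h1.le).lt_or_eq with h3 | h3
      · exact Or.inl ⟨h3, h2⟩
      · exact Or.inr ⟨h1, h3, h2⟩
    · rintro (⟨h1, h2⟩ | ⟨h1, -, h2⟩)
      · exact ⟨(word_monotone mu).reflect_lt h1, h2⟩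
      · exact ⟨h1, h2⟩
  · refine Finset.disjoint_left.2 fun a h2 h3 => ?_
    rw [Finset.mem_filter] at h2 h3
    exact h2.2.1.ne h3.2.2.1

theorem card_gt_eq (i : Fin r → Fin N) (mu : Comp N r) (p : Fin r) (s : Fin N) :
    (Finset.univ.filter fun a => p < a ∧ i a = s).card =
      sumGt (countMat i mu) s (word mu p) +
        (Finset.univ.filter fun a => p < a ∧ word mu a = word mu p ∧ i a = s).card := by
  have h1 : sumGt (countMat i mu) s (word mu p) =
      (Finset.univ.filter fun a => word mu p < word mu a ∧ i a = s).card := by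
    rw [sumGt, Finset.card_eq_sum_card_fiberwise (f := word mu) (t := Finset.Ioi (word mu p))]
    · refine Finset.sum_congr rfl fun j hj => ?_
      rw [countMat, Finset.filter_filter]
      congr 1
      ext a
      simp only [Finset.mem_filter, Finset.mem_univ, true_and]
      rw [Finset.mem_Ioi] at hj
      constructor
      · rintro ⟨h1, rfl⟩; exact ⟨⟨hj, h1⟩, rfl⟩
      · rintro ⟨⟨-, h1⟩, rfl⟩; exact ⟨h1, rfl⟩
    · intro a ha
      simp only [Finset.coe_filter, Finset.mem_univ, true_and, Set.mem_ofPred_eq] at ha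
      simpa using ha.1
  rw [h1, ← Finset.card_union_of_disjoint]
  · congr 1
    ext a
    simp only [Finset.mem_union, Finset.mem_filter, Finset.mem_univ, true_and]
    constructor
    · rintro ⟨h1, h2⟩
      rcases (word_monotone mu h1.le).lt_or_eq with h3 | h3
      · exact Or.inl ⟨h3, h2⟩
      · exact Or.inr ⟨h1, h3.symm, h2⟩
    · rintro (⟨h1, h2⟩ | ⟨h1, -, h2⟩)
      · exact ⟨(word_monotone mu).reflect_lt h1, h2⟩
      · exact ⟨h1, h2⟩
  · refine Finset.disjoint_left.2 fun a h2 h3 => ?_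
    rw [Finset.mem_filter] at h2 h3
    exact h2.2.1.ne' h3.2.2.1

/-- The coefficients `f⁺_{h,k}` (for `t = h`, `s = h + 1`) and `f⁻_{h,k}` (for `t = h + 1`,
`s = h`). -/
def stepCoeff (q : Rˣ) (m : ℕ) (t s : Fin N) (A : Matrix (Fin N) (Fin N) ℕ) (k : Fin N) : Rˣ :=
  qd q m s ^ (if t < s then sumLt A s k else sumGt A s k) *
    qdd q m t ^ (if t < s then sumGt A t k else sumLt A t k)

/-- The part of the weight that comes from the positions outside the block of `p` depends only on
the matrix; it is the coefficient of the multiplication formula. -/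
theorem stepWt_eq {t s : Fin N} (hne : t ≠ s) (i : Fin r → Fin N) (mu : Comp N r) (p : Fin r) :
    stepWt q m t s i p = stepCoeff q m t s (countMat i mu) (word mu p) *
      (qd q m s ^ (Finset.univ.filter fun a =>
          before t s p a ∧ word mu a = word mu p ∧ i a = s).card *
        qdd q m t ^ (Finset.univ.filter fun a =>
          before s t p a ∧ word mu a = word mu p ∧ i a = t).card) := by
  rw [stepWt, stepCoeff, mul_mul_mul_comm, ← pow_add, ← pow_add]
  rcases lt_or_gt_of_ne hne with h | h
  · simp only [before_of_lt h, before_of_gt h, if_pos h]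
    rw [card_lt_eq i mu, card_gt_eq i mu]
  · simp only [before_of_lt h, before_of_gt h, if_neg h.not_gt]
    rw [card_lt_eq i mu, card_gt_eq i mu]

/-- The weights of the entries `s` in the block of `p` are absorbed by the change of `blkWt`; those
of the entries `t` remain. -/
theorem blkWt_mul_stepWt {t s : Fin N} (hts : (s : ℕ) = t + 1 ∨ (t : ℕ) = s + 1)
    {i : Fin r → Fin N} {mu : Comp N r} (hA : IsSuper m (countMat i mu)) {p : Fin r}
    (hp : i p = s) :
    blkWt q m mu i * stepWt q m t s i p =
      stepCoeff q m t s (countMat i mu) (word mu p) *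
        blkWt q m mu (Function.update i p t) * (qd q m (word mu p) * qdd q m t) ^
          (Finset.univ.filter fun a =>
            before s t p a ∧ word mu a = word mu p ∧ i a = t).card := by
  have hne : t ≠ s := by rw [Ne, Fin.ext_iff]; omega
  have h := blkWt_update q (m := m) hts mu hp
  have h1 : qd q m s ^ (Finset.univ.filter fun a =>
      before t s p a ∧ word mu a = word mu p ∧ i a = s).card =
      qd q m (word mu p) ^ (Finset.univ.filter fun a =>
        before t s p a ∧ word mu a = word mu p ∧ i a = s).card := by
    by_cases hh : hat m s = hat m (word mu p)
    · rw [qd_eq_of_hat_eq q m hh]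
    · -- a second entry `s` in the same block would contradict the bound on `A`
      have h0 : (Finset.univ.filter fun a =>
          before t s p a ∧ word mu a = word mu p ∧ i a = s) = ∅ := by
        rw [Finset.filter_eq_empty_iff]
        rintro a - ⟨h1, h2, h3⟩
        have := hat_eq_of_isSuper hA (ne_of_before h1) (h3.trans hp.symm) h2
        rw [h3, h2] at this
        exact hh this
      rw [h0, Finset.card_empty, pow_zero, pow_zero]
  rw [stepWt_eq q hne i mu p, h1, mul_left_comm, ← mul_assoc (blkWt q m mu i), h, mul_pow]
  simp only [mul_assoc]

/-- `A + E_{t,k} - E_{s,k}` fails to belong to the index set of the basis only if it has an entry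
`2` at a place of mixed parity. -/
theorem isSuper_shift_or {t s k : Fin N} (hts : t ≠ s) {A : Matrix (Fin N) (Fin N) ℕ}
    (hA : IsSuper m A) (hk : 1 ≤ A s k) :
    IsSuper m (shift A t s k) ∨ (hat m t ≠ hat m k ∧ A t k = 1) := by
  by_contra hn
  push Not at hn
  refine hn.1 fun a b hab => ?_
  have h := congrFun (congrFun (shift_add hts hk) a) b
  simp only [Matrix.add_apply, Matrix.single_apply] at h
  have h1 := hA a b hab
  by_cases htk : t = a ∧ k = b
  · obtain ⟨rfl, rfl⟩ := htk
    have := hn.2 hab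
    simp only [and_self, if_true] at h
    omega
  · simp only [htk, if_false] at h
    omega

theorem shift_apply {t s k : Fin N} (hts : t ≠ s) {A : Matrix (Fin N) (Fin N) ℕ}
    (hk : 1 ≤ A s k) : shift A t s k t k = A t k + 1 := by
  have h := congrFun (congrFun (shift_add hts hk) t) k
  simpa [Matrix.single_apply, hts.symm] using h

theorem qd_mul_qdd (t : Fin N) : qd q m t * qdd q m t = qh q m t := by
  rw [qd, qdd, qh]
  split_ifs <;> simp

theorem qd_mul_qdd_of_ne {t k : Fin N} (h : hat m t ≠ hat m k) :
    qd q m k * qdd q m t = -1 := by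
  rw [hat, hat] at h
  rw [qd, qdd]
  split_ifs at * <;> simp_all

/-- The coefficient of `ub i'` in a product of standard endomorphisms. Its terms correspond to the
positions `p` at which the entry `t` of `i'` may come from. They form a geometric progression with
ratio `qh t`, or with ratio `-1`, if the parities of `t` and `k` differ; in the latter case two
terms cancel. -/
theorem sum_blkWt_mul_stepWt {t s k : Fin N} (hts : (s : ℕ) = t + 1 ∨ (t : ℕ) = s + 1)
    {A : Matrix (Fin N) (Fin N) ℕ} (hA : IsSuper m A) (hk : 1 ≤ A s k) {mu : Comp N r}
    {i' : Fin r → Fin N} (hi' : countMat i' mu = shift A t s k)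
    [Decidable (IsSuper m (shift A t s k))] :
    ∑ p with i' p = t ∧ word mu p = k,
      ((blkWt q m mu (Function.update i' p s) * stepWt q m t s (Function.update i' p s) p : Rˣ)
        : R) =
      (stepCoeff q m t s A k : R) * gint (A t k + 1) (qh q m t : R) *
        if IsSuper m (shift A t s k) then (blkWt q m mu i' : R) else 0 := by
  have hne : t ≠ s := by rw [Ne, Fin.ext_iff]; omega
  set S := Finset.univ.filter fun p => i' p = t ∧ word mu p = k with hS
  have hcard : S.card = A t k + 1 := by
    rw [← shift_apply hne hk, ← hi']
    rfl
  have h1 : ∀ p ∈ S, ((blkWt q m mu (Function.update i' p s) *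
      stepWt q m t s (Function.update i' p s) p : Rˣ) : R) =
      (stepCoeff q m t s A k : R) * blkWt q m mu i' *
        ((qd q m k * qdd q m t : Rˣ) : R) ^ (S.filter fun a => before s t p a).card := by
    intro p hp
    rw [hS, Finset.mem_filter] at hp
    obtain ⟨-, hp, hpk⟩ := hp
    have hcA : countMat (Function.update i' p s) mu = A := by
      have h2 := countMat_update i' mu p s
      rw [hi', hp, hpk] at h2
      have h3 := shift_add hne hk
      exact add_right_cancel (h2.trans h3)
    have h2 := blkWt_mul_stepWt q (m := m) hts (i := Function.update i' p s) (mu := mu) (p := p)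
      (by rwa [hcA]) (Function.update_self ..)
    rw [h2, hcA, hpk, Function.update_idem, ← hp, Function.update_eq_self, Units.val_mul,
      Units.val_mul, Units.val_pow_eq_pow_val]
    congr 3
    ext a
    rw [hS, Finset.mem_filter, Finset.mem_filter, Finset.mem_filter]
    constructor
    · rintro ⟨-, h3, h4, h5⟩
      rw [Function.update_of_ne (ne_of_before h3)] at h5
      exact ⟨⟨Finset.mem_univ _, h5.trans hp, h4⟩, hp ▸ h3⟩
    · rintro ⟨⟨-, h3, h4⟩, h5⟩
      refine ⟨Finset.mem_univ _, hp ▸ h5, h4, ?_⟩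
      rw [Function.update_of_ne (ne_of_before h5), h3, hp]
  rw [Finset.sum_congr rfl h1, ← Finset.mul_sum, sum_pow_card_before, hcard]
  by_cases htk : hat m t = hat m k
  · rw [if_pos, ← qd_eq_of_hat_eq q m htk, qd_mul_qdd]
    · ring
    · exact (isSuper_shift_or hne hA hk).resolve_right fun h => h.1 htk
  · rw [qd_mul_qdd_of_ne q htk]
    split_ifs with hs
    · have := hs t k htk
      rw [shift_apply hne hk] at this
      have h0 : A t k = 0 := by omega
      simp [h0, gint]
    · have h0 := ((isSuper_shift_or hne hA hk).resolve_left hs).2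
      simp [h0, gint, Finset.sum_range_succ]

open Classical in
/-- The multiplication formula for the standard basis, on the side of `V^{⊗ r}`: the product is
evaluated at `v_{i_μ}` by `stepEnd_ub`, and its terms are collected by the sequence `i'` that they
lead to. -/
theorem stepEnd_mul {t s : Fin N} (hts : (s : ℕ) = t + 1 ∨ (t : ℕ) = s + 1)
    {A D : Matrix (Fin N) (Fin N) ℕ} (hA : IsSuper m A) (hD : IsD A t s D)
    {f g : EndV q m N r} {F : Matrix (Fin N) (Fin N) ℕ → EndV q m N r}
    (hf : ∀ l : Comp N r, f.1 (ub R m N r (word l)) = stdVec q m l D)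
    (hg : ∀ l : Comp N r, g.1 (ub R m N r (word l)) = stdVec q m l A)
    (hF : ∀ B, ∀ l : Comp N r, (F B).1 (ub R m N r (word l)) =
      if IsSuper m B then stdVec q m l B else 0) :
    f * g = ∑ k with 1 ≤ A s k,
      ((stepCoeff q m t s A k : R) * gint (A t k + 1) (qh q m t : R)) • F (shift A t s k) := by
  have hne : t ≠ s := by rw [Ne, Fin.ext_iff]; omega
  obtain ⟨⟨x, hx⟩, hco⟩ := hD
  refine EndV_ext q m fun mu => ?_
  change f.1 (g.1 _) = _
  rw [AddSubmonoidClass.coe_finsetSum, LinearMap.sum_apply]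
  have hR : ∀ k ∈ Finset.univ.filter (fun k => 1 ≤ A s k),
      (((stepCoeff q m t s A k : R) * gint (A t k + 1) (qh q m t : R)) •
        F (shift A t s k)).1 (ub R m N r (word mu)) =
      ∑ i' with countMat i' mu = shift A t s k, ∑ p with i' p = t ∧ word mu p = k,
        ((blkWt q m mu (Function.update i' p s) *
          stepWt q m t s (Function.update i' p s) p : Rˣ) : R) • ub R m N r i' := by
    intro k hk
    rw [Finset.mem_filter] at hk
    change (_ : R) • (F (shift A t s k)).1 (ub R m N r (word mu)) = _
    have h2 : ∀ i' ∈ Finset.univ.filter (fun i' => countMat i' mu = shift A t s k),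
        ∑ p with i' p = t ∧ word mu p = k, ((blkWt q m mu (Function.update i' p s) *
          stepWt q m t s (Function.update i' p s) p : Rˣ) : R) • ub R m N r i' =
        ((stepCoeff q m t s A k : R) * gint (A t k + 1) (qh q m t : R)) •
          ((if IsSuper m (shift A t s k) then (blkWt q m mu i' : R) else 0) •
            ub R m N r i') := by
      intro i' hi'
      rw [← Finset.sum_smul, sum_blkWt_mul_stepWt q hts hA hk.2 (Finset.mem_filter.1 hi').2,
        smul_smul]
    rw [hF, Finset.sum_congr rfl h2, ← Finset.smul_sum]
    congr 1
    split_ifs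
    · rfl
    · simp
  rw [Finset.sum_congr rfl hR, hg, stdVec, map_sum]
  have hL : ∀ i ∈ Finset.univ.filter (fun i => countMat i mu = A),
      f.1 ((blkWt q m mu i : R) • ub R m N r i) =
        ∑ p with i p = s, ((blkWt q m mu i * stepWt q m t s i p : Rˣ) : R) •
          ub R m N r (Function.update i p t) := by
    intro i hi
    rw [Finset.mem_filter] at hi
    rw [map_smul, stepEnd_ub q hts hx _ f (hf _), Finset.smul_sum]
    · refine Finset.sum_congr rfl fun p _ => ?_
      rw [smul_smul, Units.val_mul]
    · rw [hco, ← hi.2, ro_countMat]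
  rw [Finset.sum_congr rfl hL]
  rw [Finset.sum_sigma', Finset.sum_congr rfl fun k _ => Finset.sum_sigma' .., Finset.sum_sigma']
  refine Finset.sum_bij' (fun z _ => ⟨word mu z.2, Function.update z.1 z.2 t, z.2⟩)
    (fun z _ => ⟨Function.update z.2.1 z.2.2 s, z.2.2⟩) ?_ ?_ ?_ ?_ ?_
  · rintro ⟨i, p⟩ h
    simp only [Finset.mem_sigma, Finset.mem_filter, Finset.mem_univ, true_and] at h ⊢
    obtain ⟨h1, h2⟩ := h
    have h3 : 1 ≤ A s (word mu p) := by
      rw [← h1]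
      exact Finset.card_pos.2 ⟨p, by simp [h2]⟩
    refine ⟨h3, ?_, Function.update_self .., trivial⟩
    have h4 := countMat_update i mu p t
    rw [h1, h2] at h4
    exact add_right_cancel (h4.trans (shift_add hne h3).symm)
  · rintro ⟨k, i', p⟩ h
    simp only [Finset.mem_sigma, Finset.mem_filter, Finset.mem_univ, true_and] at h ⊢
    obtain ⟨h1, h2, h3, rfl⟩ := h
    refine ⟨?_, Function.update_self ..⟩
    have h4 := countMat_update i' mu p s
    rw [h2, h3] at h4
    exact add_right_cancel (h4.trans (shift_add hne h1))
  · rintro ⟨i, p⟩ h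
    simp only [Finset.mem_sigma, Finset.mem_filter, Finset.mem_univ, true_and] at h
    simp only [Function.update_idem, ← h.2, Function.update_eq_self]
  · rintro ⟨k, i', p⟩ h
    simp only [Finset.mem_sigma, Finset.mem_filter, Finset.mem_univ, true_and] at h
    obtain ⟨h1, h2, h3, rfl⟩ := h
    simp only [Function.update_idem, ← h3, Function.update_eq_self]
  · rintro ⟨i, p⟩ h
    simp only [Finset.mem_sigma, Finset.mem_filter, Finset.mem_univ, true_and] at h
    simp only [Function.update_idem, ← h.2, Function.update_eq_self]

end StepMul

/-! ### The two bases of the endomorphism algebra -/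

section Bases

variable {R : Type*} [CommRing R] (q : Rˣ) (m : ℕ) {N r : ℕ}

open Classical in
/-- The relative norm `ζ_A` as an element of `End_H(V^{⊗ r})`, extended by `0` to the matrices that
do not come from a double coset. -/
def zeta (A : Matrix (Fin N) (Fin N) ℕ) : EndV q m N r :=
  if h : ∃ (l mu : Comp N r) (d : Perm (Fin r)), d ∈ Dcirc m l mu ∧ jmat l d mu = A then
    ⟨_, relNorm_mem q h.choose_spec.choose_spec.choose_spec.1⟩
  else 0

theorem zeta_jmat {l mu : Comp N r} {d : Perm (Fin r)} (hd : d ∈ Dcirc m l mu) :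
    (zeta q m (jmat l d mu)).1 = relNorm q m l d mu := by
  have h : ∃ (l' mu' : Comp N r) (d' : Perm (Fin r)),
      d' ∈ Dcirc m l' mu' ∧ jmat l' d' mu' = jmat l d mu := ⟨l, mu, d, hd, rfl⟩
  obtain ⟨h1, h2, h3⟩ := Dcirc_unique h.choose_spec.choose_spec.choose_spec.1 hd
    h.choose_spec.choose_spec.choose_spec.2
  have h4 : ∀ {l' mu' : Comp N r} {d' : Perm (Fin r)}, l' = l → mu' = mu → d' = d →
      (relNorm q m l' d' mu' : Module.End R (VT R N r)) = relNorm q m l d mu := by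
    rintro _ _ _ rfl rfl rfl; rfl
  rw [zeta, dif_pos h]
  exact h4 h1 h2 h3

theorem zeta_of_not {A : Matrix (Fin N) (Fin N) ℕ}
    (h : ¬ ∃ (l mu : Comp N r) (d : Perm (Fin r)), d ∈ Dcirc m l mu ∧ jmat l d mu = A) :
    (zeta q m A : EndV q m N r) = 0 := by
  rw [zeta, dif_neg h]

/-- The endomorphism of `V^{⊗ r}` that corresponds to the standard basis element `φ_A`. -/
def stdEnd (A : Matrix (Fin N) (Fin N) ℕ) : EndV q m N r := ((-1 : R) ^ hatM m A) • zeta q m A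

theorem neg_one_pow_mul_self (a : ℕ) : ((-1 : R) ^ a) * (-1) ^ a = 1 := by
  rw [← mul_pow]; simp

theorem zeta_eq_smul (A : Matrix (Fin N) (Fin N) ℕ) :
    (zeta q m A : EndV q m N r) = ((-1 : R) ^ hatM m A) • stdEnd q m A := by
  rw [stdEnd, smul_smul, neg_one_pow_mul_self, one_smul]

theorem stdEnd_jmat_word {l mu : Comp N r} {d : Perm (Fin r)} (hd : d ∈ Dcirc m l mu)
    (a : Comp N r) :
    (stdEnd q m (jmat l d mu)).1 (ub R m N r (word a)) =
      if a = mu then act q m (TD q m mu (minReps (nuPar l d mu) ∩ par mu))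
        (ub R m N r (word l ∘ d)) else 0 := by
  change ((-1 : R) ^ hatM m (jmat l d mu)) • (zeta q m (jmat l d mu)).1 (ub R m N r (word a)) = _
  rw [zeta_jmat q m hd, relNorm_word q hd]
  split_ifs
  · rw [smul_smul, sgn_eq hd, Units.val_pow_eq_pow_val, Units.val_neg, Units.val_one,
      neg_one_pow_mul_self, one_smul]
  · rw [smul_zero]

open Classical in
/-- All that the multiplication formulas use about the standard basis: its values at the
`v_{i_α}`. -/
theorem stdEnd_word (A : Matrix (Fin N) (Fin N) ℕ) (a : Comp N r) :
    (stdEnd q m A).1 (ub R m N r (word a)) =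
      if IsSuper m A then stdVec q m a A else 0 := by
  by_cases h : ∃ (l mu : Comp N r) (d : Perm (Fin r)), d ∈ Dcirc m l mu ∧ jmat l d mu = A
  · obtain ⟨l, mu, d, hd, rfl⟩ := h
    rw [stdEnd_jmat_word q m hd, if_pos ((mem_Dcirc_iff l mu d).1 hd).2.2]
    split_ifs with ha
    · rw [act_TD_ub q hd, ha, stdVec]
    · rw [stdVec, Finset.filter_false_of_mem, Finset.sum_empty]
      intro i _ hi
      refine ha (Subtype.ext ?_)
      rw [← co_countMat i a, hi, jmat_eq, co_countMat]
  · rw [stdEnd, zeta_of_not q m h, smul_zero]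
    split_ifs with hA
    · rw [stdVec, Finset.filter_false_of_mem, Finset.sum_empty]
      · rfl
      · rintro i - rfl
        obtain ⟨l, d, hd, h'⟩ := exists_Dcirc hA
        exact h ⟨l, a, d, hd, h'⟩
    · rfl

/-- The image of `stdEnd A` in the superalgebra is the standard basis element `φ_A`. -/
theorem isPhi_Theta {l mu : Comp N r} {d : Perm (Fin r)} (hd : d ∈ Dcirc m l mu) :
    IsPhi q m l d mu (Theta q m N r (stdEnd q m (jmat l d mu))) := by
  intro a h
  rw [← psi_act_word, Theta_psi, EndV_act, psi_act, stdEnd_jmat_word q m hd]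
  split_ifs
  · have h1 := act_std_word q m (word l ∘ d)
    rw [content_comp, content_word, ← Dcirc_eq_std hd] at h1
    rw [← h1, ← Module.End.mul_apply, ← act_mul, psi_act_word, op_smul_inT]
  · rw [map_zero, smul_zero]

end Bases

/-! ### Signs -/

section Signs

variable {m N : ℕ}

theorem hatM_eq_zero {t s : Fin N} (hts : (s : ℕ) = t + 1 ∨ (t : ℕ) = s + 1) {x : Fin N → ℕ}
    {D : Matrix (Fin N) (Fin N) ℕ} (hD : D = Matrix.diagonal x + Matrix.single t s 1) :
    hatM m D = 0 := by
  have h0 : ∀ a b, D a b ≠ 0 → a = b ∨ (a = t ∧ b = s) := by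
    intro a b h
    by_contra hn
    push Not at hn
    apply h
    rw [hD, Matrix.add_apply, Matrix.diagonal_apply_ne _ hn.1, zero_add, Matrix.single_apply,
      if_neg]
    rintro ⟨rfl, rfl⟩
    exact hn.2 rfl rfl
  rw [hatM]
  refine Finset.sum_eq_zero fun k _ => Finset.sum_eq_zero fun i hi =>
    Finset.sum_eq_zero fun j _ => Finset.sum_eq_zero fun l hl => ?_
  rw [Finset.mem_Ioi] at hi hl
  by_contra hn
  have h1 := h0 i j (left_ne_zero_of_mul hn)
  have h2 := h0 k l (right_ne_zero_of_mul hn)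
  simp only [Fin.lt_def, Fin.ext_iff] at *
  omega

theorem sum_mul_add_left (u v : Fin N → ℕ) (k : Fin N) (c : ℕ) :
    ∑ j, ∑ l ∈ Finset.Ioi j, (u j + if j = k then c else 0) * v l =
      ∑ j, ∑ l ∈ Finset.Ioi j, u j * v l + c * ∑ l ∈ Finset.Ioi k, v l := by
  simp only [← Finset.mul_sum]
  simp only [add_mul, Finset.sum_add_distrib, ite_mul, zero_mul, Finset.sum_ite_eq',
    Finset.mem_univ, if_true]

theorem sum_mul_add_right (u v : Fin N → ℕ) (k : Fin N) (c : ℕ) :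
    ∑ j, ∑ l ∈ Finset.Ioi j, u j * (v l + if l = k then c else 0) =
      ∑ j, ∑ l ∈ Finset.Ioi j, u j * v l + c * ∑ j ∈ Finset.Iio k, u j := by
  simp only [mul_add, Finset.sum_add_distrib, mul_ite, mul_zero, Finset.sum_ite_eq',
    Finset.mem_Ioi]
  rw [← Finset.sum_filter, Finset.mul_sum]
  congr 1
  refine Finset.sum_congr ?_ fun j _ => mul_comm _ _
  ext j
  simp

/-- How the hat of a matrix grows with its entry at `(a, k)`: by the entries to the right of `k` in
the odd rows above, and, if `a` is odd, by the entries to the left of `k` in the rows below. -/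
theorem hatM_add_single (C : Matrix (Fin N) (Fin N) ℕ) (a k : Fin N) :
    hatM m (C + Matrix.single a k 1) = hatM m C +
      (∑ b ∈ Finset.univ.filter (fun b : Fin N => m ≤ (b : ℕ)),
          (if b < a then sumGt C b k else 0) +
        if m ≤ (a : ℕ) then ∑ i ∈ Finset.Ioi a, sumLt C i k else 0) := by
  have hE : ∀ i j, (C + Matrix.single a k 1 : Matrix (Fin N) (Fin N) ℕ) i j =
      C i j + if j = k then (if i = a then 1 else 0) else 0 := by
    intro i j
    rw [Matrix.add_apply, Matrix.single_apply, ← ite_and]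
    congr 1
    simp only [eq_comm, and_comm]
  have key : ∀ b : Fin N, ∑ i ∈ Finset.Ioi b, ∑ j, ∑ l ∈ Finset.Ioi j,
      (C + Matrix.single a k 1 : Matrix (Fin N) (Fin N) ℕ) i j *
        (C + Matrix.single a k 1 : Matrix (Fin N) (Fin N) ℕ) b l =
      ∑ i ∈ Finset.Ioi b, ∑ j, ∑ l ∈ Finset.Ioi j, C i j * C b l +
        ((if b < a then sumGt C b k else 0) +
          if b = a then ∑ i ∈ Finset.Ioi a, sumLt C i k else 0) := by
    intro b
    simp only [hE]
    by_cases hb : b = a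
    · subst hb
      rw [if_neg (lt_irrefl b), if_pos rfl, if_pos rfl, zero_add, ← Finset.sum_add_distrib]
      refine Finset.sum_congr rfl fun i hi => ?_
      rw [if_neg (Finset.mem_Ioi.1 hi).ne']
      simp only [ite_self, add_zero]
      rw [sum_mul_add_right, one_mul, sumLt]
    · simp only [if_neg hb, ite_self, add_zero, sum_mul_add_left, Finset.sum_add_distrib]
      congr 1
      simp only [ite_mul, one_mul, zero_mul, Finset.sum_ite_eq', Finset.mem_Ioi]
      rfl
  rw [hatM, Finset.sum_congr rfl fun b _ => key b, Finset.sum_add_distrib, Finset.sum_add_distrib,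
    hatM, Finset.sum_ite_eq']
  simp

theorem sumLt_add_single (C : Matrix (Fin N) (Fin N) ℕ) (a k i : Fin N) :
    sumLt (C + Matrix.single a k 1) i k = sumLt C i k := by
  refine Finset.sum_congr rfl fun j hj => ?_
  rw [Matrix.add_apply, Matrix.single_apply, if_neg, add_zero]
  exact fun h => (Finset.mem_Iio.1 hj).ne' h.2

theorem sumGt_add_single (C : Matrix (Fin N) (Fin N) ℕ) (a k i : Fin N) :
    sumGt (C + Matrix.single a k 1) i k = sumGt C i k := by
  refine Finset.sum_congr rfl fun j hj => ?_
  rw [Matrix.add_apply, Matrix.single_apply, if_neg, add_zero]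
  exact fun h => (Finset.mem_Ioi.1 hj).ne h.2

theorem sumOdd_add_single (C : Matrix (Fin N) (Fin N) ℕ) (a k : Fin N) :
    sumOdd m (C + Matrix.single a k 1) k = sumOdd m C k := by
  rw [sumOdd, sumOdd]
  simp only [sumLt_add_single]

variable {R : Type*} [CommRing R]

/-- The sign by which the hats of two matrices differ that are obtained from each other by moving
a unit between adjacent rows. -/
theorem neg_one_pow_hatM {h h' : Fin N} (hh : (h' : ℕ) = h + 1)
    (C : Matrix (Fin N) (Fin N) ℕ) (k : Fin N) :
    (-1 : R) ^ (hatM m (C + Matrix.single h k 1) + hatM m (C + Matrix.single h' k 1)) =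
      if (h : ℕ) + 1 < m then 1
      else if (h : ℕ) + 1 = m then (-1) ^ (sumOdd m C k + sumLt C h' k)
      else (-1) ^ (sumGt C h k + sumLt C h' k) := by
  have hlt : h < h' := by rw [Fin.lt_def]; omega
  have hIoi : Finset.Ioi h = insert h' (Finset.Ioi h') := by
    ext i
    simp only [Finset.mem_Ioi, Finset.mem_insert, Fin.lt_def, Fin.ext_iff]
    omega
  have hG : ∀ b : Fin N, (if b < h' then sumGt C b k else 0) =
      (if b < h then sumGt C b k else 0) + if b = h then sumGt C h k else 0 := by
    intro b
    by_cases hb : b = h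
    · rw [hb, if_pos hlt, if_neg (lt_irrefl h), if_pos rfl, zero_add]
    · have : b < h' ↔ b < h := by
        rw [Fin.lt_def, Fin.lt_def]; rw [Fin.ext_iff] at hb; omega
      simp only [this, hb, if_false, add_zero]
  rw [hatM_add_single, hatM_add_single, hIoi, Finset.sum_insert (by simp)]
  simp only [hG]
  rw [Finset.sum_add_distrib, Finset.sum_ite_eq']
  simp only [Finset.mem_filter, Finset.mem_univ, true_and]
  have h0 : (h : ℕ) < m → ∑ b ∈ Finset.univ.filter (fun b : Fin N => m ≤ (b : ℕ)),
      (if b < h then sumGt C b k else 0) = 0 := by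
    intro hm
    refine Finset.sum_eq_zero fun b hb => if_neg ?_
    rw [Finset.mem_filter] at hb
    rw [Fin.lt_def]
    omega
  have hpow : ∀ {c : ℕ} (a b : ℕ), c = 2 * a + b → (-1 : R) ^ c = (-1) ^ b := by
    rintro c a b rfl
    rw [pow_add, two_mul, pow_add, neg_one_pow_mul_self, one_mul]
  by_cases h1 : (h : ℕ) + 1 < m
  · rw [if_pos h1, if_neg (by omega), if_neg (by omega), if_neg (by omega), h0 (by omega),
      hpow (hatM m C) 0 (by ring), pow_zero]
  · rw [if_neg h1, if_pos (show m ≤ (h' : ℕ) by omega)]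
    by_cases h2 : (h : ℕ) + 1 = m
    · have h3 : sumOdd m C k = sumLt C h' k + ∑ i ∈ Finset.Ioi h', sumLt C i k := by
        rw [sumOdd, ← Finset.sum_insert (f := fun i => sumLt C i k) (by simp)]
        refine Finset.sum_congr ?_ fun _ _ => rfl
        ext i
        simp only [Finset.mem_Ioi, Finset.mem_insert, Fin.lt_def, Fin.ext_iff, Finset.mem_filter,
          Finset.mem_univ, true_and]
        omega
      rw [if_pos h2, if_neg (by omega), if_neg (by omega), h0 (by omega), h3]
      exact (hpow (hatM m C) (∑ i ∈ Finset.Ioi h', sumLt C i k) (by ring)).trans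
        (hpow (sumLt C h' k) _ (by ring)).symm
    · rw [if_neg h2, if_pos (show m ≤ (h : ℕ) by omega), if_pos (show m ≤ (h : ℕ) by omega)]
      exact hpow (hatM m C + (∑ b ∈ Finset.univ.filter (fun b : Fin N => m ≤ (b : ℕ)),
        (if b < h then sumGt C b k else 0)) + ∑ i ∈ Finset.Ioi h', sumLt C i k) _ (by ring)

/-- Moving a unit of `A` from row `s` to row `t` amounts to adding to the common remainder `C`. -/
theorem exists_add_single {A : Matrix (Fin N) (Fin N) ℕ} {t s k : Fin N} (hts : t ≠ s)
    (hk : 1 ≤ A s k) : ∃ C : Matrix (Fin N) (Fin N) ℕ,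
      A = C + Matrix.single s k 1 ∧ shift A t s k = C + Matrix.single t k 1 := by
  have hA : A = A - Matrix.single s k 1 + Matrix.single s k 1 := by
    ext a b
    simp only [Matrix.add_apply, Matrix.sub_apply, Matrix.single_apply]
    split_ifs with h
    · obtain ⟨rfl, rfl⟩ := h
      omega
    · rfl
  refine ⟨A - Matrix.single s k 1, hA, ?_⟩
  have h := shift_add hts hk
  refine add_right_cancel (b := Matrix.single s k 1) (h.trans ?_)
  rw [add_right_comm, ← hA]

variable (q : Rˣ)

/-- The signed coefficient `f⁺` is the coefficient `f` of Du and Gu. -/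
theorem sign_mul_fPlus {A D : Matrix (Fin N) (Fin N) ℕ} {h h' k : Fin N} (hh : (h' : ℕ) = h + 1)
    (hD : IsD A h h' D) (hk : 1 ≤ A h' k) :
    (-1) ^ (hatM m D + hatM m A + hatM m (shift A h h' k)) * fPlus q m A h h' k =
      fDG q m A h h' k := by
  obtain ⟨⟨x, hx⟩, -⟩ := hD
  obtain ⟨C, rfl, hC⟩ := exists_add_single (t := h) (by rw [Ne, Fin.ext_iff]; omega) hk
  rw [hC, hatM_eq_zero (Or.inl hh) hx, zero_add, add_comm (hatM m _), neg_one_pow_hatM hh, fPlus,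
    fDG, sumLt_add_single, sumGt_add_single, sumOdd_add_single, qd, qdd]
  split_ifs with h1 h2 h3 h4 h5 h6 h7
  all_goals first | omega | skip
  · simp
  · rw [pow_add, neg_pow q⁻¹, zpow_add, zpow_neg, zpow_natCast, zpow_natCast, ← inv_pow]
    push_cast
    linear_combination (-1 : R) ^ sumOdd m C k * (↑q⁻¹ : R) ^ sumLt C h' k *
      (q : R) ^ sumGt C h k * neg_one_pow_mul_self (R := R) (sumLt C h' k)
  · rw [pow_add, neg_pow q⁻¹, zpow_neg, zpow_natCast, ← inv_pow]
    push_cast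
    linear_combination (↑q⁻¹ : R) ^ sumLt C h' k *
      neg_one_pow_mul_self (R := R) (sumLt C h' k + sumGt C h k)

/-- The signed coefficient `f⁻` is the coefficient `g` of Du and Gu. -/
theorem sign_mul_fMinus {A D : Matrix (Fin N) (Fin N) ℕ} {h h' k : Fin N} (hh : (h' : ℕ) = h + 1)
    (hD : IsD A h' h D) (hk : 1 ≤ A h k) :
    (-1) ^ (hatM m D + hatM m A + hatM m (shift A h' h k)) * fMinus q m A h h' k =
      gDG q m A h h' k := by
  obtain ⟨⟨x, hx⟩, -⟩ := hD
  obtain ⟨C, rfl, hC⟩ := exists_add_single (t := h') (by rw [Ne, Fin.ext_iff]; omega) hk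
  rw [hC, hatM_eq_zero (Or.inr hh) hx, zero_add, neg_one_pow_hatM hh, fMinus,
    gDG, sumLt_add_single, sumGt_add_single, sumOdd_add_single, qd, qdd]
  split_ifs with h1 h2 h3 h4 h5 h6 h7
  all_goals first | omega | skip
  · simp
  · rw [pow_add]
    push_cast
    linear_combination (-1 : R) ^ sumOdd m C k * neg_one_pow_mul_self (R := R) (sumLt C h' k)
  · rw [pow_add, neg_pow q⁻¹, zpow_neg, zpow_natCast, ← inv_pow]
    push_cast
    linear_combination (↑q⁻¹ : R) ^ sumGt C h k *
      neg_one_pow_mul_self (R := R) (sumLt C h' k + sumGt C h k)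

theorem fPlus_eq_stepCoeff {A : Matrix (Fin N) (Fin N) ℕ} {h h' : Fin N} (hh : (h' : ℕ) = h + 1)
    (k : Fin N) : fPlus q m A h h' k = (stepCoeff q m h h' A k : R) := by
  have hlt : h < h' := by rw [Fin.lt_def]; omega
  rw [fPlus, stepCoeff, if_pos hlt, if_pos hlt]

theorem fMinus_eq_stepCoeff {A : Matrix (Fin N) (Fin N) ℕ} {h h' : Fin N} (hh : (h' : ℕ) = h + 1)
    (k : Fin N) : fMinus q m A h h' k = (stepCoeff q m h' h A k : R) := by
  have hlt : ¬ h' < h := by rw [Fin.lt_def]; omega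
  rw [fMinus, stepCoeff, if_neg hlt, if_neg hlt]

end Signs

/-! ### The multiplication formulas -/

section Formulas

variable {R : Type*} [CommRing R] (q : Rˣ) {m N r : ℕ}

theorem stdEnd_mul {t s : Fin N} (hts : (s : ℕ) = t + 1 ∨ (t : ℕ) = s + 1)
    {A D : Matrix (Fin N) (Fin N) ℕ} (hA : IsSuper m A) (hD' : IsSuper m D) (hD : IsD A t s D) :
    (stdEnd q m D * stdEnd q m A : EndV q m N r) = ∑ k with 1 ≤ A s k,
      ((stepCoeff q m t s A k : R) * gint (A t k + 1) (qh q m t : R)) •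
        stdEnd q m (shift A t s k) := by
  classical
  convert stepEnd_mul q hts hA hD (fun l => ?_) (fun l => ?_) (stdEnd_word q m)
  · rw [stdEnd_word, if_pos hD']
  · rw [stdEnd_word, if_pos hA]

/-- The multiplication formula for the relative norms differs from that for the standard basis by
signs. -/
theorem zeta_mul {t s : Fin N} (hts : (s : ℕ) = t + 1 ∨ (t : ℕ) = s + 1)
    {A D : Matrix (Fin N) (Fin N) ℕ} (hA : IsSuper m A) (hD' : IsSuper m D) (hD : IsD A t s D)
    {f : Fin N → R} (hf : ∀ k, 1 ≤ A s k →
      (-1) ^ (hatM m D + hatM m A + hatM m (shift A t s k)) * (stepCoeff q m t s A k : R) = f k) :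
    (zeta q m D * zeta q m A : EndV q m N r) = ∑ k with 1 ≤ A s k,
      (f k * gint (A t k + 1) (qh q m t : R)) • zeta q m (shift A t s k) := by
  rw [zeta_eq_smul q m D, zeta_eq_smul q m A, smul_mul_smul_comm, stdEnd_mul q hts hA hD' hD,
    Finset.smul_sum]
  refine Finset.sum_congr rfl fun k hk => ?_
  rw [← hf k (Finset.mem_filter.1 hk).2, stdEnd, smul_smul, smul_smul]
  congr 1
  ring

end Formulas

end QSchur

end

open QSchur in
theorem mainTheorem4 (m n r : ℕ) :
    -- the signed coefficients are those of Du and Gu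
    (∀ A ∈ Mset m n r, ∀ h h' : Fin (m + n), (h' : ℕ) = h + 1 →
      (∀ D ∈ Mset m n r, IsD A h h' D → ∀ k, 1 ≤ A h' k →
        (-1) ^ (hatM m D + hatM m A + hatM m (shift A h h' k)) * fPlus qZ m A h h' k =
          fDG qZ m A h h' k) ∧
      (∀ D ∈ Mset m n r, IsD A h' h D → ∀ k, 1 ≤ A h k →
        (-1) ^ (hatM m D + hatM m A + hatM m (shift A h' h k)) * fMinus qZ m A h h' k =
          gDG qZ m A h h' k)) ∧
    ∃ (φ : Matrix (Fin (m + n)) (Fin (m + n)) ℕ → SAlg qZ m (m + n) r)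
      (ζ : Matrix (Fin (m + n)) (Fin (m + n)) ℕ → EndV qZ m (m + n) r)
      (ψ : VT (LaurentPolynomial ℤ) (m + n) r ≃ₗ[LaurentPolynomial ℤ] TSpace qZ m (m + n) r)
      (Θ : EndV qZ m (m + n) r ≃ₐ[LaurentPolynomial ℤ] SAlg qZ m (m + n) r),
      -- `φ` and `ζ` are the standard basis and the relative norm basis, extended by `0`
      (∀ (l mu : Comp (m + n) r), ∀ d ∈ Dcirc m l mu,
        IsPhi qZ m l d mu (φ (jmat l d mu)) ∧
        (ζ (jmat l d mu)).1 = relNorm qZ m l d mu) ∧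
      (∀ A, A ∉ Mset m n r → φ A = 0 ∧ ζ A = 0) ∧
      -- `ψ` is an isomorphism of right modules over the Hecke algebra that induces `Θ`
      (∀ x v, ψ (act qZ m x v) = MulOpposite.op x • ψ v) ∧
      (∀ l : Comp (m + n) r, ψ (vb (LaurentPolynomial ℤ) (m + n) r (word l)) = inT qZ m l 1) ∧
      (∀ (f : EndV qZ m (m + n) r) v, Θ f (ψ v) = ψ (f.1 v)) ∧
      (∀ A ∈ Mset m n r,
        Θ (ζ A) = ((-1) ^ hatM m A : LaurentPolynomial ℤ) • φ A) ∧
      ∀ A ∈ Mset m n r, ∀ h h' : Fin (m + n), (h' : ℕ) = h + 1 →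
        -- the multiplication formulas for the standard basis and, rewritten, for the other one
        (∀ D ∈ Mset m n r, IsD A h h' D →
          φ D * φ A = ∑ k with 1 ≤ A h' k,
            (fPlus qZ m A h h' k * gint (A h k + 1) (qh qZ m h : LaurentPolynomial ℤ)) •
              φ (shift A h h' k) ∧
          ζ D * ζ A = ∑ k with 1 ≤ A h' k,
            (fDG qZ m A h h' k * gint (A h k + 1) (qh qZ m h : LaurentPolynomial ℤ)) •
              ζ (shift A h h' k)) ∧
        (∀ D ∈ Mset m n r, IsD A h' h D →
          φ D * φ A = ∑ k with 1 ≤ A h k,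
            (fMinus qZ m A h h' k * gint (A h' k + 1) (qh qZ m h' : LaurentPolynomial ℤ)) •
              φ (shift A h' h k) ∧
          ζ D * ζ A = ∑ k with 1 ≤ A h k,
            (gDG qZ m A h h' k * gint (A h' k + 1) (qh qZ m h' : LaurentPolynomial ℤ)) •
              ζ (shift A h' h k)) := by
  have hS : ∀ A ∈ Mset m n r, IsSuper m A := by
    rintro _ ⟨l, mu, d, hd, rfl⟩
    exact ((mem_Dcirc_iff l mu d).1 hd).2.2
  refine ⟨fun A _ h h' hh => ⟨fun D _ hD k hk => sign_mul_fPlus qZ hh hD hk,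
      fun D _ hD k hk => sign_mul_fMinus qZ hh hD hk⟩,
    fun A => Theta qZ m (m + n) r (stdEnd qZ m A), zeta qZ m, psi qZ m (m + n) r,
    Theta qZ m (m + n) r,
    fun l mu d hd => ⟨isPhi_Theta qZ m hd, zeta_jmat qZ m hd⟩, fun A hA => ?_, psi_act qZ m,
    fun l => ?_, Theta_psi qZ m, fun A _ => ?_, fun A hA h h' hh => ⟨fun D hD' hD => ⟨?_, ?_⟩,
      fun D hD' hD => ⟨?_, ?_⟩⟩⟩
  · have h := zeta_of_not qZ m hA
    refine ⟨?_, h⟩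
    simp only [stdEnd, h, smul_zero, map_zero]
  · have h := psi_act_word qZ m l 1
    rwa [act_one, Module.End.one_apply, ub_word] at h
  · rw [zeta_eq_smul, map_smul]
  · rw [← map_mul, stdEnd_mul qZ (Or.inl hh) (hS A hA) (hS D hD') hD, map_sum]
    refine Finset.sum_congr rfl fun k _ => ?_
    rw [map_smul, fPlus_eq_stepCoeff qZ hh]
  · refine zeta_mul qZ (Or.inl hh) (hS A hA) (hS D hD') hD fun k hk => ?_
    rw [← fPlus_eq_stepCoeff qZ hh, sign_mul_fPlus qZ hh hD hk]
  · rw [← map_mul, stdEnd_mul qZ (Or.inr hh) (hS A hA) (hS D hD') hD, map_sum]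
    refine Finset.sum_congr rfl fun k _ => ?_
    rw [map_smul, fMinus_eq_stepCoeff qZ hh]
  · refine zeta_mul qZ (Or.inr hh) (hS A hA) (hS D hD') hD fun k hk => ?_
    rw [← fMinus_eq_stepCoeff qZ hh, sign_mul_fMinus qZ hh hD hk]
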